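/- Fix $\sigma\in\mathbb{C}\setminus\{0\}$, put $\sigma_1=\operatorname{Re}\sigma$, $\sigma_2=\operatorname{Im}\sigma$, and consider the equations $$ i\psi_t+\psi_{xx}+\sigma\psi\ln|\psi|+V(t,x)\psi=0 \qquad (\ast) $$ for $\psi\ne0$, where $V$ is a smooth complex-valued potential on a nonempty connected open set $\Omega\subset\mathbb{R}^2$ all of whose sections $t=\mathrm{const}$ are intervals. Let $J$ be the open interval of the values of $t$ on $\Omega$. Let $A_{\ln}(V)$ be the maximal Lie invariance algebra of $(\ast)$: the real Lie algebra of all smooth vector fields $\tau\partial_t+\xi\partial_x+\eta\partial_\psi+\eta^*\partial_{\psi^*}$ on $\{(t,x,\psi):(t,x)\in\Omega,\ \psi\neq0\}$ that satisfy the infinitesimal invariance criterion for $(\ast)$. Let $A^\cap_{\ln}$ be the intersection of the algebras $A_{\ln}(V)$ over all smooth $V$ on $\Omega$. Put $$M=i(\psi\partial_\psi-\psi^*\partial_{\psi^*}),\quad I=\psi\partial_\psi+\psi^*\partial_{\psi^*},\quad G(\chi)=\chi\partial_x+\tfrac12\chi_t x M,$$ $$I'=e^{-\sigma_2t}(\sigma_2I-\sigma_1M)\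 \text{ if }\sigma_2\ne0,\qquad I'=I+\sigma_1tM\ \text{ if }\sigma_2=0,$$ $$G'(\chi)=G(\chi)-e^{-\sigma_2t}\tilde\chi\, I-\sigma_1\Bigl(\int e^{-\sigma_2t}\tilde\chi\,dt\Bigr)M,\qquad \tilde\chi=\int e^{\sigma_2t}w\chi\,dt,$$ with an arbitrary choice of the antiderivatives; here $w=w(t)$ is the function in the potential of Case 2, and $w=\nu$ in Cases 3, 4 and 5. Two potentials are called equivalent if they are connected by a transformation from the usual equivalence group of the class of equations $(\ast)$ with the given $\sigma$, that is, by a point transformation of $(t,x,\psi,\psi^*,V)$, projectable to $(t,x,\psi,\psi^*)$, which maps every equation of the class to an equation of the class. Then $A^\cap_{\ln}$ has the basis $M$, $I'$, and a complete list of inequivalent cases of potentials with $A_{\ln}(V)\neq A^\cap_{\ln}$ is given by Cases 1-5 of the following table. | N | $V$ | Basis of $A_{\ln}(V)$ | |---|---|---| | 0 | $V(t,x)$ | $M,\ I'$ | | 1 | $V(x)$ | $M,\ I',\ \partial_t$ | | 2 | $v(t)x^2+iw(t)x$ | $M,\ I',\ G'(\chi^1),\ G'(\chi^2)$ | | 3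 | $i\nu x$ | $M,\ I',\ \partial_t,\ G'(1),\ G'(t)$ | | 4 | $\mu^2x^2+i\nu x$ | $M,\ I',\ \partial_t,\ G'(e^{-2\mu t}),\ G'(e^{2\mu t})$ | | 5 | $-\mu^2x^2+i\nu x$ | $M,\ I',\ \partial_t,\ G'(\cos2\mu t),\ G'(\sin2\mu t)$ | Here $v$, $w$ are smooth real-valued functions on $J$ with $(v_t,w_t)\not\equiv(0,0)$, the constants $\mu,\nu$ are real with $\mu>0$, $\nu\ge0$, and $\chi^1,\chi^2$ form a fundamental system of solutions of $\chi_{tt}=4v\chi$ on $J$ (such systems exist, and any of them may be taken). $V(x)$ means $V_t=0$ on $\Omega$. Case 0 refers to potentials that are not equivalent to potentials of Cases 1-5, and Case 1 to potentials that are not equivalent to potentials of Cases 2-5. In detail: 1. every potential $V$ with $A_{\ln}(V)\ne A^\cap_{\ln}$ is equivalent to a potential of one of Cases 1-5; 2. in each of Cases 0-5, the listed operators form a basis of $A_{\ln}(V)$; 3. if two potentials from Cases 1-5 are connected by any smooth invertible point transformation of $(t,x,\psi,\psi^*)$, between the respective sets $\{(t,x)\in\Omega,\ \psi\ne0\}$,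 which maps one of the equations $(\ast)$ to the other, then they belong to the same case, and in Cases 3, 4 and 5 also the values of $\nu$ (of $\mu$ and $\nu$, respectively) coincide. -/

import Mathlib

open Set Filter Topology Complex
open scoped ContDiff

noncomputable section

namespace LogNLS

/-- The space of the variables `(t, x, ψ)`. A function of `ψ` and `ψ*` is a function of the complex
number `ψ` that is differentiated over `ℝ`. -/
abbrev TotalSpace : Type := ℝ × ℝ × ℂ

/-- The point `(t, x)` below `(t, x, ψ)`. -/
def base (z : TotalSpace) : ℝ × ℝ := (z.1, z.2.1)

/-- The domains on which potentials are considered: nonempty connected open sets of pairs `(t, x)`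
whose sections `t = const` are intervals. -/
structure IsPotentialDomain (Ω : Set (ℝ × ℝ)) : Prop where
  isOpen : IsOpen Ω
  isConnected : IsConnected Ω
  ordConnected_section : ∀ t : ℝ, {x : ℝ | (t, x) ∈ Ω}.OrdConnected

/-- `V` is a smooth complex-valued potential on `Ω`. Only the values of `V` on `Ω` matter. -/
structure IsPotential (Ω : Set (ℝ × ℝ)) (V : ℝ × ℝ → ℂ) : Prop where
  domain : IsPotentialDomain Ω
  smooth : ContDiffOn ℝ ∞ V Ω

/-- The set of all values of `t` on `Ω`. -/
def timeInterval (Ω : Set (ℝ × ℝ)) : Set ℝ := Prod.fst '' Ω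

/-- The part of the `(t, x, ψ)`-space over `Ω` with `ψ ≠ 0`. -/
def phaseDomain (Ω : Set (ℝ × ℝ)) : Set TotalSpace := {z | base z ∈ Ω ∧ z.2.2 ≠ 0}

/-! ### The equation `i ψ_t + ψ_xx + σ ψ ln|ψ| + V(t,x) ψ = 0` -/

/-- The derivative-free part `σ ψ ln|ψ| + V(t,x) ψ`. -/
def nlsF (σ : ℂ) (V : ℝ × ℝ → ℂ) (z : TotalSpace) : ℂ :=
  σ * z.2.2 * (Real.log ‖z.2.2‖ : ℂ) + V (base z) * z.2.2

/-- The left-hand side of the equation as a function on the jet space. -/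
def nlsL (σ : ℂ) (V : ℝ × ℝ → ℂ) (z : TotalSpace) (ψt ψxx : ℂ) : ℂ :=
  I * ψt + ψxx + nlsF σ V z

/-- The left-hand side of the equation evaluated on a function `ψ = u(t,x)` at the point `p`. -/
def nlsOp (σ : ℂ) (V : ℝ × ℝ → ℂ) (u : ℝ × ℝ → ℂ) (p : ℝ × ℝ) : ℂ :=
  nlsL σ V (p.1, p.2, u p) (fderiv ℝ u p (1, 0))
    (fderiv ℝ (fun q => fderiv ℝ u q (0, 1)) p (0, 1))

/-! ### Lie symmetries -/

/-- A vector field `τ ∂_t + ξ ∂_x + η ∂_ψ + η* ∂_ψ*`, with `τ`, `ξ` real and `η` complex functions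
of `(t, x, ψ, ψ*)`, is given by its coefficients `(τ, ξ, η)`. -/
abbrev Field : Type := TotalSpace → ℝ × ℝ × ℂ

section Prolongation

variable {F : Type} [NormedAddCommGroup F] [NormedSpace ℝ F]

/-- Total derivative `D_t f` of a function of `(t, x, ψ, ψ*)`. -/
def totalDt (f : TotalSpace → F) (z : TotalSpace) (ψt : ℂ) : F := fderiv ℝ f z (1, 0, ψt)

/-- Total derivative `D_x f`. -/
def totalDx (f : TotalSpace → F) (z : TotalSpace) (ψx : ℂ) : F := fderiv ℝ f z (0, 1, ψx)

/-- Second total derivative `D_x (D_x f)`. -/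
def totalDxx (f : TotalSpace → F) (z : TotalSpace) (ψx ψxx : ℂ) : F :=
  fderiv ℝ (fun y => totalDx f y ψx) z (0, 1, ψx) + fderiv ℝ f z (0, 0, ψxx)

end Prolongation

/-- The coefficient of `∂_{ψ_t}` in the prolongation of `Q`:
`D_t (η - τ ψ_t - ξ ψ_x) + τ ψ_tt + ξ ψ_tx`. -/
def prolongT (Q : Field) (z : TotalSpace) (ψt ψx : ℂ) : ℂ :=
  totalDt (fun y => (Q y).2.2) z ψt
    - ((totalDt (fun y => (Q y).1) z ψt : ℝ) : ℂ) * ψt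
    - ((totalDt (fun y => (Q y).2.1) z ψt : ℝ) : ℂ) * ψx

/-- The coefficient of `∂_{ψ_xx}` in the second prolongation of `Q`:
`D_x D_x (η - τ ψ_t - ξ ψ_x) + τ ψ_txx + ξ ψ_xxx`. -/
def prolongXX (Q : Field) (z : TotalSpace) (ψt ψx ψtx ψxx : ℂ) : ℂ :=
  totalDxx (fun y => (Q y).2.2) z ψx ψxx
    - ((totalDxx (fun y => (Q y).1) z ψx ψxx : ℝ) : ℂ) * ψt
    - 2 * ((totalDx (fun y => (Q y).1) z ψx : ℝ) : ℂ) * ψtx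
    - ((totalDxx (fun y => (Q y).2.1) z ψx ψxx : ℝ) : ℂ) * ψx
    - 2 * ((totalDx (fun y => (Q y).2.1) z ψx : ℝ) : ℂ) * ψxx

/-- The second prolongation of `Q` applied to the left-hand side `i ψ_t + ψ_xx + nlsF`. -/
def prolongedAction (σ : ℂ) (V : ℝ × ℝ → ℂ) (Q : Field) (z : TotalSpace)
    (ψt ψx ψtx ψxx : ℂ) : ℂ :=
  I * prolongT Q z ψt ψx + prolongXX Q z ψt ψx ψtx ψxx + fderiv ℝ (nlsF σ V) z (Q z)

/-- Infinitesimal invariance criterion: the prolonged field annihilates the left-hand side of the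
equation on the manifold that the equation determines in the second-order jet space. -/
def IsLieSymmetry (σ : ℂ) (Ω : Set (ℝ × ℝ)) (V : ℝ × ℝ → ℂ) (Q : Field) : Prop :=
  ∀ z ∈ phaseDomain Ω, ∀ ψt ψx ψtx ψxx : ℂ,
    nlsL σ V z ψt ψxx = 0 → prolongedAction σ V Q z ψt ψx ψtx ψxx = 0

/-- The maximal Lie invariance algebra: all smooth vector fields on the domain `ψ ≠ 0` over `Ω` that
satisfy the infinitesimal invariance criterion. -/
def lieAlgebra (σ : ℂ) (Ω : Set (ℝ × ℝ)) (V : ℝ × ℝ → ℂ) : Set (phaseDomain Ω → ℝ × ℝ × ℂ) :=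
  (phaseDomain Ω).domRestrict '' {Q : Field | ContDiffOn ℝ ∞ Q (phaseDomain Ω) ∧ IsLieSymmetry σ Ω V Q}

/-- The common part of the maximal Lie invariance algebras for all potentials on `Ω`. -/
def kernelAlgebra (σ : ℂ) (Ω : Set (ℝ × ℝ)) : Set (phaseDomain Ω → ℝ × ℝ × ℂ) :=
  ⋂ (V : ℝ × ℝ → ℂ) (_ : IsPotential Ω V), lieAlgebra σ Ω V

/-- The vector fields `b 0, …, b (n-1)`, restricted to the domain `ψ ≠ 0` over `Ω`, form a basis of
the real vector space `A`. -/
def HasBasis (Ω : Set (ℝ × ℝ)) {n : ℕ} (A : Set (phaseDomain Ω → ℝ × ℝ × ℂ)) (b : Fin n → Field) :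
    Prop :=
  LinearIndependent ℝ (fun i => (phaseDomain Ω).domRestrict (b i)) ∧
    (Submodule.span ℝ (range fun i => (phaseDomain Ω).domRestrict (b i)) : Set _) = A

/-- `∂_t`. -/
def fieldDt : Field := fun _ => (1, 0, 0)

/-- `M = i (ψ ∂_ψ - ψ* ∂_ψ*)`. -/
def fieldM : Field := fun z => (0, 0, I * z.2.2)

/-- `I = ψ ∂_ψ + ψ* ∂_ψ*`. -/
def fieldI : Field := fun z => (0, 0, z.2.2)

/-- `f(t) Q`. -/
def timeMul (f : ℝ → ℝ) (Q : Field) : Field := fun z => f z.1 • Q z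

/-- `G(χ) = χ ∂_x + (1/2) χ_t x M`. -/
def fieldG (χ : ℝ → ℝ) : Field :=
  fun z => (0, χ z.1, 0) + (deriv χ z.1 * z.2.1 / 2) • fieldM z

/-- `I' = e^{-σ₂ t} (σ₂ I - σ₁ M)` if `σ₂ ≠ 0`, and `I' = I + σ₁ t M` if `σ₂ = 0`. -/
def fieldI' (σ : ℂ) : Field :=
  if σ.im = 0 then fieldI + timeMul (fun t => σ.re * t) fieldM
  else timeMul (fun t => Real.exp (-σ.im * t)) (σ.im • fieldI - σ.re • fieldM)

/-- `Q` is the field `G'(χ) = G(χ) - e^{-σ₂ t} χ̃ I - σ₁ (∫ e^{-σ₂ t} χ̃ dt) M`, where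
`χ̃ = ∫ e^{σ₂ t} w χ dt`, for some choice of the antiderivatives on the interval `J`. -/
def IsG' (σ : ℂ) (J : Set ℝ) (w χ : ℝ → ℝ) (Q : Field) : Prop :=
  ∃ χ₁ κ : ℝ → ℝ,
    (∀ t ∈ J, HasDerivAt χ₁ (Real.exp (σ.im * t) * w t * χ t) t) ∧
    (∀ t ∈ J, HasDerivAt κ (Real.exp (-σ.im * t) * χ₁ t) t) ∧
    Q = fieldG χ - timeMul (fun t => Real.exp (-σ.im * t) * χ₁ t) fieldI
          - timeMul (fun t => σ.re * κ t) fieldM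

/-- `χ¹`, `χ²` form a fundamental system of solutions of `χ_tt = 4 v χ` on `J`. -/
def IsFundamentalSystem (J : Set ℝ) (v χ₁ χ₂ : ℝ → ℝ) : Prop :=
  (ContDiffOn ℝ ∞ χ₁ J ∧ ∀ t ∈ J, deriv (deriv χ₁) t = 4 * v t * χ₁ t) ∧
  (ContDiffOn ℝ ∞ χ₂ J ∧ ∀ t ∈ J, deriv (deriv χ₂) t = 4 * v t * χ₂ t) ∧
  LinearIndependent ℝ ![J.domRestrict χ₁, J.domRestrict χ₂]

/-! ### Point transformations and equivalence -/

/-- `f` restricts to a smooth diffeomorphism of `s` onto `t`. -/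
def IsDiffeoOn {X Y : Type} [NormedAddCommGroup X] [NormedSpace ℝ X] [NormedAddCommGroup Y]
    [NormedSpace ℝ Y] (f : X → Y) (s : Set X) (t : Set Y) : Prop :=
  ContDiffOn ℝ ∞ f s ∧ MapsTo f s t ∧
    ∃ g : Y → X, ContDiffOn ℝ ∞ g t ∧ MapsTo g t s ∧ LeftInvOn g f s ∧ RightInvOn g f t

/-- The second prolongation of `φ` maps the equation with the potential `V` to the equation with the
potential `V'`: whenever `φ` takes the graph of a function `u` near a point to the graph of a function
`u'`, the 2-jet of `u` at the point satisfies the first equation if and only if the 2-jet of `u'` at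
the corresponding point satisfies the second one. -/
def TransformsEquation (σ : ℂ) (Ω : Set (ℝ × ℝ)) (V V' : ℝ × ℝ → ℂ)
    (φ : TotalSpace → TotalSpace) : Prop :=
  ∀ p ∈ Ω, ∀ u u' : ℝ × ℝ → ℂ, u p ≠ 0 →
    ContDiffAt ℝ 2 u p → ContDiffAt ℝ 2 u' (base (φ (p.1, p.2, u p))) →
    (∀ᶠ q in 𝓝 p, u' (base (φ (q.1, q.2, u q))) = (φ (q.1, q.2, u q)).2.2) →
    (nlsOp σ V u p = 0 ↔ nlsOp σ V' u' (base (φ (p.1, p.2, u p))) = 0)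

/-- The equations with the potentials `V` on `Ω` and `V'` on `Ω'` are connected by a point
transformation of the variables `(t, x, ψ, ψ*)`. -/
def PointEquivalent (σ : ℂ) (Ω : Set (ℝ × ℝ)) (V : ℝ × ℝ → ℂ) (Ω' : Set (ℝ × ℝ))
    (V' : ℝ × ℝ → ℂ) : Prop :=
  ∃ φ : TotalSpace → TotalSpace,
    IsDiffeoOn φ (phaseDomain Ω) (phaseDomain Ω') ∧ TransformsEquation σ Ω V V' φ

/-- `φ` takes the equation with the potential `V` to the one with the potential `V'`, and the values
of the potentials are connected by `V' = θ(t, x, ψ, ψ*, V)`. -/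
def TransformsPotential (σ : ℂ) (Ω : Set (ℝ × ℝ)) (V V' : ℝ × ℝ → ℂ)
    (φ : TotalSpace → TotalSpace) (θ : TotalSpace × ℂ → ℂ) : Prop :=
  (∀ z ∈ phaseDomain Ω, V' (base (φ z)) = θ (z, V (base z))) ∧ TransformsEquation σ Ω V V' φ

/-- `(φ, θ)` belongs to the usual equivalence group of the class of equations with fixed `σ` and
arbitrary potential: it is a point transformation of the variables `(t, x, ψ, ψ*, V)` over `Ω` that
is projectable to `(t, x, ψ, ψ*)` and takes every equation of the class to an equation of the class. -/
def IsEquivalenceTransformation (σ : ℂ) (Ω Ω' : Set (ℝ × ℝ)) (φ : TotalSpace → TotalSpace)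
    (θ : TotalSpace × ℂ → ℂ) : Prop :=
  IsDiffeoOn φ (phaseDomain Ω) (phaseDomain Ω') ∧
  IsDiffeoOn (fun q : TotalSpace × ℂ => (φ q.1, θ q))
    (phaseDomain Ω ×ˢ univ) (phaseDomain Ω' ×ˢ univ) ∧
  ∀ V, IsPotential Ω V → ∃ V', IsPotential Ω' V' ∧ TransformsPotential σ Ω V V' φ θ

/-- Equivalence of potentials with respect to the equivalence group of the class. -/
def GroupEquivalent (σ : ℂ) (Ω : Set (ℝ × ℝ)) (V : ℝ × ℝ → ℂ) (Ω' : Set (ℝ × ℝ))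
    (V' : ℝ × ℝ → ℂ) : Prop :=
  ∃ (φ : TotalSpace → TotalSpace) (θ : TotalSpace × ℂ → ℂ),
    IsEquivalenceTransformation σ Ω Ω' φ θ ∧ TransformsPotential σ Ω V V' φ θ

/-! ### The classification list -/

/-- `V = V(x)`, i.e. `V_t = 0`. -/
def IsStationary (Ω : Set (ℝ × ℝ)) (V : ℝ × ℝ → ℂ) : Prop :=
  ∀ p ∈ Ω, fderiv ℝ V p (1, 0) = 0

/-- `V = v(t) x² + i w(t) x` with `(v_t, w_t) ≠ (0, 0)`. -/
def IsCase2 (Ω : Set (ℝ × ℝ)) (V : ℝ × ℝ → ℂ) (v w : ℝ → ℝ) : Prop :=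
  ContDiffOn ℝ ∞ v (timeInterval Ω) ∧ ContDiffOn ℝ ∞ w (timeInterval Ω) ∧
  (∃ t ∈ timeInterval Ω, deriv v t ≠ 0 ∨ deriv w t ≠ 0) ∧
  ∀ p ∈ Ω, V p = (v p.1 : ℂ) * (p.2 : ℂ) ^ 2 + I * (w p.1 : ℂ) * (p.2 : ℂ)

/-- `V = i ν x` with `ν ≥ 0`. -/
def IsCase3 (Ω : Set (ℝ × ℝ)) (V : ℝ × ℝ → ℂ) (ν : ℝ) : Prop :=
  0 ≤ ν ∧ ∀ p ∈ Ω, V p = I * (ν : ℂ) * (p.2 : ℂ)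

/-- `V = μ² x² + i ν x` with `μ > 0`, `ν ≥ 0`. -/
def IsCase4 (Ω : Set (ℝ × ℝ)) (V : ℝ × ℝ → ℂ) (μ ν : ℝ) : Prop :=
  0 < μ ∧ 0 ≤ ν ∧ ∀ p ∈ Ω, V p = (μ : ℂ) ^ 2 * (p.2 : ℂ) ^ 2 + I * (ν : ℂ) * (p.2 : ℂ)

/-- `V = -μ² x² + i ν x` with `μ > 0`, `ν ≥ 0`. -/
def IsCase5 (Ω : Set (ℝ × ℝ)) (V : ℝ × ℝ → ℂ) (μ ν : ℝ) : Prop :=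
  0 < μ ∧ 0 ≤ ν ∧ ∀ p ∈ Ω, V p = -(μ : ℂ) ^ 2 * (p.2 : ℂ) ^ 2 + I * (ν : ℂ) * (p.2 : ℂ)

/-- `V` on `Ω` is of one of the forms of Cases 2-5. -/
def IsSpecialized (Ω : Set (ℝ × ℝ)) (V : ℝ × ℝ → ℂ) : Prop :=
  (∃ v w, IsCase2 Ω V v w) ∨ (∃ ν, IsCase3 Ω V ν) ∨ (∃ μ ν, IsCase4 Ω V μ ν) ∨
    (∃ μ ν, IsCase5 Ω V μ ν)

/-- `V = V(x)`, not equivalent to a potential of one of the more specialized Cases 2-5. -/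
def IsCase1 (σ : ℂ) (Ω : Set (ℝ × ℝ)) (V : ℝ × ℝ → ℂ) : Prop :=
  IsStationary Ω V ∧
    ∀ Ω' V', IsPotential Ω' V' → IsSpecialized Ω' V' → ¬ GroupEquivalent σ Ω V Ω' V'

/-- The potential `V` on `Ω` belongs to Case `n` of the list (`n = 1, …, 5`). -/
def IsCase (σ : ℂ) (n : ℕ) (Ω : Set (ℝ × ℝ)) (V : ℝ × ℝ → ℂ) : Prop :=
  match n with
  | 1 => IsCase1 σ Ω V
  | 2 => ∃ v w, IsCase2 Ω V v w
  | 3 => ∃ ν, IsCase3 Ω V ν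
  | 4 => ∃ μ ν, IsCase4 Ω V μ ν
  | 5 => ∃ μ ν, IsCase5 Ω V μ ν
  | _ => False

/-- The operators `M`, `I'`, `∂_t`, `G'(χ¹)`, `G'(χ²)` form a basis of the maximal Lie invariance
algebra, whichever antiderivatives are used in `G'`. -/
def HasStationaryBasis (σ : ℂ) (Ω : Set (ℝ × ℝ)) (V : ℝ × ℝ → ℂ) (w χ₁ χ₂ : ℝ → ℝ) : Prop :=
  (∃ Q₁ Q₂, IsG' σ (timeInterval Ω) w χ₁ Q₁ ∧ IsG' σ (timeInterval Ω) w χ₂ Q₂) ∧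
  ∀ Q₁ Q₂, IsG' σ (timeInterval Ω) w χ₁ Q₁ → IsG' σ (timeInterval Ω) w χ₂ Q₂ →
    HasBasis Ω (lieAlgebra σ Ω V) ![fieldM, fieldI' σ, fieldDt, Q₁, Q₂]

/-- The operators `M`, `I'`, `G'(χ¹)`, `G'(χ²)` form a basis of the maximal Lie invariance algebra,
whichever antiderivatives are used in `G'`. -/
def HasNonstationaryBasis (σ : ℂ) (Ω : Set (ℝ × ℝ)) (V : ℝ × ℝ → ℂ) (w χ₁ χ₂ : ℝ → ℝ) : Prop :=
  (∃ Q₁ Q₂, IsG' σ (timeInterval Ω) w χ₁ Q₁ ∧ IsG' σ (timeInterval Ω) w χ₂ Q₂) ∧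
  ∀ Q₁ Q₂, IsG' σ (timeInterval Ω) w χ₁ Q₁ → IsG' σ (timeInterval Ω) w χ₂ Q₂ →
    HasBasis Ω (lieAlgebra σ Ω V) ![fieldM, fieldI' σ, Q₁, Q₂]

end LogNLS

end

/-! The infinitesimal criterion holds identically in the free jet variables, so it splits. Splitting
with respect to `ψ_tx`, `ψ_x`, `ψ_xx` makes `τ` a function of `t` with `τ_t = 2 ξ_x` and makes `η`
affine in `ψ`. Splitting with respect to the logarithm then removes the inhomogeneous part of `η`
and gives `τ_t = 0`, so `ξ = χ(t)`. Every symmetry is therefore given by a constant `τ`, a real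
function `χ` and a complex function `ρ` of `t`, subject to the single classifying condition `τ V_t +
χ V_x = χ_tt x / 2 - i ρ_t - σ Re ρ`. This is `IsLieSymmetry.exists_isSymData`, with converse
`IsSymData.isLieSymmetry`. For `τ = χ = 0` the condition is a real linear system for `ρ` whose
two-dimensional solution space is spanned by the coefficients of `M` and `I'` (`exists_rho_eq`);
this is the kernel.

An extra symmetry has `τ ≠ 0` or `τ = 0`, `χ ≢ 0`. In the second case `χ V_xx = χ_tt / 2`, and zeros
of `χ` are isolated, so `V` is quadratic in `x` with a real leading coefficient
(`IsSymData.isQuadratic`). In the first case one may take `τ = 1`, and straightening the field to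
`∂_t` makes the potential stationary (`IsSymData.exists_stationary`). Both reductions use explicit
equivalence transformations: a time-dependent shift of `x`, possibly with a reflection, combined
with a multiplication of `ψ` (`GaugeData`). The same transformations bring a quadratic potential to
`v x² + i w x` (`exists_gaugeData_reduced`), which gives Cases 2-5 according to whether `v`, `w` are
constant and to the sign of `v`. For such potentials the classifying condition becomes `τ v_t = τ
w_t = 0`, `χ_tt = 4 v χ` and a linear equation for `ρ` (`IsReduced.symData_iff`), and the bases
follow from linear ODE theory.

Inequivalence requires the form of an arbitrary point transformation between two equations. Testing
the transformation on graphs of quadratic polynomials (`TransformsEquation.jet`) shows that the new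
time depends on `t` only, the new `x` on `(t, x)` only, and the new `ψ` is linear in `ψ` or in its
conjugate; the logarithm forces `T_t = ±1` and `X_x = ±1`. Potentials are then related up to time
reversal, translations, reflection and adding a function affine in `x` whose `x`-coefficient is real
(`PointEquivalent.exists_potentialForm`). Hence being quadratic is invariant, and so are `v` and
`w²` for reduced potentials, which separates the cases and their parameters. -/

namespace LogNLS

/-! ### Antiderivatives and linear differential equations on an open interval. -/

section OneVariable

variable {E : Type*} [NormedAddCommGroup E] [NormedSpace ℝ E]

theorem contDiffOn_infty_of_hasDerivAt {J : Set ℝ} (hJ : IsOpen J) {f g : ℝ → E}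
    (hf : ∀ t ∈ J, HasDerivAt f (g t) t) (hg : ContDiffOn ℝ ∞ g J) : ContDiffOn ℝ ∞ f J := by
  rw [contDiffOn_infty_iff_deriv_of_isOpen hJ]
  exact ⟨fun t ht => (hf t ht).differentiableAt.differentiableWithinAt,
    hg.congr fun t ht => (hf t ht).deriv⟩

theorem contDiffOn_deriv {J : Set ℝ} (hJ : IsOpen J) {f : ℝ → E}
    (hf : ContDiffOn ℝ ∞ f J) : ContDiffOn ℝ ∞ (deriv f) J :=
  ((contDiffOn_infty_iff_deriv_of_isOpen hJ).1 hf).2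

theorem hasDerivAt_deriv_of_contDiffOn {J : Set ℝ} (hJ : IsOpen J) {f : ℝ → E}
    (hf : ContDiffOn ℝ ∞ f J) {t : ℝ} (ht : t ∈ J) : HasDerivAt f (deriv f t) t :=
  ((hf.contDiffAt (hJ.mem_nhds ht)).differentiableAt (by simp)).hasDerivAt

theorem hasDerivAt_integral_of_continuousOn [CompleteSpace E] {J : Set ℝ} (hJ : IsOpen J)
    (hJc : J.OrdConnected) {f : ℝ → E} (hf : ContinuousOn f J) {a t : ℝ} (ha : a ∈ J)
    (ht : t ∈ J) : HasDerivAt (fun s => ∫ τ in a..s, f τ) (f t) t := by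
  refine intervalIntegral.integral_hasDerivAt_right
    (hf.mono (hJc.uIcc_subset ha ht)).intervalIntegrable
    (hf.stronglyMeasurableAtFilter hJ t ht) (hf.continuousAt (hJ.mem_nhds ht))

theorem exists_antiderivative [CompleteSpace E] {J : Set ℝ} (hJ : IsOpen J)
    (hJc : J.OrdConnected) {f : ℝ → E} (hf : ContDiffOn ℝ ∞ f J) :
    ∃ g : ℝ → E, ContDiffOn ℝ ∞ g J ∧ ∀ t ∈ J, HasDerivAt g (f t) t := by
  rcases J.eq_empty_or_nonempty with rfl | ⟨a, ha⟩
  · exact ⟨0, by simp, by simp⟩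
  have h : ∀ t ∈ J, HasDerivAt (fun s => ∫ τ in a..s, f τ) (f t) t := fun t ht =>
    hasDerivAt_integral_of_continuousOn hJ hJc hf.continuousOn ha ht
  exact ⟨_, contDiffOn_infty_of_hasDerivAt hJ h hf, h⟩

theorem eq_of_hasDerivAt_eq {J : Set ℝ} (hJ : IsOpen J) (hJc : J.OrdConnected) {f g h : ℝ → E}
    (hf : ∀ t ∈ J, HasDerivAt f (h t) t) (hg : ∀ t ∈ J, HasDerivAt g (h t) t) :
    ∃ c, ∀ t ∈ J, f t = g t + c := by
  obtain ⟨c, hc⟩ := hJ.exists_is_const_of_deriv_eq_zero hJc.isPreconnected (f := f - g)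
    (fun t ht => ((hf t ht).sub (hg t ht)).differentiableAt.differentiableWithinAt)
    (fun t ht => by rw [((hf t ht).sub (hg t ht)).deriv]; simp)
  exact ⟨c, fun t ht => by rw [← hc t ht]; simp⟩

/-- The terms of the Picard series of `y' = A y + b`, `y a = y₀`. -/
noncomputable def picardTerm (A : ℝ → E →L[ℝ] E) (b : ℝ → E) (a : ℝ) (y₀ : E) : ℕ → ℝ → E
  | 0 => fun t => y₀ + ∫ s in a..t, b s
  | n + 1 => fun t => ∫ s in a..t, A s (picardTerm A b a y₀ n s)

variable {J : Set ℝ} {A : ℝ → E →L[ℝ] E} {b : ℝ → E} {a : ℝ} {y₀ : E}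

theorem continuousOn_picardTerm [CompleteSpace E] (hJ : IsOpen J) (hJc : J.OrdConnected) (hA : ContinuousOn A J)
    (hb : ContinuousOn b J) (ha : a ∈ J) (n : ℕ) : ContinuousOn (picardTerm A b a y₀ n) J := by
  induction n with
  | zero =>
    intro t ht
    exact ((hasDerivAt_integral_of_continuousOn hJ hJc hb ha ht).const_add
      y₀).continuousAt.continuousWithinAt
  | succ n ih =>
    intro t ht
    exact (hasDerivAt_integral_of_continuousOn hJ hJc (hA.clm_apply ih) ha
      ht).continuousAt.continuousWithinAt

/-- Each iterated integration of `|s - a| ^ n` gains a factor `|t - a| / (n + 1)`. The resulting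
factorials give convergence on every compact subinterval, so that no smallness of the interval is
needed. -/
theorem norm_picardTerm_le {K C : ℝ} (hK : 0 ≤ K) {c d : ℝ} (ha : a ∈ Icc c d)
    (hAK : ∀ t ∈ Icc c d, ‖A t‖ ≤ K) (hC : ∀ t ∈ Icc c d, ‖picardTerm A b a y₀ 0 t‖ ≤ C) (n : ℕ) :
    ∀ t ∈ Icc c d, ‖picardTerm A b a y₀ n t‖ ≤ C * ((K * |t - a|) ^ n / n.factorial) := by
  have hC0 : 0 ≤ C := (norm_nonneg _).trans (hC a ha)
  induction n with
  | zero => simpa using hC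
  | succ n ih =>
    intro t ht
    calc ‖picardTerm A b a y₀ (n + 1) t‖
        ≤ ∫ s in uIoc a t, K * (C * ((K * |s - a|) ^ n / n.factorial)) := by
          rw [picardTerm, intervalIntegral.norm_intervalIntegral_eq]
          apply MeasureTheory.norm_integral_le_of_norm_le (Continuous.integrableOn_uIoc (by fun_prop))
          apply (MeasureTheory.ae_restrict_mem measurableSet_uIoc).mono
          intro s hs
          have hs' : s ∈ Icc c d := subset_trans uIoc_subset_uIcc (uIcc_subset_Icc ha ht) hs
          exact ((A s).le_opNorm _).trans
            (mul_le_mul (hAK s hs') (ih s hs') (norm_nonneg _) hK)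
      _ = ∫ s in uIoc a t, (K ^ (n + 1) * C / n.factorial) * |s - a| ^ n := by
          congr 1; ext s; rw [mul_pow]; ring
      _ = C * ((K * |t - a|) ^ (n + 1) / (n + 1).factorial) := by
          rw [MeasureTheory.integral_const_mul, integral_pow_abs_sub_uIoc, Nat.factorial_succ,
            mul_pow]
          push_cast
          field_simp

/-- Global solvability of linear differential equations. -/
theorem exists_linear_ode_solution [CompleteSpace E] (hJ : IsOpen J) (hJc : J.OrdConnected) (hA : ContinuousOn A J)
    (hb : ContinuousOn b J) (ha : a ∈ J) (y₀ : E) :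
    ∃ y : ℝ → E, y a = y₀ ∧ ∀ t ∈ J, HasDerivAt y (A t (y t) + b t) t := by
  -- The solution is the sum of the Picard series. All terms except the zeroth vanish at `a`, which
  -- gives the initial value.
  set g := picardTerm A b a y₀ with hg
  refine ⟨fun t => ∑' n, g n t, ?_, fun t ht => ?_⟩
  · beta_reduce
    rw [tsum_eq_single 0]
    · simp [hg, picardTerm]
    · intro n hn
      obtain ⟨m, rfl⟩ := Nat.exists_eq_succ_of_ne_zero hn
      simp [hg, picardTerm]
  · have hcont := continuousOn_picardTerm (y₀ := y₀) hJ hJc hA hb ha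
    -- A compact interval inside `J` with both `a` and `t` in its interior: compactness gives
    -- uniform bounds, and interior points allow termwise differentiation.
    obtain ⟨c, hc, hcJ⟩ : ∃ c < min a t, Icc c (min a t) ⊆ J := by
      have hm : min a t ∈ J := by rcases min_choice a t with h | h <;> rw [h] <;> assumption
      obtain ⟨ε, hε, h⟩ := Metric.isOpen_iff.1 hJ _ hm
      refine ⟨min a t - ε / 2, by linarith, fun s hs => h ?_⟩
      rw [Metric.mem_ball, Real.dist_eq, abs_lt]
      exact ⟨by linarith [hs.1], by linarith [hs.2]⟩
    obtain ⟨d, hd, hdJ⟩ : ∃ d > max a t, Icc (max a t) d ⊆ J := by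
      have hm : max a t ∈ J := by rcases max_choice a t with h | h <;> rw [h] <;> assumption
      obtain ⟨ε, hε, h⟩ := Metric.isOpen_iff.1 hJ _ hm
      refine ⟨max a t + ε / 2, by linarith, fun s hs => h ?_⟩
      rw [Metric.mem_ball, Real.dist_eq, abs_lt]
      exact ⟨by linarith [hs.1], by linarith [hs.2]⟩
    have hcd : Icc c d ⊆ J :=
      hJc.out (hcJ (left_mem_Icc.2 hc.le)) (hdJ (right_mem_Icc.2 hd.le))
    have haI : a ∈ Ioo c d :=
      ⟨hc.trans_le (min_le_left _ _), (le_max_left _ _).trans_lt hd⟩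
    have htI : t ∈ Ioo c d :=
      ⟨hc.trans_le (min_le_right _ _), (le_max_right _ _).trans_lt hd⟩
    obtain ⟨K, hK⟩ := isCompact_Icc.exists_bound_of_continuousOn (hA.mono hcd)
    obtain ⟨B, hB⟩ := isCompact_Icc.exists_bound_of_continuousOn (hb.mono hcd)
    obtain ⟨C, hC⟩ := isCompact_Icc.exists_bound_of_continuousOn ((hcont 0).mono hcd)
    have hK0 : 0 ≤ K := (norm_nonneg _).trans (hK a (Ioo_subset_Icc_self haI))
    have hC0 : 0 ≤ C := (norm_nonneg _).trans (hC a (Ioo_subset_Icc_self haI))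
    have hbound : ∀ n, ∀ s ∈ Icc c d,
        ‖g n s‖ ≤ C * ((K * (d - c)) ^ n / n.factorial) := fun n s hs => by
      refine (norm_picardTerm_le hK0 (Ioo_subset_Icc_self haI) hK hC n s hs).trans ?_
      have : |s - a| ≤ d - c := by
        rw [abs_le]; exact ⟨by linarith [hs.1, haI.2], by linarith [hs.2, haI.1]⟩
      gcongr
    have hsum : Summable fun n : ℕ => C * ((K * (d - c)) ^ n / n.factorial) :=
      (Real.summable_pow_div_factorial _).mul_left C
    -- Termwise derivatives: the zeroth is `b` and the derivative of term `m + 1` is `A` applied to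
    -- term `m`. This index shift turns the differentiated series into `b + A y`.
    let g' : ℕ → ℝ → E := fun n s => Nat.casesOn n (b s) fun m => A s (g m s)
    let u : ℕ → ℝ := fun n => Nat.casesOn n B fun m => K * (C * ((K * (d - c)) ^ m / m.factorial))
    have hu : Summable u := (summable_nat_add_iff 1).1 (hsum.mul_left K)
    have hder : ∀ n s, s ∈ Ioo c d → HasDerivAt (g n) (g' n s) s := by
      intro n s hs
      have hsJ := hcd (Ioo_subset_Icc_self hs)
      cases n with
      | zero => exact (hasDerivAt_integral_of_continuousOn hJ hJc hb ha hsJ).const_add y₀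
      | succ n =>
        exact hasDerivAt_integral_of_continuousOn hJ hJc (hA.clm_apply (hcont n)) ha hsJ
    have hder' : ∀ n s, s ∈ Ioo c d → ‖g' n s‖ ≤ u n := by
      intro n s hs
      have hs' := Ioo_subset_Icc_self hs
      cases n with
      | zero => exact hB s hs'
      | succ n =>
        exact ((A s).le_opNorm _).trans (mul_le_mul (hK s hs') (hbound n s hs') (norm_nonneg _) hK0)
    have hs0 : ∀ s ∈ Icc c d, Summable fun n => g n s := fun s hs =>
      .of_norm_bounded hsum fun n => hbound n s hs
    have h := hasDerivAt_tsum_of_isPreconnected hu isOpen_Ioo isPreconnected_Ioo hder hder' haI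
      (hs0 a (Ioo_subset_Icc_self haI)) htI
    have hg's : Summable fun n => g' n t := .of_norm_bounded hu fun n => hder' n t htI
    rw [hg's.tsum_eq_zero_add] at h
    convert! h using 1
    rw [add_comm, (A t).map_tsum (hs0 t (Ioo_subset_Icc_self htI))]
    rfl

end OneVariable

/-- Global solvability of `χ'' = q χ + f`. -/
theorem exists_second_order_ode_solution {J : Set ℝ} (hJ : IsOpen J) (hJc : J.OrdConnected)
    {q f : ℝ → ℝ} (hq : ContDiffOn ℝ ∞ q J) (hf : ContDiffOn ℝ ∞ f J) {a : ℝ} (ha : a ∈ J)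
    (c d : ℝ) : ∃ χ : ℝ → ℝ, ContDiffOn ℝ ∞ χ J ∧ χ a = c ∧ deriv χ a = d ∧
      ∀ t ∈ J, deriv (deriv χ) t = q t * χ t + f t := by
  -- The equivalent first-order system for the pair `(χ, χ')`.
  let A : ℝ → (ℝ × ℝ) →L[ℝ] ℝ × ℝ := fun t =>
    (ContinuousLinearMap.snd ℝ ℝ ℝ).prod (q t • ContinuousLinearMap.fst ℝ ℝ ℝ)
  have hA : ContinuousOn A J := by
    have h1 : A = fun t => (ContinuousLinearMap.snd ℝ ℝ ℝ).prod (0 : ℝ × ℝ →L[ℝ] ℝ) +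
        q t • ContinuousLinearMap.prod (0 : ℝ × ℝ →L[ℝ] ℝ) (ContinuousLinearMap.fst ℝ ℝ ℝ) := by
      ext t : 1
      ext <;> simp [A]
    rw [h1]
    exact continuousOn_const.add (hq.continuousOn.smul continuousOn_const)
  obtain ⟨y, hya, hy⟩ := exists_linear_ode_solution hJ hJc hA
    (b := fun t => (0, f t)) (continuousOn_const.prodMk hf.continuousOn) ha (c, d)
  have h1 : ∀ t ∈ J, HasDerivAt (fun t => (y t).1) (y t).2 t := fun t ht => by
    simpa [A] using! (hasFDerivAt_fst (𝕜 := ℝ) (p := y t)).comp_hasDerivAt t (hy t ht)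
  have h2 : ∀ t ∈ J, HasDerivAt (fun t => (y t).2) (q t * (y t).1 + f t) t := fun t ht => by
    simpa [A] using! (hasFDerivAt_snd (𝕜 := ℝ) (p := y t)).comp_hasDerivAt t (hy t ht)
  -- Bootstrapping: the derivatives of both components are smooth combinations of the components, so
  -- each round gains one order of smoothness.
  have hn : ∀ n : ℕ, ContDiffOn ℝ n (fun t => (y t).1) J ∧ ContDiffOn ℝ n (fun t => (y t).2) J := by
    intro n
    induction n with
    | zero =>
      exact ⟨contDiffOn_zero.2 fun t ht => (h1 t ht).continuousAt.continuousWithinAt,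
        contDiffOn_zero.2 fun t ht => (h2 t ht).continuousAt.continuousWithinAt⟩
    | succ n ih =>
      push_cast
      rw [contDiffOn_succ_iff_deriv_of_isOpen hJ, contDiffOn_succ_iff_deriv_of_isOpen hJ]
      refine ⟨⟨fun t ht => (h1 t ht).differentiableAt.differentiableWithinAt, by simp,
        ih.2.congr fun t ht => (h1 t ht).deriv⟩,
        ⟨fun t ht => (h2 t ht).differentiableAt.differentiableWithinAt, by simp, ?_⟩⟩
      exact (((hq.of_le (by exact_mod_cast le_top)).mul ih.1).add
        (hf.of_le (by exact_mod_cast le_top))).congr fun t ht => (h2 t ht).deriv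
  refine ⟨fun t => (y t).1, contDiffOn_infty.2 fun n => (hn n).1, by simp [hya],
    by rw [(h1 a ha).deriv, hya], fun t ht => ?_⟩
  rw [← (h2 t ht).deriv]
  exact EventuallyEq.deriv_eq (by filter_upwards [hJ.mem_nhds ht] with s hs using (h1 s hs).deriv)

/-- A solution of a homogeneous equation `χ'' = q χ` with vanishing Cauchy data vanishes. -/
theorem eq_zero_of_second_order_ode {J : Set ℝ} (hJ : IsOpen J) (hJc : J.OrdConnected)
    {χ : ℝ → ℝ} (hχ : ContDiffOn ℝ ∞ χ J)
    (hode : ∀ t ∈ J, ∃ q : ℝ → ℝ, ContinuousAt q t ∧ ∀ᶠ s in 𝓝 t, deriv (deriv χ) s = q s * χ s)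
    {a : ℝ} (ha : a ∈ J) (h0 : χ a = 0) (h1 : deriv χ a = 0) : ∀ t ∈ J, χ t = 0 := by
  have hχ' := contDiffOn_deriv hJ hχ
  have hloc : ∀ t ∈ J, χ t = 0 → deriv χ t = 0 → ∀ᶠ s in 𝓝 t, χ s = 0 := by
    intro t ht e0 e1
    obtain ⟨q, hqc, hq⟩ := hode t ht
    have hqb : ∀ᶠ s in 𝓝 t, |q s| ≤ |q t| + 1 := by
      filter_upwards [hqc.abs.eventually (gt_mem_nhds (lt_add_one _))] with s hs using hs.le
    let v : ℝ → ℝ × ℝ → ℝ × ℝ := fun s y => (y.2, q s * y.1)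
    have hL : ∀ᶠ s in 𝓝 t, LipschitzOnWith (⟨|q t| + 1, by positivity⟩ : NNReal) (v s) univ := by
      filter_upwards [hqb] with s hs
      refine LipschitzOnWith.of_dist_le_mul fun y _ z _ => ?_
      change max |y.2 - z.2| |q s * y.1 - q s * z.1| ≤ (|q t| + 1) * max |y.1 - z.1| |y.2 - z.2|
      rw [← mul_sub, abs_mul]
      have A1 := le_max_left |y.1 - z.1| |y.2 - z.2|
      have A2 := le_max_right |y.1 - z.1| |y.2 - z.2|
      have A3 := abs_nonneg (q t)
      have A4 := abs_nonneg (y.1 - z.1)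
      have A5 := abs_nonneg (y.2 - z.2)
      refine max_le ?_ ?_
      · nlinarith
      · exact mul_le_mul hs A1 A4 (by positivity)
    have hsol : (fun s => (χ s, deriv χ s)) =ᶠ[𝓝 t] fun _ => ((0 : ℝ), (0 : ℝ)) := by
      refine ODE_solution_unique_of_eventually hL ?_ ?_ (by simp [e0, e1])
      · filter_upwards [hJ.mem_nhds ht, hq] with s hs hqs
        refine ⟨?_, mem_univ _⟩
        have := (hasDerivAt_deriv_of_contDiffOn hJ hχ hs).prodMk
          (hasDerivAt_deriv_of_contDiffOn hJ hχ' hs)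
        rwa [hqs] at this
      · refine Eventually.of_forall fun s => ⟨?_, mem_univ _⟩
        simpa [v] using! hasDerivAt_const s ((0 : ℝ), (0 : ℝ))
    filter_upwards [hsol] with s hs using (Prod.ext_iff.1 hs).1
  -- Local uniqueness shows that `J` is covered by two open sets: points near which `χ` vanishes,
  -- and points with nonzero Cauchy data. They are disjoint within `J`, so connectedness excludes
  -- that both are nonempty there.
  let Z : Set ℝ := {t | ∀ᶠ s in 𝓝 t, χ s = 0}
  have hZ : IsOpen Z := isOpen_iff_mem_nhds.2 fun t ht => eventually_eventually_nhds.2 ht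
  by_contra! hne
  obtain ⟨b, hb, hbne⟩ := hne
  let W : Set ℝ := {t ∈ J | ¬ (χ t = 0 ∧ deriv χ t = 0)}
  have hW : IsOpen W := by
    have : W = {t ∈ J | (χ t, deriv χ t) ∈ ({(0, 0)}ᶜ : Set (ℝ × ℝ))} := by
      ext t; simp [W]
    rw [this]
    exact (hχ.continuousOn.prodMk hχ'.continuousOn).isOpen_inter_preimage hJ
      isOpen_compl_singleton
  obtain ⟨t, htJ, htZ, htW⟩ := hJc.isPreconnected Z W hZ hW
    (fun t ht => by
      by_cases h : χ t = 0 ∧ deriv χ t = 0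
      · exact Or.inl (hloc t ht h.1 h.2)
      · exact Or.inr ⟨ht, h⟩)
    ⟨a, ha, hloc a ha h0 h1⟩ ⟨b, hb, hb, fun h => hbne h.1⟩
  refine htW.2 ⟨htZ.self_of_nhds, ?_⟩
  have : χ =ᶠ[𝓝 t] fun _ => 0 := htZ
  rw [this.deriv_eq]; simp

end LogNLS

/-! ### Domains with interval sections, partial derivatives and functions of `t` alone. -/

namespace LogNLS

section Domain

variable {Ω : Set (ℝ × ℝ)} {F : Type*} [NormedAddCommGroup F] [NormedSpace ℝ F]

theorem IsPotentialDomain.isOpen_timeInterval (h : IsPotentialDomain Ω) :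
    IsOpen (timeInterval Ω) := isOpenMap_fst _ h.isOpen

theorem IsPotentialDomain.ordConnected_timeInterval (h : IsPotentialDomain Ω) :
    (timeInterval Ω).OrdConnected :=
  (h.isConnected.isPreconnected.image _ continuous_fst.continuousOn).ordConnected

theorem mem_timeInterval {p : ℝ × ℝ} (hp : p ∈ Ω) : p.1 ∈ timeInterval Ω := ⟨p, hp, rfl⟩

theorem isOpen_phaseDomain (h : IsOpen Ω) : IsOpen (phaseDomain Ω) :=
  (h.preimage (by unfold base; fun_prop)).inter
    ((isOpen_compl_singleton (x := (0 : ℂ))).preimage (f := fun z : TotalSpace => z.2.2)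
      (by fun_prop))

theorem isPreconnected_ne_zero : IsPreconnected {c : ℂ | c ≠ 0} :=
  (isConnected_compl_singleton_of_one_lt_rank
    (by rw [Complex.rank_real_complex]; exact Nat.one_lt_ofNat) (0 : ℂ)).isPreconnected

theorem isPreconnected_phaseDomain (h : IsPreconnected Ω) : IsPreconnected (phaseDomain Ω) := by
  have h1 := (h.prod isPreconnected_ne_zero).image
    (fun q : (ℝ × ℝ) × ℂ => ((q.1.1, q.1.2, q.2) : TotalSpace))
    (Continuous.continuousOn (by fun_prop))
  convert h1 using 1
  ext z
  constructor
  · rintro ⟨h1, h2⟩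
    exact ⟨((z.1, z.2.1), z.2.2), ⟨h1, h2⟩, rfl⟩
  · rintro ⟨q, ⟨h1, h2⟩, rfl⟩
    exact ⟨h1, h2⟩

theorem IsPotentialDomain.exists_mem (h : IsPotentialDomain Ω) : ∃ p, p ∈ Ω :=
  h.isConnected.nonempty

/-- The partial derivative with respect to `x`. -/
noncomputable def dX (f : ℝ × ℝ → F) (p : ℝ × ℝ) : F := fderiv ℝ f p (0, 1)

/-- The partial derivative with respect to `t`. -/
noncomputable def dT (f : ℝ × ℝ → F) (p : ℝ × ℝ) : F := fderiv ℝ f p (1, 0)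

theorem contDiffOn_fderiv_apply {E : Type*} [NormedAddCommGroup E] [NormedSpace ℝ E] {s : Set E}
    (hs : IsOpen s) {f : E → F} (hf : ContDiffOn ℝ ∞ f s) (v : E) :
    ContDiffOn ℝ ∞ (fun x => fderiv ℝ f x v) s :=
  ((contDiffOn_infty_iff_fderiv_of_isOpen hs).1 hf).2.clm_apply contDiffOn_const

theorem contDiffOn_dX (hΩ : IsOpen Ω) {f : ℝ × ℝ → F} (hf : ContDiffOn ℝ ∞ f Ω) :
    ContDiffOn ℝ ∞ (dX f) Ω := contDiffOn_fderiv_apply hΩ hf _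

theorem differentiableAt_of_contDiffOn {E : Type*} [NormedAddCommGroup E] [NormedSpace ℝ E]
    {s : Set E} (hs : IsOpen s) {f : E → F} (hf : ContDiffOn ℝ ∞ f s) {x : E} (hx : x ∈ s) :
    DifferentiableAt ℝ f x :=
  (hf.contDiffAt (hs.mem_nhds hx)).differentiableAt (by simp)

theorem fderiv_prod_apply {f : ℝ × ℝ → F} {p : ℝ × ℝ} (a b : ℝ) :
    fderiv ℝ f p (a, b) = a • dT f p + b • dX f p := by
  unfold dT dX
  rw [← map_smul, ← map_smul, ← map_add]
  simp

theorem hasDerivAt_dX {f : ℝ × ℝ → F} {p : ℝ × ℝ} (hf : DifferentiableAt ℝ f p) :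
    HasDerivAt (fun x => f (p.1, x)) (dX f p) p.2 := by
  have h : HasDerivAt (fun x : ℝ => (p.1, x)) ((0 : ℝ), (1 : ℝ)) p.2 :=
    (hasDerivAt_const _ _).prodMk (hasDerivAt_id _)
  exact hf.hasFDerivAt.comp_hasDerivAt p.2 h

theorem hasDerivAt_dT {f : ℝ × ℝ → F} {p : ℝ × ℝ} (hf : DifferentiableAt ℝ f p) :
    HasDerivAt (fun t => f (t, p.2)) (dT f p) p.1 := by
  have h : HasDerivAt (fun t : ℝ => (t, p.2)) ((1 : ℝ), (0 : ℝ)) p.1 :=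
    (hasDerivAt_id _).prodMk (hasDerivAt_const _ _)
  exact hf.hasFDerivAt.comp_hasDerivAt p.1 h

theorem IsPotentialDomain.isOpen_section (h : IsPotentialDomain Ω) (t : ℝ) :
    IsOpen {x : ℝ | (t, x) ∈ Ω} := h.isOpen.preimage (by fun_prop)

/-- A smooth function with vanishing derivative with respect to `x` is a smooth function of `t`. -/
theorem IsPotentialDomain.exists_eq_comp_fst (h : IsPotentialDomain Ω) {f : ℝ × ℝ → F}
    (hf : ContDiffOn ℝ ∞ f Ω) (hx : ∀ p ∈ Ω, dX f p = 0) :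
    ∃ g : ℝ → F, ContDiffOn ℝ ∞ g (timeInterval Ω) ∧ ∀ p ∈ Ω, f p = g p.1 := by
  have hsec : ∀ t x y, (t, x) ∈ Ω → (t, y) ∈ Ω → f (t, x) = f (t, y) := by
    intro t x y hx' hy'
    obtain ⟨a, ha⟩ := (h.isOpen_section t).exists_is_const_of_deriv_eq_zero
      (h.ordConnected_section t).isPreconnected (f := fun x => f (t, x))
      (fun x hx' => (hasDerivAt_dX (p := (t, x)) (differentiableAt_of_contDiffOn h.isOpen hf
        hx')).differentiableAt.differentiableWithinAt)
      (fun x hx' => by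
        rw [(hasDerivAt_dX (p := (t, x))
          (differentiableAt_of_contDiffOn h.isOpen hf hx')).deriv, hx _ hx']; rfl)
    rw [ha x hx', ha y hy']
  classical
  have hex : ∀ t : ℝ, ∃ x : ℝ, t ∈ timeInterval Ω → (t, x) ∈ Ω := by
    intro t
    by_cases ht : t ∈ timeInterval Ω
    · obtain ⟨p, hp, rfl⟩ := ht
      exact ⟨p.2, fun _ => hp⟩
    · exact ⟨0, fun h => absurd h ht⟩
  choose X hX using hex
  have key : ∀ p ∈ Ω, f p = f (p.1, X p.1) := fun p hp =>
    hsec p.1 p.2 (X p.1) hp (hX _ (mem_timeInterval hp))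
  refine ⟨fun t => f (t, X t), fun t ht => ?_, key⟩
  -- The chosen abscissa `X` need not even be continuous. Near a fixed `t` it is replaced by the
  -- frozen value `X t`, which remains in the section at nearby times and gives the same values of
  -- `f`.
  have h1 : ContDiffAt ℝ ∞ (fun s => f (s, X t)) t :=
    ContDiffAt.comp t (hf.contDiffAt (h.isOpen.mem_nhds (hX t ht)))
      (contDiffAt_id.prodMk contDiffAt_const)
  refine (h1.congr_of_eventuallyEq ?_).contDiffWithinAt
  have : ∀ᶠ s in 𝓝 t, (s, X t) ∈ Ω :=
    (Continuous.prodMk_left (X t)).continuousAt.eventually (h.isOpen.mem_nhds (hX t ht))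
  filter_upwards [this] with s hs using (key _ hs).symm

theorem contDiffOn_comp_fst {f : ℝ → F} (hf : ContDiffOn ℝ ∞ f (timeInterval Ω)) :
    ContDiffOn ℝ ∞ (fun p : ℝ × ℝ => f p.1) Ω :=
  hf.comp contDiff_fst.contDiffOn fun _ hp => mem_timeInterval hp

theorem hasFDerivAt_comp_fst {f : ℝ → F} {f' : F} {p : ℝ × ℝ} (hf : HasDerivAt f f' p.1) :
    HasFDerivAt (fun p : ℝ × ℝ => f p.1)
      ((ContinuousLinearMap.fst ℝ ℝ ℝ).smulRight f') p := by
  have := hf.hasFDerivAt.comp p (hasFDerivAt_fst (𝕜 := ℝ) (E := ℝ) (F := ℝ) (p := p))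
  convert! this using 1

theorem dX_comp_fst {f : ℝ → F} {p : ℝ × ℝ} (hf : DifferentiableAt ℝ f p.1) :
    dX (fun p : ℝ × ℝ => f p.1) p = 0 := by
  rw [dX, (hasFDerivAt_comp_fst hf.hasDerivAt).fderiv]; simp

theorem dT_comp_fst {f : ℝ → F} {p : ℝ × ℝ} (hf : DifferentiableAt ℝ f p.1) :
    dT (fun p : ℝ × ℝ => f p.1) p = deriv f p.1 := by
  rw [dT, (hasFDerivAt_comp_fst hf.hasDerivAt).fderiv]; simp

end Domain

end LogNLS

/-! ### Determining equations of Lie symmetries. -/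

namespace LogNLS

theorem two_le_infty : (2 : WithTop ℕ∞) ≤ ∞ := by
  have h : ∀ n : ℕ, (n : WithTop ℕ∞) ≤ ∞ := fun n => by exact_mod_cast le_top
  exact h 2

theorem fderiv_apply_eq {E F : Type*} [NormedAddCommGroup E] [NormedSpace ℝ E]
    [NormedAddCommGroup F] [NormedSpace ℝ F] {f : E → F} {z v : E} {d : F}
    (hf : DifferentiableAt ℝ f z) (h : HasDerivAt (fun s : ℝ => f (z + s • v)) d 0) :
    fderiv ℝ f z v = d := by
  have : HasLineDerivAt ℝ f (fderiv ℝ f z v) z v := hf.hasFDerivAt.hasLineDerivAt v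
  exact HasDerivAt.unique this h

theorem fderiv_fderiv_apply {E F : Type*} [NormedAddCommGroup E] [NormedSpace ℝ E]
    [NormedAddCommGroup F] [NormedSpace ℝ F] {s : Set E} (hs : IsOpen s) {f : E → F}
    (hf : ContDiffOn ℝ ∞ f s) {z : E} (hz : z ∈ s) (v w : E) :
    fderiv ℝ (fun y => fderiv ℝ f y v) z w = fderiv ℝ (fderiv ℝ f) z w v := by
  have h : DifferentiableAt ℝ (fderiv ℝ f) z := differentiableAt_of_contDiffOn hs
    ((contDiffOn_infty_iff_fderiv_of_isOpen hs).1 hf).2 hz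
  rw [fderiv_clm_apply h (by fun_prop)]
  simp

theorem fderiv_fderiv_symm {E F : Type*} [NormedAddCommGroup E] [NormedSpace ℝ E]
    [NormedAddCommGroup F] [NormedSpace ℝ F] {s : Set E} (hs : IsOpen s) {f : E → F}
    (hf : ContDiffOn ℝ ∞ f s) {z : E} (hz : z ∈ s) (v w : E) :
    fderiv ℝ (fderiv ℝ f) z v w = fderiv ℝ (fderiv ℝ f) z w v :=
  ((hf.contDiffAt (hs.mem_nhds hz)).isSymmSndFDerivAt (by
    simpa using two_le_infty)).eq v w

/-- The function `log |c|` is half the logarithm of `c.re² + c.im²`. Its real differential `Re (h /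
c)` is not complex linear in `h`, which is why the real part of `ρ` enters the classifying
condition. -/
theorem hasDerivAt_log_norm {c h : ℂ} (hc : c ≠ 0) :
    HasDerivAt (fun s : ℝ => Real.log ‖c + s * h‖) (h / c).re 0 := by
  have hn : 0 < normSq c := normSq_pos.2 hc
  have h1 : HasDerivAt (fun s : ℝ => (c.re + s * h.re) ^ 2 + (c.im + s * h.im) ^ 2)
      (2 * (c.re * h.re + c.im * h.im)) 0 := by
    have e1 := (((hasDerivAt_id (0 : ℝ)).mul_const h.re).const_add c.re).pow 2
    have e2 := (((hasDerivAt_id (0 : ℝ)).mul_const h.im).const_add c.im).pow 2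
    refine (e1.add e2).congr_deriv ?_
    simp; ring
  have h2 := (h1.log (by simp; rw [normSq_apply] at hn; nlinarith)).div_const 2
  convert! h2 using 1
  · ext s
    rw [Complex.norm_def, Real.log_sqrt (normSq_nonneg _), normSq_apply]
    simp [sq]
  · rw [Complex.div_re, normSq_apply]
    simp [sq]
    field_simp

theorem differentiableAt_nlsF (σ : ℂ) {V : ℝ × ℝ → ℂ} {z : TotalSpace} (hz : z.2.2 ≠ 0)
    (hV : DifferentiableAt ℝ V (base z)) : DifferentiableAt ℝ (nlsF σ V) z := by
  have h1 : DifferentiableAt ℝ (fun z : TotalSpace => z.2.2) z := by fun_prop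
  have h2 : DifferentiableAt ℝ (fun z : TotalSpace => Real.log ‖z.2.2‖) z :=
    (h1.norm ℝ hz).log (by simpa using hz)
  have h3 : DifferentiableAt ℝ (fun z : TotalSpace => (Real.log ‖z.2.2‖ : ℂ)) z :=
    Complex.ofRealCLM.differentiableAt.comp z h2
  have h4 : DifferentiableAt ℝ (fun z : TotalSpace => V (base z)) z :=
    hV.comp z (by unfold base; fun_prop)
  exact ((h1.const_mul σ).mul h3).add (h4.mul h1)

theorem fderiv_nlsF (σ : ℂ) {V : ℝ × ℝ → ℂ} {z : TotalSpace} (hz : z.2.2 ≠ 0)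
    (hV : DifferentiableAt ℝ V (base z)) (a b : ℝ) (h : ℂ) :
    fderiv ℝ (nlsF σ V) z (a, b, h) =
      (a * dT V (base z) + b * dX V (base z)) * z.2.2
        + (σ * Real.log ‖z.2.2‖ + V (base z)) * h + σ * z.2.2 * ((h / z.2.2).re : ℝ) := by
  refine fderiv_apply_eq (differentiableAt_nlsF σ hz hV) ?_
  have h1 : HasDerivAt (fun s : ℝ => z.2.2 + s * h) h 0 := by
    simpa using ((hasDerivAt_id (0 : ℝ)).ofReal_comp.mul_const h).const_add z.2.2
  have h2 := (hasDerivAt_log_norm (h := h) hz).ofReal_comp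
  have h3 : HasDerivAt (fun s : ℝ => V (base z + s • (a, b))) (fderiv ℝ V (base z) (a, b)) 0 :=
    hV.hasFDerivAt.hasLineDerivAt (a, b)
  have h4 := ((h1.const_mul σ).mul h2).add (h3.mul h1)
  convert! h4 using 1
  rw [fderiv_prod_apply]
  simp
  ring

theorem contDiffOn_components {D : Set TotalSpace} {Q : Field} (hQ : ContDiffOn ℝ ∞ Q D) :
    ContDiffOn ℝ ∞ (fun z => (Q z).1) D ∧ ContDiffOn ℝ ∞ (fun z => (Q z).2.1) D ∧
      ContDiffOn ℝ ∞ (fun z => (Q z).2.2) D :=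
  ⟨hQ.fst, hQ.snd.fst, hQ.snd.snd⟩

theorem clm_total_apply {F : Type*} [NormedAddCommGroup F] [NormedSpace ℝ F]
    (A : TotalSpace →L[ℝ] F) (s y : ℝ) (c : ℂ) :
    A (s, y, c) = s • A (1, 0, 0) + y • A (0, 1, 0) + A (0, 0, c) := by
  rw [← map_smul, ← map_smul, ← map_add, ← map_add]
  simp

theorem clm_total_psi {F : Type*} [NormedAddCommGroup F] [NormedSpace ℝ F]
    (A : TotalSpace →L[ℝ] F) (c : ℂ) :
    A (0, 0, c) = c.re • A (0, 0, 1) + c.im • A (0, 0, I) := by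
  rw [← map_smul, ← map_smul, ← map_add]
  congr 1
  simp

/-- Determining equations that the infinitesimal invariance criterion implies at one point. -/
structure Determining (σ : ℂ) (V : ℝ × ℝ → ℂ) (τ ξ : TotalSpace → ℝ) (η : TotalSpace → ℂ)
    (z : TotalSpace) : Prop where
  tau_fiber : ∀ (y : ℝ) (c : ℂ), fderiv ℝ τ z (0, y, c) = 0
  xi_psi : ∀ c : ℂ, fderiv ℝ ξ z (0, 0, c) = 0
  tau_t : fderiv ℝ τ z (1, 0, 0) = 2 * fderiv ℝ ξ z (0, 1, 0)
  eta_psi : ∀ c : ℂ, fderiv ℝ η z (0, 0, c) = c * fderiv ℝ η z (0, 0, 1)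
  eta_psi_psi : ∀ c : ℂ, fderiv ℝ (fderiv ℝ η) z (0, 0, c) (0, 0, c) = 0
  eta_x_psi : 2 * fderiv ℝ (fderiv ℝ η) z (0, 1, 0) (0, 0, 1) =
    I * fderiv ℝ ξ z (1, 0, 0) + fderiv ℝ (fderiv ℝ ξ) z (0, 1, 0) (0, 1, 0)
  zero_order : I * fderiv ℝ η z (1, 0, 0) - fderiv ℝ η z (0, 0, 1) * nlsF σ V z
    + fderiv ℝ τ z (1, 0, 0) * nlsF σ V z + fderiv ℝ (fderiv ℝ η) z (0, 1, 0) (0, 1, 0)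
    + fderiv ℝ (nlsF σ V) z (τ z, ξ z, η z) = 0

/-- The mixed derivative `ψ_tx` is absent from the equation and hence unconstrained; its coefficient
in the criterion is `-2 D_x τ`. As `ψ_x` is arbitrary as well, `τ_x` and `τ_ψ` vanish separately. -/
theorem IsLieSymmetry.tau_fiber {σ : ℂ} {Ω : Set (ℝ × ℝ)} {V : ℝ × ℝ → ℂ} {Q : Field}
    (hs : IsLieSymmetry σ Ω V Q) {z : TotalSpace} (hz : z ∈ phaseDomain Ω) (y : ℝ) (c : ℂ) :
    fderiv ℝ (fun y => (Q y).1) z (0, y, c) = 0 := by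
  have h1 : ∀ a : ℂ, fderiv ℝ (fun y => (Q y).1) z (0, 1, a) = 0 := by
    intro a
    have hF : nlsL σ V z (I * nlsF σ V z) 0 = 0 := by
      unfold nlsL; linear_combination nlsF σ V z * I_sq
    have e0 := hs z hz _ a 0 _ hF
    have e1 := hs z hz _ a 1 _ hF
    unfold prolongedAction prolongXX totalDx at e0 e1
    have : ((fderiv ℝ (fun y => (Q y).1) z (0, 1, a) : ℝ) : ℂ) = 0 := by
      linear_combination (e0 - e1) / 2
    exact_mod_cast this
  have h0 := h1 0
  have hc := h1 c
  rw [clm_total_apply] at hc ⊢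
  simp only [zero_smul, one_smul, zero_add] at *
  rw [h0] at hc ⊢
  simpa using hc

/-- On the solution manifold `ψ_t = i (ψ_xx + F)`, so the criterion is an identity in the free
variables `a = ψ_x` and `b = ψ_xx`. The equations are read off from finitely many values of `a` and
`b`. -/
theorem IsLieSymmetry.determining {σ : ℂ} {Ω : Set (ℝ × ℝ)} {V : ℝ × ℝ → ℂ} {Q : Field}
    (hΩ : IsOpen Ω) (hQ : ContDiffOn ℝ ∞ Q (phaseDomain Ω))
    (hs : IsLieSymmetry σ Ω V Q) {z : TotalSpace} (hz : z ∈ phaseDomain Ω) :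
    Determining σ V (fun z => (Q z).1) (fun z => (Q z).2.1) (fun z => (Q z).2.2) z := by
  have hD := isOpen_phaseDomain hΩ
  obtain ⟨hτ, hξ, hη⟩ := contDiffOn_components hQ
  have hmem := hD.mem_nhds hz
  set F := nlsF σ V z with hF
  -- the equation on the solution manifold
  have hE : ∀ z ∈ phaseDomain Ω, ∀ a b : ℂ,
      I * (fderiv ℝ (fun z => (Q z).2.2) z (1, 0, 0)
          + fderiv ℝ (fun z => (Q z).2.2) z (0, 0, I * (b + nlsF σ V z))
          - fderiv ℝ (fun z => (Q z).1) z (1, 0, 0) * (I * (b + nlsF σ V z))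
          - (fderiv ℝ (fun z => (Q z).2.1) z (1, 0, 0)
            + fderiv ℝ (fun z => (Q z).2.1) z (0, 0, I * (b + nlsF σ V z)) : ℝ) * a)
        + (fderiv ℝ (fderiv ℝ fun z => (Q z).2.2) z (0, 1, a) (0, 1, a)
          + fderiv ℝ (fun z => (Q z).2.2) z (0, 0, b))
        - (fderiv ℝ (fderiv ℝ fun z => (Q z).2.1) z (0, 1, a) (0, 1, a)
          + fderiv ℝ (fun z => (Q z).2.1) z (0, 0, b) : ℝ) * a
        - 2 * (fderiv ℝ (fun z => (Q z).2.1) z (0, 1, 0)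
          + fderiv ℝ (fun z => (Q z).2.1) z (0, 0, a) : ℝ) * b
        + fderiv ℝ (nlsF σ V) z (Q z) = 0 := by
    intro z hz a b
    have h := hs z hz (I * (b + nlsF σ V z)) a 0 b (by
      unfold nlsL; linear_combination (b + nlsF σ V z) * I_sq)
    have hτx : fderiv ℝ (fderiv ℝ fun z => (Q z).1) z (0, 1, a) (0, 1, a) = 0 := by
      rw [← fderiv_fderiv_apply hD hτ hz]
      have : (fun y => fderiv ℝ (fun z => (Q z).1) y (0, 1, a)) =ᶠ[𝓝 z] fun _ => 0 := by
        filter_upwards [hD.mem_nhds hz] with y hy using hs.tau_fiber hy 1 a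
      rw [this.fderiv_eq]; simp
    have hτc := fun c => hs.tau_fiber hz 0 c
    unfold prolongedAction prolongT prolongXX totalDxx totalDx totalDt at h
    rw [fderiv_fderiv_apply hD hη hz, fderiv_fderiv_apply hD hξ hz, fderiv_fderiv_apply hD hτ hz,
      hτx, hs.tau_fiber hz, clm_total_apply _ 1 0 (I * (b + nlsF σ V z)),
      clm_total_apply _ 1 0 (I * (b + nlsF σ V z)), clm_total_apply _ 1 0 (I * (b + nlsF σ V z)),
      hτc, clm_total_apply (fderiv ℝ (fun z => (Q z).2.1) z) 0 1 a] at h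
    simp only [one_smul, zero_smul, add_zero, zero_add, ofReal_zero] at h
    refine Eq.trans ?_ h
    ring
  have hξψ : ∀ z ∈ phaseDomain Ω, ∀ c : ℂ, fderiv ℝ (fun z => (Q z).2.1) z (0, 0, c) = 0 := by
    intro z hz c
    have e11 := hE z hz 1 1
    have e10 := hE z hz 1 0
    have e01 := hE z hz 0 1
    have e00 := hE z hz 0 0
    have hI : ((0 : ℝ), (0 : ℝ), I * (1 + nlsF σ V z)) = (0, 0, I) + (0, 0, I * (0 + nlsF σ V z)) := by
      simp; ring
    rw [hI] at e11 e01
    have h0 : ((0 : ℝ), (0 : ℝ), (0 : ℂ)) = 0 := rfl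
    simp only [map_add, h0, map_zero] at e11 e10 e01 e00
    push_cast at e11 e10 e01 e00
    -- The mixed second difference in `(a, b)` isolates the terms containing both variables, and
    -- these come from `ξ_ψ` only. As `ξ` is real, the real and imaginary parts of the identity kill
    -- both fiber derivatives of `ξ`.
    have key : I * (fderiv ℝ (fun z => (Q z).2.1) z (0, 0, I) : ℂ)
        + 3 * (fderiv ℝ (fun z => (Q z).2.1) z (0, 0, 1) : ℂ) = 0 := by
      linear_combination -(e11 - e10 - e01 + e00)
    have k1 := congrArg Complex.re key
    have k2 := congrArg Complex.im key
    simp at k1 k2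
    rw [clm_total_psi, k1, k2]; simp
  have hξ2 : ∀ w c, fderiv ℝ (fderiv ℝ fun z => (Q z).2.1) z w (0, 0, c) = 0 := by
    intro w c
    rw [← fderiv_fderiv_apply hD hξ hz]
    have : (fun y => fderiv ℝ (fun z => (Q z).2.1) y (0, 0, c)) =ᶠ[𝓝 z] fun _ => 0 := by
      filter_upwards [hmem] with y hy using hξψ y hy c
    rw [this.fderiv_eq]; simp
  have hξxx : ∀ a : ℂ, fderiv ℝ (fderiv ℝ fun z => (Q z).2.1) z (0, 1, a) (0, 1, a) =
      fderiv ℝ (fderiv ℝ fun z => (Q z).2.1) z (0, 1, 0) (0, 1, 0) := by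
    intro a
    have hsym := fderiv_fderiv_symm hD hξ hz (0, 0, a) (0, 1, 0)
    have : ((0 : ℝ), (1 : ℝ), a) = (0, 1, 0) + (0, 0, a) := by simp
    rw [this]
    simp only [map_add, add_apply]
    rw [hsym, hξ2, hξ2]
    simp
  have hη2 : ∀ a : ℂ, fderiv ℝ (fderiv ℝ fun z => (Q z).2.2) z (0, 1, a) (0, 1, a) =
      fderiv ℝ (fderiv ℝ fun z => (Q z).2.2) z (0, 1, 0) (0, 1, 0)
      + 2 * fderiv ℝ (fderiv ℝ fun z => (Q z).2.2) z (0, 1, 0) (0, 0, a)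
      + fderiv ℝ (fderiv ℝ fun z => (Q z).2.2) z (0, 0, a) (0, 0, a) := by
    intro a
    have hsym := fderiv_fderiv_symm hD hη hz (0, 0, a) (0, 1, 0)
    have : ((0 : ℝ), (1 : ℝ), a) = (0, 1, 0) + (0, 0, a) := by simp
    rw [this]
    simp only [map_add, add_apply]
    rw [hsym]
    ring
  have hE' : ∀ a b : ℂ, I * (fderiv ℝ (fun z => (Q z).2.2) z (1, 0, 0)
          + fderiv ℝ (fun z => (Q z).2.2) z (0, 0, I * (b + F))
          - fderiv ℝ (fun z => (Q z).1) z (1, 0, 0) * (I * (b + F))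
          - fderiv ℝ (fun z => (Q z).2.1) z (1, 0, 0) * a)
        + (fderiv ℝ (fderiv ℝ fun z => (Q z).2.2) z (0, 1, 0) (0, 1, 0)
          + 2 * fderiv ℝ (fderiv ℝ fun z => (Q z).2.2) z (0, 1, 0) (0, 0, a)
          + fderiv ℝ (fderiv ℝ fun z => (Q z).2.2) z (0, 0, a) (0, 0, a)
          + fderiv ℝ (fun z => (Q z).2.2) z (0, 0, b))
        - fderiv ℝ (fderiv ℝ fun z => (Q z).2.1) z (0, 1, 0) (0, 1, 0) * a
        - 2 * fderiv ℝ (fun z => (Q z).2.1) z (0, 1, 0) * b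
        + fderiv ℝ (nlsF σ V) z (Q z) = 0 := by
    intro a b
    have h := hE z hz a b
    rw [hξxx, hη2, hξψ z hz, hξψ z hz, hξψ z hz] at h
    simpa only [add_zero] using h
  have h0 : ((0 : ℝ), (0 : ℝ), (0 : ℂ)) = 0 := rfl
  have hadd : ∀ b : ℂ, ((0 : ℝ), (0 : ℝ), I * (b + F)) = (0, 0, I * b) + (0, 0, I * F) := by
    intro b; simp; ring
  have e00 := hE' 0 0
  -- The values `b = 1` and `b = I` separate the complex linear and antilinear parts of the
  -- dependence on `b`: one yields `τ_t = 2 ξ_x`, the other complex linearity of `η_ψ`.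
  have e1 := hE' 0 1
  have eI := hE' 0 I
  rw [hadd] at e00 e1 eI
  have hII : ((0 : ℝ), (0 : ℝ), I * I) = -((0 : ℝ), (0 : ℝ), (1 : ℂ)) := by simp
  rw [hII] at eI
  simp only [map_add, map_neg, h0, map_zero, mul_zero, mul_one, add_zero, zero_add] at e00 e1 eI
  have ht : (fderiv ℝ (fun z => (Q z).1) z (1, 0, 0) : ℂ) =
      2 * fderiv ℝ (fun z => (Q z).2.1) z (0, 1, 0) := by
    linear_combination ((e1 - e00) - I * (eI - e00)) / 2 +
      (-fderiv ℝ (fun z => (Q z).2.2) z (0, 0, 1) / 2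
        + fderiv ℝ (fun z => (Q z).1) z (1, 0, 0) * (1 - I ^ 2 / 2)
        - fderiv ℝ (fun z => (Q z).2.1) z (0, 1, 0)) * I_sq
  have hAI : fderiv ℝ (fun z => (Q z).2.2) z (0, 0, I) =
      I * fderiv ℝ (fun z => (Q z).2.2) z (0, 0, 1) := by
    linear_combination (-I) * (e1 - e00) + (fderiv ℝ (fun z => (Q z).2.2) z (0, 0, I)
      - fderiv ℝ (fun z => (Q z).1) z (1, 0, 0) * I) * I_sq + I * ht
  have hψ : ∀ c : ℂ, fderiv ℝ (fun z => (Q z).2.2) z (0, 0, c) =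
      c * fderiv ℝ (fun z => (Q z).2.2) z (0, 0, 1) := by
    intro c
    rw [clm_total_psi, hAI]
    simp only [real_smul]
    linear_combination fderiv ℝ (fun z => (Q z).2.2) z (0, 0, 1) * re_add_im c
  have hodd : ∀ a : ℂ, ((0 : ℝ), (0 : ℝ), -a) = -((0 : ℝ), (0 : ℝ), a) := by intro a; simp
  refine ⟨hs.tau_fiber hz, hξψ z hz, by exact_mod_cast ht, hψ, fun a => ?_, ?_, ?_⟩
  -- The part even in `ψ_x` is the fiber Hessian of `η`; the odd part, used next, is the equation
  -- for `η_xψ`.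
  · have ea := hE' a 0
    have en := hE' (-a) 0
    rw [hadd] at ea en
    rw [hodd] at en
    simp only [map_neg, h0, map_zero, mul_zero, add_zero, zero_add,
      neg_apply, neg_neg] at ea en
    linear_combination (ea + en) / 2 - e00
  · have ea := hE' 1 0
    have en := hE' (-1) 0
    rw [hadd] at ea en
    rw [hodd] at en
    simp only [map_neg, h0, map_zero, mul_zero, add_zero, zero_add,
      neg_apply, neg_neg] at ea en
    linear_combination (ea - en) / 2
  · rw [hψ] at e00
    change _ + fderiv ℝ (nlsF σ V) z (Q z) = 0
    linear_combination e00 - (fderiv ℝ (fun z => (Q z).2.2) z (0, 0, 1) * F -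
      fderiv ℝ (fun z => (Q z).1) z (1, 0, 0) * F) * I_sq

end LogNLS

/-! ### Integration of the determining equations in the fiber direction. -/

namespace LogNLS

/-- The general form `τ ∂_t + χ ∂_x + ((i/2) χ_t x + ρ) ψ ∂_ψ` of Lie symmetry fields. -/
noncomputable def symField (τ : ℝ) (χ : ℝ → ℝ) (ρ : ℝ → ℂ) : Field := fun z =>
  (τ, χ z.1, (I / 2 * (deriv χ z.1 : ℝ) * (z.2.1 : ℝ) + ρ z.1) * z.2.2)

/-- The classifying condition on the parameters of a Lie symmetry field. -/
structure IsSymData (σ : ℂ) (Ω : Set (ℝ × ℝ)) (V : ℝ × ℝ → ℂ) (τ : ℝ) (χ : ℝ → ℝ) (ρ : ℝ → ℂ) :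
    Prop where
  smooth_chi : ContDiffOn ℝ ∞ χ (timeInterval Ω)
  smooth_rho : ContDiffOn ℝ ∞ ρ (timeInterval Ω)
  classifying : ∀ p ∈ Ω, τ * dT V p + χ p.1 * dX V p =
    (deriv (deriv χ) p.1 : ℝ) / 2 * (p.2 : ℝ) - I * deriv ρ p.1 - σ * ((ρ p.1).re : ℝ)

/-- The two hypotheses make `η_ψ` locally constant along the fibers, and the punctured plane is
connected. Hence `η_ψ` is a function `α(t, x)`, and then so is the remainder `η - α ψ`. The lemma
serves both symmetry fields and point transformations. -/
theorem eta_structure {Ω : Set (ℝ × ℝ)} (hΩ : IsOpen Ω) {η : TotalSpace → ℂ}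
    (hη : ContDiffOn ℝ ∞ η (phaseDomain Ω))
    (h1 : ∀ z ∈ phaseDomain Ω, ∀ c : ℂ, fderiv ℝ η z (0, 0, c) = c * fderiv ℝ η z (0, 0, 1))
    (h2 : ∀ z ∈ phaseDomain Ω, ∀ c : ℂ, fderiv ℝ (fderiv ℝ η) z (0, 0, c) (0, 0, c) = 0) :
    ∃ α β : ℝ × ℝ → ℂ, ContDiffOn ℝ ∞ α Ω ∧ ContDiffOn ℝ ∞ β Ω ∧
      ∀ z ∈ phaseDomain Ω, η z = α (base z) * z.2.2 + β (base z) := by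
  have hD := isOpen_phaseDomain hΩ
  have hα := contDiffOn_fderiv_apply hD hη (0, 0, 1)
  have hι : ContDiff ℝ ∞ (fun p : ℝ × ℝ => ((p.1, p.2, 1) : TotalSpace)) := by fun_prop
  have hm : MapsTo (fun p : ℝ × ℝ => ((p.1, p.2, 1) : TotalSpace)) Ω (phaseDomain Ω) :=
    fun p hp => ⟨hp, one_ne_zero⟩
  have h3 : ∀ z ∈ phaseDomain Ω, ∀ c : ℂ, fderiv ℝ (fun y => fderiv ℝ η y (0, 0, 1)) z (0, 0, c) = 0 := by
    intro z hz c
    -- By complex linearity of the first derivative, the second derivative along `(c, c)` is `c`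
    -- times the derivative of `η_ψ` along `c`; a nonzero `c` can be cancelled.
    have h4 : fderiv ℝ (fun y => fderiv ℝ η y (0, 0, c)) z (0, 0, c) =
        c * fderiv ℝ (fun y => fderiv ℝ η y (0, 0, 1)) z (0, 0, c) := by
      have : (fun y => fderiv ℝ η y (0, 0, c)) =ᶠ[𝓝 z]
          fun y => c * fderiv ℝ η y (0, 0, 1) := by
        filter_upwards [hD.mem_nhds hz] with y hy using h1 y hy c
      rw [this.fderiv_eq, fderiv_const_mul (differentiableAt_of_contDiffOn hD hα hz)]
      rfl
    rw [fderiv_fderiv_apply hD hη hz, h2 z hz] at h4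
    rcases eq_or_ne c 0 with rfl | hc
    · exact map_zero _
    · exact (mul_eq_zero.1 h4.symm).resolve_left hc
  have hopen : IsOpen {c : ℂ | c ≠ 0} := isOpen_compl_singleton
  have hline : ∀ {g : TotalSpace → ℂ}, ContDiffOn ℝ ∞ g (phaseDomain Ω) → ∀ p ∈ Ω, ∀ c : ℂ, c ≠ 0 →
      HasFDerivAt (fun c : ℂ => g (p.1, p.2, c)) ((fderiv ℝ g (p.1, p.2, c)).comp
        ((ContinuousLinearMap.inr ℝ ℝ (ℝ × ℂ)).comp (ContinuousLinearMap.inr ℝ ℝ ℂ))) c := by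
    intro g hg p hp c hc
    have hd := differentiableAt_of_contDiffOn hD hg (x := (p.1, p.2, c)) ⟨hp, hc⟩
    refine hd.hasFDerivAt.comp c ?_
    exact (hasFDerivAt_prodMk_right p.1 (p.2, c)).comp c (hasFDerivAt_prodMk_right p.2 c)
  have h5 : ∀ p ∈ Ω, ∀ c : ℂ, c ≠ 0 →
      fderiv ℝ η (p.1, p.2, c) (0, 0, 1) = fderiv ℝ η (p.1, p.2, 1) (0, 0, 1) := by
    intro p hp c hc
    refine hopen.is_const_of_fderiv_eq_zero (𝕜 := ℝ) isPreconnected_ne_zero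
      (f := fun c : ℂ => fderiv ℝ η (p.1, p.2, c) (0, 0, 1))
      (fun c hc => (hline hα p hp c hc).differentiableAt.differentiableWithinAt) ?_ hc one_ne_zero
    intro c hc
    rw [(hline hα p hp c hc).fderiv]
    ext a
    simpa using h3 (p.1, p.2, c) ⟨hp, hc⟩ a
  refine ⟨fun p => fderiv ℝ η (p.1, p.2, 1) (0, 0, 1),
    fun p => η (p.1, p.2, 1) - fderiv ℝ η (p.1, p.2, 1) (0, 0, 1),
    hα.comp hι.contDiffOn hm, (hη.comp hι.contDiffOn hm).sub (hα.comp hι.contDiffOn hm), ?_⟩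
  rintro ⟨t, x, c⟩ ⟨hp, hc⟩
  have hd : ∀ c : ℂ, c ≠ 0 → HasFDerivAt
      (fun c : ℂ => η (t, x, c) - fderiv ℝ η (t, x, 1) (0, 0, 1) * c) (0 : ℂ →L[ℝ] ℂ) c := by
    intro c hc
    refine ((hline hη (t, x) hp c hc).sub ((hasFDerivAt_id c).const_mul
      (fderiv ℝ η (t, x, 1) (0, 0, 1)))).congr_fderiv ?_
    ext a
    have := h1 (t, x, c) ⟨hp, hc⟩ a
    have h6 := h5 (t, x) hp c hc
    simp at this h6 ⊢
    rw [this, h6]; ring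
  have := hopen.is_const_of_fderiv_eq_zero (𝕜 := ℝ) isPreconnected_ne_zero
      (f := fun c : ℂ => η (t, x, c) - fderiv ℝ η (t, x, 1) (0, 0, 1) * c)
      (fun c hc => (hd c hc).differentiableAt.differentiableWithinAt)
      (fun c hc => (hd c hc).fderiv) hc one_ne_zero
  simp only [base]
  simp only [mul_one] at this
  linear_combination this

/-- `base` as a continuous linear map. -/
noncomputable def baseL : TotalSpace →L[ℝ] ℝ × ℝ :=
  (ContinuousLinearMap.fst ℝ ℝ (ℝ × ℂ)).prod
    ((ContinuousLinearMap.fst ℝ ℝ ℂ).comp (ContinuousLinearMap.snd ℝ ℝ (ℝ × ℂ)))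

theorem contDiffOn_comp_base {F : Type*} [NormedAddCommGroup F] [NormedSpace ℝ F]
    {Ω : Set (ℝ × ℝ)} {f : ℝ × ℝ → F} (hf : ContDiffOn ℝ ∞ f Ω) :
    ContDiffOn ℝ ∞ (fun z => f (base z)) (phaseDomain Ω) :=
  hf.comp baseL.contDiff.contDiffOn fun _ hz => hz.1

theorem fderiv_comp_base {F : Type*} [NormedAddCommGroup F] [NormedSpace ℝ F]
    {f : ℝ × ℝ → F} {z : TotalSpace} (hf : DifferentiableAt ℝ f (base z)) (a b : ℝ) (c : ℂ) :
    fderiv ℝ (fun z => f (base z)) z (a, b, c) = a • dT f (base z) + b • dX f (base z) := by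
  have h : HasFDerivAt (fun z => f (base z)) ((fderiv ℝ f (base z)).comp baseL) z :=
    hf.hasFDerivAt.comp z baseL.hasFDerivAt
  rw [h.fderiv, ← fderiv_prod_apply]
  rfl

theorem hasFDerivAt_psi (z : TotalSpace) : HasFDerivAt (fun z : TotalSpace => z.2.2)
    ((ContinuousLinearMap.snd ℝ ℝ ℂ).comp (ContinuousLinearMap.snd ℝ ℝ (ℝ × ℂ))) z :=
  ((ContinuousLinearMap.snd ℝ ℝ ℂ).comp (ContinuousLinearMap.snd ℝ ℝ (ℝ × ℂ))).hasFDerivAt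

/-- Derivative of `α(t,x) ψ + β(t,x)`. -/
theorem fderiv_affine {α β : ℝ × ℝ → ℂ} {z : TotalSpace} (hα : DifferentiableAt ℝ α (base z))
    (hβ : DifferentiableAt ℝ β (base z)) (a b : ℝ) (c : ℂ) :
    fderiv ℝ (fun z => α (base z) * z.2.2 + β (base z)) z (a, b, c) =
      (a * dT α (base z) + b * dX α (base z)) * z.2.2 + α (base z) * c
        + (a * dT β (base z) + b * dX β (base z)) := by
  have hα' : DifferentiableAt ℝ (fun z => α (base z)) z := hα.comp z baseL.differentiableAt
  have hβ' : DifferentiableAt ℝ (fun z => β (base z)) z := hβ.comp z baseL.differentiableAt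
  have h := ((hα'.hasFDerivAt.mul (hasFDerivAt_psi z)).add hβ'.hasFDerivAt).fderiv
  have h' := DFunLike.congr_fun h (a, b, c)
  refine h'.trans ?_
  simp [fderiv_comp_base hα, fderiv_comp_base hβ]
  ring

theorem IsPotential.differentiableAt {Ω : Set (ℝ × ℝ)} {V : ℝ × ℝ → ℂ} (h : IsPotential Ω V)
    {p : ℝ × ℝ} (hp : p ∈ Ω) : DifferentiableAt ℝ V p :=
  differentiableAt_of_contDiffOn h.domain.isOpen h.smooth hp

/-- The four values `±1`, `±e` of `ψ` suffice. The terms in `β` are even in `s` and the others,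
apart from `R`, are odd; comparing logarithm `0` with logarithm `1` then isolates `σ β` and `σ τ_t`.
This is the place where `σ ≠ 0` excludes scalings of time. -/
theorem zero_order_split {P R σ V β τt : ℂ} (hσ : σ ≠ 0)
    (h : ∀ (l s : ℝ), (l = 0 ∧ s = 1) ∨ (l = 0 ∧ s = -1) ∨ (l = 1 ∧ s = Real.exp 1) ∨
        (l = 1 ∧ s = -Real.exp 1) →
      P * s + R + τt * (σ * s * l + V * s) + (σ * l + V) * β + σ * s * ((β.re / s : ℝ) : ℂ) = 0) :
    β = 0 ∧ τt = 0 ∧ P = 0 := by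
  have he : Real.exp 1 ≠ 0 := (Real.exp_pos 1).ne'
  have he' : (Real.exp 1 : ℂ) ≠ 0 := by exact_mod_cast he
  have h1 := h 0 1 (by simp)
  have h2 := h 0 (-1) (by simp)
  have h3 := h 1 (Real.exp 1) (by simp)
  have h4 := h 1 (-Real.exp 1) (by simp)
  push_cast at h1 h2 h3 h4
  field_simp at h1 h2 h3 h4
  have hβ : β = 0 := by
    have : σ * β = 0 := by linear_combination ((h3 + h4) - (h1 + h2)) / 2
    exact (mul_eq_zero.1 this).resolve_left hσ
  have hτ : τt = 0 := by
    have : (Real.exp 1 : ℂ) * σ * τt = 0 := by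
      push_cast
      linear_combination (h3 - h4) / 2 - Complex.exp 1 * (h1 - h2) / 2
    simpa [he', hσ] using this
  refine ⟨hβ, hτ, ?_⟩
  rw [hτ] at h1 h2
  linear_combination (h1 - h2) / 2

end LogNLS

/-! ### General form of the symmetry fields and the classifying condition. -/

namespace LogNLS

theorem contDiffOn_symField {Ω : Set (ℝ × ℝ)} (hΩ : IsOpen (timeInterval Ω)) (τ : ℝ) {χ : ℝ → ℝ}
    {ρ : ℝ → ℂ} (hχ : ContDiffOn ℝ ∞ χ (timeInterval Ω)) (hρ : ContDiffOn ℝ ∞ ρ (timeInterval Ω)) :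
    ContDiffOn ℝ ∞ (symField τ χ ρ) (phaseDomain Ω) := by
  have hm : MapsTo (fun z : TotalSpace => z.1) (phaseDomain Ω) (timeInterval Ω) := fun z hz =>
    mem_timeInterval hz.1
  have h1 : ContDiffOn ℝ ∞ (fun z : TotalSpace => χ z.1) (phaseDomain Ω) :=
    hχ.comp contDiff_fst.contDiffOn hm
  have h2 : ContDiffOn ℝ ∞ (fun z : TotalSpace => ((deriv χ z.1 : ℝ) : ℂ)) (phaseDomain Ω) :=
    ofRealCLM.contDiff.comp_contDiffOn ((contDiffOn_deriv hΩ hχ).comp contDiff_fst.contDiffOn hm)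
  have h3 : ContDiffOn ℝ ∞ (fun z : TotalSpace => ρ z.1) (phaseDomain Ω) :=
    hρ.comp contDiff_fst.contDiffOn hm
  have h4 : ContDiffOn ℝ ∞ (fun z : TotalSpace => ((z.2.1 : ℝ) : ℂ)) (phaseDomain Ω) :=
    ofRealCLM.contDiff.comp_contDiffOn (ContDiff.contDiffOn (by fun_prop))
  have h5 : ContDiffOn ℝ ∞ (fun z : TotalSpace => z.2.2) (phaseDomain Ω) :=
    ContDiff.contDiffOn (by fun_prop)
  exact contDiffOn_const.prodMk (h1.prodMk
    ((((contDiffOn_const.mul h2).mul h4).add h3).mul h5))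

/-- Partial derivatives of `(i/2) a(t) x + b(t)`. -/
theorem hasFDerivAt_phase {a : ℝ → ℝ} {b : ℝ → ℂ} {p : ℝ × ℝ} (ha : DifferentiableAt ℝ a p.1)
    (hb : DifferentiableAt ℝ b p.1) :
    DifferentiableAt ℝ (fun p : ℝ × ℝ => I / 2 * (a p.1 : ℂ) * (p.2 : ℂ) + b p.1) p ∧
    dT (fun p : ℝ × ℝ => I / 2 * (a p.1 : ℂ) * (p.2 : ℂ) + b p.1) p =
      I / 2 * (deriv a p.1 : ℝ) * (p.2 : ℂ) + deriv b p.1 ∧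
    dX (fun p : ℝ × ℝ => I / 2 * (a p.1 : ℂ) * (p.2 : ℂ) + b p.1) p = I / 2 * (a p.1 : ℂ) := by
  have hd : DifferentiableAt ℝ (fun p : ℝ × ℝ => I / 2 * (a p.1 : ℂ) * (p.2 : ℂ) + b p.1) p := by
    have h1 : DifferentiableAt ℝ (fun p : ℝ × ℝ => (a p.1 : ℂ)) p :=
      ofRealCLM.differentiableAt.comp p (ha.comp p differentiableAt_fst)
    have h2 : DifferentiableAt ℝ (fun p : ℝ × ℝ => (p.2 : ℂ)) p :=
      ofRealCLM.differentiableAt.comp p differentiableAt_snd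
    have h3 : DifferentiableAt ℝ (fun p : ℝ × ℝ => b p.1) p := hb.comp p differentiableAt_fst
    exact ((h1.const_mul _).mul h2).add h3
  refine ⟨hd, ?_, ?_⟩
  · refine (hasDerivAt_dT hd).unique ?_
    exact ((ha.hasDerivAt.ofReal_comp.const_mul (I / 2)).mul_const (p.2 : ℂ)).fun_add hb.hasDerivAt
  · refine (hasDerivAt_dX hd).unique ?_
    simpa using ((hasDerivAt_id p.2).ofReal_comp.const_mul (I / 2 * (a p.1 : ℂ))).add_const (b p.1)

theorem exists_eq_comp_base {F : Type*} [NormedAddCommGroup F] [NormedSpace ℝ F]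
    {Ω : Set (ℝ × ℝ)} (hΩ : IsOpen Ω) {f : TotalSpace → F} (hf : ContDiffOn ℝ ∞ f (phaseDomain Ω))
    (h : ∀ z ∈ phaseDomain Ω, ∀ c : ℂ, fderiv ℝ f z (0, 0, c) = 0) :
    ∃ g : ℝ × ℝ → F, ContDiffOn ℝ ∞ g Ω ∧ ∀ z ∈ phaseDomain Ω, f z = g (base z) := by
  have hι : ContDiff ℝ ∞ (fun p : ℝ × ℝ => ((p.1, p.2, 1) : TotalSpace)) := by fun_prop
  refine ⟨fun p => f (p.1, p.2, 1), hf.comp hι.contDiffOn fun p hp => ⟨hp, one_ne_zero⟩, ?_⟩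
  rintro ⟨t, x, c⟩ ⟨hp, hc⟩
  have hopen : IsOpen {c : ℂ | c ≠ 0} := isOpen_compl_singleton
  have hd : ∀ c : ℂ, c ≠ 0 → HasFDerivAt (fun c : ℂ => f (t, x, c)) (0 : ℂ →L[ℝ] F) c := by
    intro c hc
    have h1 := (differentiableAt_of_contDiffOn (isOpen_phaseDomain hΩ) hf (x := (t, x, c))
      ⟨hp, hc⟩).hasFDerivAt.comp c
      ((hasFDerivAt_prodMk_right t (x, c)).comp c (hasFDerivAt_prodMk_right x c))
    refine h1.congr_fderiv ?_
    ext a : 1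
    simpa using h (t, x, c) ⟨hp, hc⟩ a
  exact hopen.is_const_of_fderiv_eq_zero (𝕜 := ℝ) isPreconnected_ne_zero
    (fun c hc => (hd c hc).differentiableAt.differentiableWithinAt)
    (fun c hc => (hd c hc).fderiv) hc one_ne_zero

theorem fderiv_eq_of_eq_comp_base {F : Type*} [NormedAddCommGroup F] [NormedSpace ℝ F]
    {Ω : Set (ℝ × ℝ)} (hΩ : IsOpen Ω) {f : TotalSpace → F} {g : ℝ × ℝ → F}
    (hg : ContDiffOn ℝ ∞ g Ω) (h : ∀ z ∈ phaseDomain Ω, f z = g (base z)) {z : TotalSpace}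
    (hz : z ∈ phaseDomain Ω) (a b : ℝ) (c : ℂ) :
    fderiv ℝ f z (a, b, c) = a • dT g (base z) + b • dX g (base z) := by
  have : f =ᶠ[𝓝 z] fun z => g (base z) := by
    filter_upwards [(isOpen_phaseDomain hΩ).mem_nhds hz] with y hy using h y hy
  rw [this.fderiv_eq, fderiv_comp_base (differentiableAt_of_contDiffOn hΩ hg hz.1)]

/-- From `τ_x = 0` and `τ_t = 0` the coefficient `τ` is constant on the connected domain; then `τ_t
= 2 ξ_x` makes `ξ` a function `χ(t)`, and `2 α_x = i ξ_t + ξ_xx` gives `α = (i/2) χ_t x + ρ(t)`. The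
remaining terms, linear in `ψ`, are the classifying condition. -/
theorem IsLieSymmetry.exists_isSymData {σ : ℂ} (hσ : σ ≠ 0) {Ω : Set (ℝ × ℝ)} {V : ℝ × ℝ → ℂ}
    {Q : Field} (hV : IsPotential Ω V) (hQ : ContDiffOn ℝ ∞ Q (phaseDomain Ω))
    (hs : IsLieSymmetry σ Ω V Q) :
    ∃ τ χ ρ, IsSymData σ Ω V τ χ ρ ∧ ∀ z ∈ phaseDomain Ω, Q z = symField τ χ ρ z := by
  have hdom := hV.domain
  have hΩ := hdom.isOpen
  have hD := isOpen_phaseDomain hΩ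
  obtain ⟨hτ, hξ, hη⟩ := contDiffOn_components hQ
  have hdet : ∀ z ∈ phaseDomain Ω, _ := fun z hz => hs.determining hΩ hQ hz
  obtain ⟨α, β, hα, hβ, hηeq⟩ := eta_structure hΩ hη (fun z hz => (hdet z hz).eta_psi)
    (fun z hz => (hdet z hz).eta_psi_psi)
  have hαd := fun p (hp : p ∈ Ω) => differentiableAt_of_contDiffOn hΩ hα hp
  have hβd := fun p (hp : p ∈ Ω) => differentiableAt_of_contDiffOn hΩ hβ hp
  have hαx := contDiffOn_dX hΩ hα
  have hβx := contDiffOn_dX hΩ hβ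
  have hη1 : ∀ z ∈ phaseDomain Ω, ∀ (a b : ℝ) (c : ℂ), fderiv ℝ (fun z => (Q z).2.2) z (a, b, c) =
      (a * dT α (base z) + b * dX α (base z)) * z.2.2 + α (base z) * c
        + (a * dT β (base z) + b * dX β (base z)) := by
    intro z hz a b c
    have : (fun z => (Q z).2.2) =ᶠ[𝓝 z] fun z => α (base z) * z.2.2 + β (base z) := by
      filter_upwards [hD.mem_nhds hz] with y hy using hηeq y hy
    rw [this.fderiv_eq, fderiv_affine (hαd _ hz.1) (hβd _ hz.1)]
  have hη2 : ∀ z ∈ phaseDomain Ω, ∀ c : ℂ,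
      fderiv ℝ (fderiv ℝ fun z => (Q z).2.2) z (0, 1, 0) (0, 1, 0) =
        dX (dX α) (base z) * z.2.2 + dX (dX β) (base z) ∧
      fderiv ℝ (fderiv ℝ fun z => (Q z).2.2) z (0, 1, 0) (0, 0, 1) = dX α (base z) := by
    intro z hz c
    have hx : (fun y => fderiv ℝ (fun z => (Q z).2.2) y (0, 1, 0)) =ᶠ[𝓝 z]
        fun z => dX α (base z) * z.2.2 + dX β (base z) := by
      filter_upwards [hD.mem_nhds hz] with y hy
      rw [hη1 y hy]; simp
    constructor
    · rw [← fderiv_fderiv_apply hD hη hz, hx.fderiv_eq,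
        fderiv_affine (differentiableAt_of_contDiffOn hΩ hαx hz.1)
          (differentiableAt_of_contDiffOn hΩ hβx hz.1)]
      simp
    · rw [fderiv_fderiv_symm hD hη hz, ← fderiv_fderiv_apply hD hη hz, hx.fderiv_eq,
        fderiv_affine (differentiableAt_of_contDiffOn hΩ hαx hz.1)
          (differentiableAt_of_contDiffOn hΩ hβx hz.1)]
      simp
  have hone : ∀ p ∈ Ω, ((p.1, p.2, 1) : TotalSpace) ∈ phaseDomain Ω := fun p hp =>
    ⟨hp, one_ne_zero⟩
  -- `τ` and `ξ` do not depend on `ψ`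
  obtain ⟨T, hT, hTeq⟩ := exists_eq_comp_base hΩ hτ fun z hz c => (hdet z hz).tau_fiber 0 c
  obtain ⟨X, hX, hXeq⟩ := exists_eq_comp_base hΩ hξ fun z hz c => (hdet z hz).xi_psi c
  have hXx := contDiffOn_dX hΩ hX
  have hT1 := fun z hz => fderiv_eq_of_eq_comp_base (z := z) hΩ hT hTeq hz
  have hX1 := fun z hz => fderiv_eq_of_eq_comp_base (z := z) hΩ hX hXeq hz
  have hX2 : ∀ z ∈ phaseDomain Ω, fderiv ℝ (fderiv ℝ fun z => (Q z).2.1) z (0, 1, 0) (0, 1, 0) =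
      dX (dX X) (base z) := by
    intro z hz
    rw [← fderiv_fderiv_apply hD hξ hz, fderiv_eq_of_eq_comp_base hΩ hXx (z := z) ?_ hz]
    · simp
    · intro y hy; rw [hX1 y hy]; simp
  have hTx : ∀ p ∈ Ω, dX T p = 0 := by
    intro p hp
    have := (hdet _ (hone p hp)).tau_fiber 1 0
    rw [hT1 _ (hone p hp)] at this
    simpa [base] using this
  have hTt : ∀ p ∈ Ω, dT T p = 2 * dX X p := by
    intro p hp
    have := (hdet _ (hone p hp)).tau_t
    rw [hT1 _ (hone p hp), hX1 _ (hone p hp)] at this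
    simpa [base] using this
  -- separation of the logarithmic terms
  have hsplit : ∀ p ∈ Ω, β p = 0 ∧ ((dT T p : ℝ) : ℂ) = 0
      ∧ I * dT α p + dX (dX α) p + T p * dT V p + X p * dX V p + σ * ((α p).re : ℝ) = 0 := by
    intro p hp
    refine zero_order_split (R := I * dT β p + dX (dX β) p) (V := V p) hσ fun l s hls => ?_
    have hs0 : s ≠ 0 ∧ Real.log |s| = l := by
      rcases hls with h | h | h | h <;> obtain ⟨rfl, rfl⟩ := h <;> simp
    have hs0' : (s : ℂ) ≠ 0 := by exact_mod_cast hs0.1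
    have hz : ((p.1, p.2, (s : ℂ)) : TotalSpace) ∈ phaseDomain Ω := ⟨hp, hs0'⟩
    have h0 := (hdet _ hz).zero_order
    rw [fderiv_nlsF σ hz.2 (hV.differentiableAt hz.1), hη1 _ hz, hη1 _ hz, (hη2 _ hz 0).1,
      hT1 _ hz, hTeq _ hz, hXeq _ hz, hηeq _ hz] at h0
    simp only [base, nlsF, norm_real, Real.norm_eq_abs, hs0.2] at h0
    have hre : ((α p * s + β p) / s).re = (α p).re + (β p).re / s := by
      rw [add_div, mul_div_assoc, div_self hs0', mul_one, add_re, div_ofReal_re]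
    rw [show ((p.1, p.2) : ℝ × ℝ) = p from rfl, hre] at h0
    simp at h0
    push_cast
    linear_combination h0
  have hα1 : ∀ p ∈ Ω, 2 * dX α p = I * dT X p + dX (dX X) p := by
    intro p hp
    have := (hdet _ (hone p hp)).eta_x_psi
    rw [(hη2 _ (hone p hp) 0).2, hX1 _ (hone p hp), hX2 _ (hone p hp)] at this
    simpa [base] using this
  have hTt0 : ∀ p ∈ Ω, dT T p = 0 := fun p hp => by exact_mod_cast (hsplit p hp).2.1
  have hXx0 : ∀ p ∈ Ω, dX X p = 0 := fun p hp => by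
    have := hTt p hp; rw [hTt0 p hp] at this; linarith
  obtain ⟨τ, hτc⟩ := hΩ.exists_is_const_of_fderiv_eq_zero (𝕜 := ℝ) hdom.isConnected.isPreconnected
    (f := T) (fun p hp => (differentiableAt_of_contDiffOn hΩ hT hp).differentiableWithinAt)
    (fun p hp => by
      ext
      · simpa [dT] using hTt0 p hp
      · simpa [dX] using hTx p hp)
  obtain ⟨χ, hχ, hχeq⟩ := hdom.exists_eq_comp_fst hX hXx0
  have hJ := hdom.isOpen_timeInterval
  have hχd := fun t (ht : t ∈ timeInterval Ω) => differentiableAt_of_contDiffOn hJ hχ ht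
  have hχ' := contDiffOn_deriv hJ hχ
  have hχ'd := fun t (ht : t ∈ timeInterval Ω) => differentiableAt_of_contDiffOn hJ hχ' ht
  have hXt : ∀ p ∈ Ω, dT X p = deriv χ p.1 := by
    intro p hp
    have : X =ᶠ[𝓝 p] fun p => χ p.1 := by
      filter_upwards [hΩ.mem_nhds hp] with q hq using hχeq q hq
    rw [← dT_comp_fst (hχd _ (mem_timeInterval hp)), dT, this.fderiv_eq, dT]
  have hXxx : ∀ p ∈ Ω, dX (dX X) p = 0 := by
    intro p hp
    have : dX X =ᶠ[𝓝 p] fun p => 0 := by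
      filter_upwards [hΩ.mem_nhds hp] with q hq using hXx0 q hq
    rw [dX, this.fderiv_eq]; simp
  have hαx' : ∀ p ∈ Ω, dX α p = I / 2 * (deriv χ p.1 : ℝ) := by
    intro p hp
    have := hα1 p hp
    rw [hXt p hp, hXxx p hp] at this
    simp at this
    linear_combination this / 2
  have hph : ∀ p ∈ Ω, _ := fun p hp =>
    hasFDerivAt_phase (b := fun _ => 0) (p := p) (hχ'd _ (mem_timeInterval hp)) (by fun_prop)
  obtain ⟨ρ, hρ, hρeq⟩ := hdom.exists_eq_comp_fst
    (f := fun p => α p - (I / 2 * (deriv χ p.1 : ℝ) * (p.2 : ℂ) + 0))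
    (hα.sub (((contDiffOn_const.mul (ofRealCLM.contDiff.comp_contDiffOn
      (contDiffOn_comp_fst hχ'))).mul
      (ofRealCLM.contDiff.comp_contDiffOn contDiff_snd.contDiffOn)).add contDiffOn_const))
    (fun p hp => by
      have h1 := fderiv_sub (hαd p hp) (hph p hp).1
      have h2 := (hph p hp).2.2
      have h3 := hαx' p hp
      unfold dX at h2 h3 ⊢
      refine (DFunLike.congr_fun h1 _).trans ?_
      rw [sub_apply, h2, h3, sub_self])
  have hρd := fun t (ht : t ∈ timeInterval Ω) => differentiableAt_of_contDiffOn hJ hρ ht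
  have hαeq : ∀ p ∈ Ω, α p = I / 2 * (deriv χ p.1 : ℝ) * (p.2 : ℂ) + ρ p.1 := fun p hp => by
    rw [← hρeq p hp]; ring
  refine ⟨τ, χ, ρ, ⟨hχ, hρ, fun p hp => ?_⟩, fun z hz => ?_⟩
  · have h1 := (hsplit p hp).2.2
    have hαt : dT α p = I / 2 * (deriv (deriv χ) p.1 : ℝ) * (p.2 : ℂ) + deriv ρ p.1 := by
      rw [← (hasFDerivAt_phase (p := p) (hχ'd _ (mem_timeInterval hp))
        (hρd _ (mem_timeInterval hp))).2.1]
      have : α =ᶠ[𝓝 p] fun p => I / 2 * (deriv χ p.1 : ℝ) * (p.2 : ℂ) + ρ p.1 := by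
        filter_upwards [hΩ.mem_nhds hp] with q hq using hαeq q hq
      rw [dT, this.fderiv_eq, dT]
    have hαxx : dX (dX α) p = 0 := by
      have hg : DifferentiableAt ℝ (fun t : ℝ => I / 2 * ((deriv χ t : ℝ) : ℂ)) p.1 :=
        (ofRealCLM.differentiableAt.comp _ (hχ'd _ (mem_timeInterval hp))).const_mul (I / 2)
      rw [← dX_comp_fst hg]
      have : dX α =ᶠ[𝓝 p] fun p => I / 2 * ((deriv χ p.1 : ℝ) : ℂ) := by
        filter_upwards [hΩ.mem_nhds hp] with q hq using hαx' q hq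
      rw [dX, this.fderiv_eq, dX]
    have hre : (α p).re = (ρ p.1).re := by rw [hαeq p hp]; simp
    rw [hαt, hαxx, hre, hτc p hp, hχeq p hp] at h1
    linear_combination h1 - (deriv (deriv χ) p.1 : ℝ) / 2 * (p.2 : ℂ) * I_sq
  · refine Prod.ext ?_ (Prod.ext ?_ ?_)
    · change (Q z).1 = τ
      rw [hTeq z hz, hτc _ hz.1]
    · change (Q z).2.1 = χ z.1
      rw [hXeq z hz, hχeq _ hz.1]; rfl
    · rw [hηeq z hz, (hsplit _ hz.1).1, hαeq _ hz.1, add_zero]; rfl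

/-- The prolonged action is the multiplier `(i/2) χ_t x + ρ` times the left-hand side of the
equation plus `ψ` times the defect in the classifying condition. -/
theorem IsSymData.isLieSymmetry {σ : ℂ} {Ω : Set (ℝ × ℝ)} {V : ℝ × ℝ → ℂ} {τ : ℝ} {χ : ℝ → ℝ}
    {ρ : ℝ → ℂ} (hV : IsPotential Ω V) (h : IsSymData σ Ω V τ χ ρ) :
    IsLieSymmetry σ Ω V (symField τ χ ρ) := by
  have hJ := hV.domain.isOpen_timeInterval
  have hΩ := hV.domain.isOpen
  have hD := isOpen_phaseDomain hΩ
  intro z hz ψt ψx ψtx ψxx hL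
  have hχd := fun t (ht : t ∈ timeInterval Ω) => differentiableAt_of_contDiffOn hJ h.smooth_chi ht
  have hχ'd := fun t (ht : t ∈ timeInterval Ω) =>
    differentiableAt_of_contDiffOn hJ (contDiffOn_deriv hJ h.smooth_chi) ht
  have hρd := fun t (ht : t ∈ timeInterval Ω) => differentiableAt_of_contDiffOn hJ h.smooth_rho ht
  let α : ℝ × ℝ → ℂ := fun p => I / 2 * ((deriv χ p.1 : ℝ) : ℂ) * (p.2 : ℂ) + ρ p.1
  have hα := fun p (hp : p ∈ Ω) => hasFDerivAt_phase (hχ'd _ (mem_timeInterval hp))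
    (hρd _ (mem_timeInterval hp))
  have hη : ∀ z ∈ phaseDomain Ω, ∀ (a b : ℝ) (c : ℂ),
      fderiv ℝ (fun z => (symField τ χ ρ z).2.2) z (a, b, c) =
      (a * (I / 2 * (deriv (deriv χ) z.1 : ℝ) * (z.2.1 : ℝ) + deriv ρ z.1)
        + b * (I / 2 * (deriv χ z.1 : ℝ))) * z.2.2 + α (base z) * c := by
    intro z hz a b c
    obtain ⟨h1, h2, h3⟩ := hα _ hz.1
    have := fderiv_affine (z := z) (β := fun _ => 0) h1 (by fun_prop) a b c
    rw [h2, h3] at this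
    simp only [add_zero] at this
    refine this.trans ?_
    simp [dT, dX, base, α]
  have hξ : ∀ z ∈ phaseDomain Ω, ∀ (a b : ℝ) (c : ℂ),
      fderiv ℝ (fun z => (symField τ χ ρ z).2.1) z (a, b, c) = a * deriv χ z.1 := by
    intro z hz a b c
    have hc := hχd z.1 (mem_timeInterval hz.1)
    have := fderiv_comp_base (z := z) (f := fun p : ℝ × ℝ => χ p.1)
      (hc.comp (base z) differentiableAt_fst) a b c
    rw [dT_comp_fst hc, dX_comp_fst hc] at this
    exact this.trans (by simp [base])
  have hτ : ∀ z, fderiv ℝ (fun z => (symField τ χ ρ z).1) z = 0 := by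
    intro z; exact fderiv_const_apply _
  have hξ2 : fderiv ℝ (fun y => totalDx (fun y => (symField τ χ ρ y).2.1) y ψx) z (0, 1, ψx) = 0 := by
    have : (fun y => totalDx (fun y => (symField τ χ ρ y).2.1) y ψx) =ᶠ[𝓝 z] fun _ => 0 := by
      filter_upwards [hD.mem_nhds hz] with y hy
      rw [totalDx, hξ y hy]; simp
    rw [this.fderiv_eq]; simp
  have hη2 : fderiv ℝ (fun y => totalDx (fun y => (symField τ χ ρ y).2.2) y ψx) z (0, 1, ψx) =
      I * (deriv χ z.1 : ℝ) * ψx := by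
    let a₁ : ℝ × ℝ → ℂ := fun p => I / 2 * ((deriv χ p.1 : ℝ) : ℂ)
    have e : (fun y => totalDx (fun y => (symField τ χ ρ y).2.2) y ψx) =ᶠ[𝓝 z]
        fun y => a₁ (base y) * y.2.2 + (fun p => α p * ψx) (base y) := by
      filter_upwards [hD.mem_nhds hz] with y hy
      rw [totalDx, hη y hy]; simp [a₁, base]
    have hg : DifferentiableAt ℝ (fun t : ℝ => I / 2 * ((deriv χ t : ℝ) : ℂ)) (base z).1 :=
      (ofRealCLM.differentiableAt.comp _ (hχ'd _ (mem_timeInterval hz.1))).const_mul (I / 2)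
    have h1 : DifferentiableAt ℝ a₁ (base z) := hg.comp (base z) differentiableAt_fst
    obtain ⟨h2, -, h3⟩ := hα _ hz.1
    have h5 : dX (fun p => α p * ψx) (base z) = dX α (base z) * ψx := by
      unfold dX
      rw [fderiv_mul_const h2]
      exact mul_comm _ _
    rw [e.fderiv_eq, fderiv_affine h1 (h2.mul_const ψx), h5, h3, dX_comp_fst hg]
    simp [a₁, base]
    ring
  have hcl := h.classifying _ hz.1
  have hc0 := hz.2
  unfold prolongedAction prolongT prolongXX totalDxx
  rw [hξ2, hη2]
  unfold totalDt totalDx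
  simp only [hτ, hη z hz, hξ z hz, zero_apply]
  rw [show symField τ χ ρ z = (τ, χ z.1, α (base z) * z.2.2) from rfl,
    fderiv_nlsF σ hc0 (hV.differentiableAt hz.1), mul_div_assoc, div_self hc0, mul_one]
  have hre : (α (base z)).re = (ρ z.1).re := by simp [α, base]
  have h00 : fderiv ℝ (fun _ : TotalSpace => (0 : ℝ)) z = 0 := fderiv_const_apply _
  rw [hre, h00]
  simp only [nlsL, nlsF] at hL
  simp only [base] at hcl hL ⊢
  simp only [α]
  have h000 : (0 : TotalSpace →L[ℝ] ℝ) (0, 1, ψx) = 0 := rfl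
  rw [h000]
  push_cast
  linear_combination (I / 2 * (deriv χ z.1 : ℝ) * (z.2.1 : ℝ) + ρ z.1) * hL + z.2.2 * hcl +
    (deriv (deriv χ) z.1 : ℝ) / 2 * (z.2.1 : ℝ) * z.2.2 * I_sq

end LogNLS

/-! ### The invariance algebra as a vector space, and the kernel fields. -/

namespace LogNLS

variable {σ : ℂ} {Ω : Set (ℝ × ℝ)} {V : ℝ × ℝ → ℂ}

/-- From here on the algebra is studied only through the parameters `(τ, χ, ρ)`; jets are not needed
again for symmetries. -/
theorem mem_lieAlgebra_iff (hσ : σ ≠ 0) (hV : IsPotential Ω V) {f : phaseDomain Ω → ℝ × ℝ × ℂ} :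
    f ∈ lieAlgebra σ Ω V ↔
      ∃ τ χ ρ, IsSymData σ Ω V τ χ ρ ∧ f = (phaseDomain Ω).domRestrict (symField τ χ ρ) := by
  constructor
  · rintro ⟨Q, ⟨hQ, hs⟩, rfl⟩
    obtain ⟨τ, χ, ρ, h, he⟩ := hs.exists_isSymData hσ hV hQ
    exact ⟨τ, χ, ρ, h, funext fun z => he z z.2⟩
  · rintro ⟨τ, χ, ρ, h, rfl⟩
    exact ⟨_, ⟨contDiffOn_symField hV.domain.isOpen_timeInterval τ h.smooth_chi h.smooth_rho,
      h.isLieSymmetry hV⟩, rfl⟩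

theorem fst_mem_timeInterval {z : TotalSpace} (hz : z ∈ phaseDomain Ω) : z.1 ∈ timeInterval Ω :=
  mem_timeInterval hz.1

theorem IsSymData.mem {τ : ℝ} {χ : ℝ → ℝ} {ρ : ℝ → ℂ} (hσ : σ ≠ 0) (hV : IsPotential Ω V)
    (h : IsSymData σ Ω V τ χ ρ) {Q : Field} (hQ : ∀ z ∈ phaseDomain Ω, Q z = symField τ χ ρ z) :
    (phaseDomain Ω).domRestrict Q ∈ lieAlgebra σ Ω V :=
  (mem_lieAlgebra_iff hσ hV).2 ⟨τ, χ, ρ, h, funext fun z => hQ z z.2⟩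

theorem deriv_deriv_linear {J : Set ℝ} (hJ : IsOpen J) {χ₁ χ₂ : ℝ → ℝ} (h₁ : ContDiffOn ℝ ∞ χ₁ J)
    (h₂ : ContDiffOn ℝ ∞ χ₂ J) (a b : ℝ) {t : ℝ} (ht : t ∈ J) :
    deriv (fun s => a * χ₁ s + b * χ₂ s) t = a * deriv χ₁ t + b * deriv χ₂ t ∧
    deriv (deriv fun s => a * χ₁ s + b * χ₂ s) t =
      a * deriv (deriv χ₁) t + b * deriv (deriv χ₂) t := by
  have key : ∀ {f g : ℝ → ℝ}, ContDiffOn ℝ ∞ f J → ContDiffOn ℝ ∞ g J → ∀ s ∈ J,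
      deriv (fun s => a * f s + b * g s) s = a * deriv f s + b * deriv g s := fun hf hg s hs =>
    (((hasDerivAt_deriv_of_contDiffOn hJ hf hs).const_mul a).fun_add
      ((hasDerivAt_deriv_of_contDiffOn hJ hg hs).const_mul b)).deriv
  refine ⟨key h₁ h₂ t ht, ?_⟩
  rw [← key (contDiffOn_deriv hJ h₁) (contDiffOn_deriv hJ h₂) t ht]
  refine EventuallyEq.deriv_eq ?_
  filter_upwards [hJ.mem_nhds ht] with s hs using key h₁ h₂ s hs

theorem IsSymData.linear (hΩ : IsPotentialDomain Ω) {τ₁ τ₂ : ℝ} {χ₁ χ₂ : ℝ → ℝ} {ρ₁ ρ₂ : ℝ → ℂ}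
    (h₁ : IsSymData σ Ω V τ₁ χ₁ ρ₁) (h₂ : IsSymData σ Ω V τ₂ χ₂ ρ₂) (a b : ℝ) :
    IsSymData σ Ω V (a * τ₁ + b * τ₂) (fun t => a * χ₁ t + b * χ₂ t)
      (fun t => a * ρ₁ t + b * ρ₂ t) := by
  have hJ := hΩ.isOpen_timeInterval
  refine ⟨(contDiffOn_const.mul h₁.smooth_chi).add (contDiffOn_const.mul h₂.smooth_chi),
    (contDiffOn_const.mul h₁.smooth_rho).add (contDiffOn_const.mul h₂.smooth_rho), fun p hp => ?_⟩
  have ht := mem_timeInterval hp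
  have e1 := h₁.classifying p hp
  have e2 := h₂.classifying p hp
  have hρ : deriv (fun t => (a : ℂ) * ρ₁ t + b * ρ₂ t) p.1 = a * deriv ρ₁ p.1 + b * deriv ρ₂ p.1 :=
    (((hasDerivAt_deriv_of_contDiffOn hJ h₁.smooth_rho ht).const_mul _).fun_add
      ((hasDerivAt_deriv_of_contDiffOn hJ h₂.smooth_rho ht).const_mul _)).deriv
  rw [(deriv_deriv_linear hJ h₁.smooth_chi h₂.smooth_chi a b ht).2, hρ]
  simp only [add_re, re_ofReal_mul]
  push_cast
  linear_combination a * e1 + b * e2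

theorem symField_linear (hΩ : IsPotentialDomain Ω) {τ₁ τ₂ : ℝ} {χ₁ χ₂ : ℝ → ℝ} {ρ₁ ρ₂ : ℝ → ℂ}
    (h₁ : ContDiffOn ℝ ∞ χ₁ (timeInterval Ω)) (h₂ : ContDiffOn ℝ ∞ χ₂ (timeInterval Ω)) (a b : ℝ)
    {z : TotalSpace} (hz : z ∈ phaseDomain Ω) :
    symField (a * τ₁ + b * τ₂) (fun t => a * χ₁ t + b * χ₂ t) (fun t => a * ρ₁ t + b * ρ₂ t) z =
      a • symField τ₁ χ₁ ρ₁ z + b • symField τ₂ χ₂ ρ₂ z := by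
  unfold symField
  rw [(deriv_deriv_linear hΩ.isOpen_timeInterval h₁ h₂ a b (fst_mem_timeInterval hz)).1]
  simp
  ring

/-- The maximal Lie invariance algebra as a vector space. -/
noncomputable def lieSubmodule (hσ : σ ≠ 0) (hV : IsPotential Ω V) :
    Submodule ℝ (phaseDomain Ω → ℝ × ℝ × ℂ) where
  carrier := lieAlgebra σ Ω V
  add_mem' := by
    intro f g hf hg
    obtain ⟨τ₁, χ₁, ρ₁, h₁, rfl⟩ := (mem_lieAlgebra_iff hσ hV).1 hf
    obtain ⟨τ₂, χ₂, ρ₂, h₂, rfl⟩ := (mem_lieAlgebra_iff hσ hV).1 hg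
    refine (mem_lieAlgebra_iff hσ hV).2 ⟨_, _, _, h₁.linear hV.domain h₂ 1 1, funext fun z => ?_⟩
    have := symField_linear hV.domain (τ₁ := τ₁) (τ₂ := τ₂) (ρ₁ := ρ₁) (ρ₂ := ρ₂)
      h₁.smooth_chi h₂.smooth_chi 1 1 z.2
    simp only [one_smul] at this
    exact this.symm
  zero_mem' := by
    refine (mem_lieAlgebra_iff hσ hV).2 ⟨0, fun _ => 0, fun _ => 0, ⟨contDiffOn_const,
      contDiffOn_const, fun p _ => by simp⟩, funext fun z => by simp [symField]; rfl⟩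
  smul_mem' := by
    intro a f hf
    obtain ⟨τ₁, χ₁, ρ₁, h₁, rfl⟩ := (mem_lieAlgebra_iff hσ hV).1 hf
    refine (mem_lieAlgebra_iff hσ hV).2 ⟨_, _, _, h₁.linear hV.domain h₁ a 0, funext fun z => ?_⟩
    have := symField_linear hV.domain (τ₁ := τ₁) (τ₂ := τ₁) (ρ₁ := ρ₁) (ρ₂ := ρ₁)
      h₁.smooth_chi h₁.smooth_chi a 0 z.2
    simp only [zero_smul, add_zero] at this
    exact this.symm

theorem hasBasis_of {n : ℕ} {A : Submodule ℝ (phaseDomain Ω → ℝ × ℝ × ℂ)} {b : Fin n → Field}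
    (hb : ∀ i, (phaseDomain Ω).domRestrict (b i) ∈ A)
    (hspan : ∀ f ∈ A, ∃ c : Fin n → ℝ, ∀ z : phaseDomain Ω, f z = ∑ i, c i • b i z)
    (hli : ∀ c : Fin n → ℝ, (∀ z ∈ phaseDomain Ω, ∑ i, c i • b i z = 0) → ∀ i, c i = 0) :
    HasBasis Ω (A : Set _) b := by
  constructor
  · rw [Fintype.linearIndependent_iff]
    intro c hc
    refine hli c fun z hz => ?_
    have := congrFun hc ⟨z, hz⟩
    simpa using this
  · congr 1
    refine le_antisymm (Submodule.span_le.2 ?_) fun f hf => ?_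
    · rintro _ ⟨i, rfl⟩
      exact hb i
    · obtain ⟨c, hc⟩ := hspan f hf
      rw [Submodule.mem_span_range_iff_exists_fun]
      refine ⟨c, funext fun z => ?_⟩
      rw [hc z]
      simp

/-! ### The kernel fields -/

/-- The coefficient of `I'`. -/
noncomputable def rhoI' (σ : ℂ) (t : ℝ) : ℂ :=
  if σ.im = 0 then 1 + I * σ.re * t else Real.exp (-σ.im * t) * (σ.im - I * σ.re)

theorem fieldI'_eq (σ : ℂ) (z : TotalSpace) : fieldI' σ z = symField 0 (fun _ => 0) (rhoI' σ) z := by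
  unfold fieldI' rhoI' symField
  split_ifs with h
  · simp [fieldI, timeMul, fieldM]; ring
  · simp [fieldI, timeMul, fieldM]; ring

theorem fieldM_eq (z : TotalSpace) : fieldM z = symField 0 (fun _ => 0) (fun _ => I) z := by
  simp [fieldM, symField]

theorem fieldDt_eq (z : TotalSpace) : fieldDt z = symField 1 (fun _ => 0) (fun _ => 0) z := by
  simp [fieldDt, symField]

theorem contDiff_rhoI' (σ : ℂ) : ContDiff ℝ ∞ (rhoI' σ) := by
  unfold rhoI'
  split_ifs with h
  · exact contDiff_const.add (contDiff_const.mul ofRealCLM.contDiff)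
  · refine ContDiff.mul (ofRealCLM.contDiff.comp ?_) contDiff_const
    exact Real.contDiff_exp.comp (contDiff_const.mul contDiff_id)

/-- This is `i ρ_t + σ Re ρ = 0`, the classifying condition for `τ = χ = 0`, which does not involve
the potential. -/
theorem hasDerivAt_rhoI' (σ : ℂ) (t : ℝ) : HasDerivAt (rhoI' σ) (I * σ * (rhoI' σ t).re) t := by
  unfold rhoI'
  split_ifs with h
  · have : HasDerivAt (fun t : ℝ => 1 + I * σ.re * (t : ℂ)) (I * σ.re * 1) t :=
      ((hasDerivAt_id t).ofReal_comp.const_mul (I * σ.re)).const_add 1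
    refine this.congr_deriv ?_
    apply Complex.ext <;> simp [h]
  · have h1 : HasDerivAt (fun t : ℝ => Real.exp (-σ.im * t)) (Real.exp (-σ.im * t) * (-σ.im * 1)) t :=
      ((hasDerivAt_id t).const_mul (-σ.im)).exp
    refine (h1.ofReal_comp.mul_const _).congr_deriv ?_
    rw [re_ofReal_mul]
    apply Complex.ext <;> simp [-ofReal_exp] <;> ring

theorem rhoI'_re_ne_zero (σ : ℂ) (t : ℝ) : (rhoI' σ t).re ≠ 0 := by
  unfold rhoI'
  split_ifs with h
  · simp
  · rw [re_ofReal_mul]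
    simp [h, (Real.exp_pos _).ne']

/-- The system is triangular: the real part satisfies `y' = -σ₂ y`, for which `e^{σ₂ t}` is an
integrating factor, and once it vanishes `ρ` has zero derivative. -/
theorem rho_eq_zero {J : Set ℝ} (hJ : IsOpen J) (hJc : J.OrdConnected) {ρ : ℝ → ℂ}
    (h : ∀ t ∈ J, HasDerivAt ρ (I * σ * (ρ t).re) t) {a : ℝ} (ha : a ∈ J) (h0 : ρ a = 0) :
    ∀ t ∈ J, ρ t = 0 := by
  have hre : ∀ t ∈ J, HasDerivAt (fun t => (ρ t).re) (-σ.im * (ρ t).re) t := fun t ht =>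
    (reCLM.hasFDerivAt.comp_hasDerivAt t (h t ht)).congr_deriv (by simp)
  have h1 : ∀ t ∈ J, HasDerivAt (fun t => Real.exp (σ.im * t) * (ρ t).re) 0 t := fun t ht => by
    have e : HasDerivAt (fun t : ℝ => Real.exp (σ.im * t)) (Real.exp (σ.im * t) * (σ.im * 1)) t :=
      ((hasDerivAt_id t).const_mul σ.im).exp
    refine (e.mul (hre t ht)).congr_deriv ?_
    ring
  obtain ⟨k, hk⟩ := eq_of_hasDerivAt_eq hJ hJc h1 (g := fun _ => 0) fun t _ => hasDerivAt_const t 0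
  have hk0 : k = 0 := by simpa [h0] using (hk a ha).symm
  have hz : ∀ t ∈ J, (ρ t).re = 0 := fun t ht => by
    have := hk t ht
    rw [hk0] at this
    simpa [(Real.exp_pos _).ne'] using this
  obtain ⟨k, hk⟩ := eq_of_hasDerivAt_eq hJ hJc (f := ρ) (h := fun _ => 0)
    (fun t ht => (h t ht).congr_deriv (by rw [hz t ht]; simp)) (g := fun _ => 0)
    fun t _ => hasDerivAt_const t 0
  have hk0 : k = 0 := by simpa [h0] using (hk a ha).symm
  intro t ht
  rw [hk t ht, hk0, add_zero]

/-- Solutions of `i ρ_t + σ Re ρ = 0`. -/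
theorem exists_rho_eq {J : Set ℝ} (hJ : IsOpen J) (hJc : J.OrdConnected) {ρ : ℝ → ℂ}
    (h : ∀ t ∈ J, HasDerivAt ρ (I * σ * (ρ t).re) t) :
    ∃ a b : ℝ, ∀ t ∈ J, ρ t = a * rhoI' σ t + b * I := by
  rcases J.eq_empty_or_nonempty with rfl | ⟨s, hs⟩
  · exact ⟨0, 0, by simp⟩
  -- The constants match `ρ` at one time: `a` by the real part, which never vanishes for the
  -- coefficient of `I'`, and `b` by the imaginary part. Uniqueness does the rest.
  set a : ℝ := (ρ s).re / (rhoI' σ s).re with ha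
  set b : ℝ := (ρ s).im - a * (rhoI' σ s).im with hb
  refine ⟨a, b, fun t ht => ?_⟩
  have hne := rhoI'_re_ne_zero σ s
  have := rho_eq_zero (σ := σ) hJ hJc (ρ := fun t => ρ t - (a * rhoI' σ t + b * I)) (fun t ht => by
    refine ((h t ht).sub (((hasDerivAt_rhoI' σ t).const_mul (a : ℂ)).add_const _)).congr_deriv ?_
    simp
    ring) hs (by
      apply Complex.ext
      · simp [ha]; field_simp; simp
      · simp [hb]) t ht
  linear_combination this

theorem rho_linear_independent {t : ℝ} {a b : ℝ} (h : (a : ℂ) * rhoI' σ t + b * I = 0) :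
    a = 0 ∧ b = 0 := by
  have h1 := congrArg Complex.re h
  have h2 := congrArg Complex.im h
  simp [rhoI'_re_ne_zero] at h1
  simp [h1] at h2
  exact ⟨h1, h2⟩

theorem isSymData_rho {ρ : ℝ → ℂ} (hρ : ContDiffOn ℝ ∞ ρ (timeInterval Ω))
    (h : ∀ t ∈ timeInterval Ω, HasDerivAt ρ (I * σ * (ρ t).re) t) :
    IsSymData σ Ω V 0 (fun _ => 0) ρ := by
  refine ⟨contDiffOn_const, hρ, fun p hp => ?_⟩
  rw [(h p.1 (mem_timeInterval hp)).deriv]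
  simp
  linear_combination σ * ((ρ p.1).re : ℂ) * I_sq

theorem isSymData_M : IsSymData σ Ω V 0 (fun _ => 0) (fun _ => I) :=
  isSymData_rho contDiffOn_const fun t _ => by simpa using hasDerivAt_const t I

theorem isSymData_I' : IsSymData σ Ω V 0 (fun _ => 0) (rhoI' σ) :=
  isSymData_rho (contDiff_rhoI' σ).contDiffOn fun t _ => hasDerivAt_rhoI' σ t

theorem fieldM_mem (hσ : σ ≠ 0) (hV : IsPotential Ω V) :
    (phaseDomain Ω).domRestrict fieldM ∈ lieAlgebra σ Ω V :=
  isSymData_M.mem hσ hV fun z _ => fieldM_eq z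

theorem fieldI'_mem (hσ : σ ≠ 0) (hV : IsPotential Ω V) :
    (phaseDomain Ω).domRestrict (fieldI' σ) ∈ lieAlgebra σ Ω V :=
  isSymData_I'.mem hσ hV fun z _ => fieldI'_eq σ z

theorem IsSymData.hasDerivAt_rho (hΩ : IsPotentialDomain Ω) {χ : ℝ → ℝ} {ρ : ℝ → ℂ}
    (h : IsSymData σ Ω V 0 χ ρ) (hχ : ∀ t ∈ timeInterval Ω, χ t = 0) :
    ∀ t ∈ timeInterval Ω, HasDerivAt ρ (I * σ * (ρ t).re) t := by
  have hJ := hΩ.isOpen_timeInterval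
  rintro _ ⟨p, hp, rfl⟩
  have ht := mem_timeInterval hp
  have e := h.classifying p hp
  have h2 : ∀ t ∈ timeInterval Ω, deriv χ t = 0 := by
    intro t ht
    have : χ =ᶠ[𝓝 t] fun _ => 0 := by filter_upwards [hJ.mem_nhds ht] with s hs using hχ s hs
    rw [this.deriv_eq]; simp
  have h3 : deriv χ =ᶠ[𝓝 p.1] fun _ => 0 := by
    filter_upwards [hJ.mem_nhds ht] with s hs using h2 s hs
  rw [hχ _ ht, h3.deriv_eq] at e
  refine (hasDerivAt_deriv_of_contDiffOn hJ h.smooth_rho ht).congr_deriv ?_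
  simp at e
  linear_combination -I * e + deriv ρ p.1 * I_sq

theorem symField_eq_of_chi_zero (hΩ : IsPotentialDomain Ω) {τ : ℝ} {χ : ℝ → ℝ} {ρ : ℝ → ℂ}
    (hχ : ∀ t ∈ timeInterval Ω, χ t = 0) {z : TotalSpace} (hz : z ∈ phaseDomain Ω) :
    symField τ χ ρ z = (τ, 0, ρ z.1 * z.2.2) := by
  have : χ =ᶠ[𝓝 z.1] fun _ => 0 := by
    filter_upwards [hΩ.isOpen_timeInterval.mem_nhds (fst_mem_timeInterval hz)] with s hs using hχ s hs
  unfold symField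
  rw [this.deriv_eq, hχ _ (fst_mem_timeInterval hz)]
  simp

/-- If no symmetry involves `∂_t` or `∂_x`, then `M`, `I'` form a basis. -/
theorem hasBasis_MI' (hσ : σ ≠ 0) (hV : IsPotential Ω V)
    (h : ∀ τ χ ρ, IsSymData σ Ω V τ χ ρ → τ = 0 ∧ ∀ t ∈ timeInterval Ω, χ t = 0) :
    HasBasis Ω (lieAlgebra σ Ω V) ![fieldM, fieldI' σ] := by
  have hdom := hV.domain
  refine hasBasis_of (A := lieSubmodule hσ hV) ?_ ?_ ?_
  · intro i
    fin_cases i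
    · exact fieldM_mem hσ hV
    · exact fieldI'_mem hσ hV
  · intro f hf
    obtain ⟨τ, χ, ρ, hs, rfl⟩ := (mem_lieAlgebra_iff hσ hV).1 hf
    obtain ⟨rfl, hχ⟩ := h τ χ ρ hs
    obtain ⟨a, b, hab⟩ := exists_rho_eq hdom.isOpen_timeInterval hdom.ordConnected_timeInterval
      (hs.hasDerivAt_rho hdom hχ)
    refine ⟨![b, a], fun z => ?_⟩
    rw [domRestrict_apply, symField_eq_of_chi_zero hdom hχ z.2, hab _ (fst_mem_timeInterval z.2)]
    simp [Fin.sum_univ_two, fieldM_eq, fieldI'_eq, symField]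
    ring
  · intro c hc
    obtain ⟨p, hp⟩ := hdom.exists_mem
    have := hc (p.1, p.2, 1) ⟨hp, one_ne_zero⟩
    simp [Fin.sum_univ_two, fieldM_eq, fieldI'_eq, symField] at this
    obtain ⟨h1, h0⟩ := rho_linear_independent (a := c 1) (b := c 0) (by linear_combination this)
    intro i; fin_cases i <;> assumption

/-- If all symmetries are stationary up to `∂_t`, then `M`, `I'`, `∂_t` form a basis. -/
theorem hasBasis_MI'Dt (hσ : σ ≠ 0) (hV : IsPotential Ω V) (hst : IsStationary Ω V)
    (h : ∀ χ ρ, IsSymData σ Ω V 0 χ ρ → ∀ t ∈ timeInterval Ω, χ t = 0) :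
    HasBasis Ω (lieAlgebra σ Ω V) ![fieldM, fieldI' σ, fieldDt] := by
  have hdom := hV.domain
  have hDt : IsSymData σ Ω V 1 (fun _ => 0) (fun _ => 0) :=
    ⟨contDiffOn_const, contDiffOn_const, fun p hp => by simp [dT, hst p hp]⟩
  refine hasBasis_of (A := lieSubmodule hσ hV) ?_ ?_ ?_
  · intro i
    fin_cases i
    · exact fieldM_mem hσ hV
    · exact fieldI'_mem hσ hV
    · exact hDt.mem hσ hV fun z _ => fieldDt_eq z
  · intro f hf
    obtain ⟨τ, χ, ρ, hs, rfl⟩ := (mem_lieAlgebra_iff hσ hV).1 hf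
    have hs' : IsSymData σ Ω V 0 χ ρ := by
      have := hs.linear hdom hDt 1 (-τ)
      simpa using this
    have hχ := h χ ρ hs'
    obtain ⟨a, b, hab⟩ := exists_rho_eq hdom.isOpen_timeInterval hdom.ordConnected_timeInterval
      (hs'.hasDerivAt_rho hdom hχ)
    refine ⟨![b, a, τ], fun z => ?_⟩
    rw [domRestrict_apply, symField_eq_of_chi_zero hdom hχ z.2, hab _ (fst_mem_timeInterval z.2)]
    simp [Fin.sum_univ_three, fieldM_eq, fieldI'_eq, fieldDt_eq, symField]
    ring
  · intro c hc
    obtain ⟨p, hp⟩ := hdom.exists_mem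
    have := hc (p.1, p.2, 1) ⟨hp, one_ne_zero⟩
    simp [Fin.sum_univ_three, fieldM_eq, fieldI'_eq, fieldDt_eq, symField] at this
    obtain ⟨h1, h0⟩ := rho_linear_independent (a := c 1) (b := c 0) (by linear_combination this.2)
    intro i; fin_cases i
    · exact h0
    · exact h1
    · exact this.1

end LogNLS

/-! ### Symmetries of the potentials `v(t) x² + i w(t) x`. -/

namespace LogNLS

variable {σ : ℂ} {Ω : Set (ℝ × ℝ)} {V : ℝ × ℝ → ℂ}

/-- The section contains four equidistant points with step `ε / 4`, and finite differences recover
the coefficients from the cubic one down. This permits splitting with respect to `x`. -/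
theorem cubic_eq_zero (hΩ : IsPotentialDomain Ω) {p : ℝ × ℝ} (hp : p ∈ Ω) {A B C D : ℂ}
    (h : ∀ x : ℝ, (p.1, x) ∈ Ω → A * (x : ℂ) ^ 3 + B * (x : ℂ) ^ 2 + C * (x : ℂ) + D = 0) :
    A = 0 ∧ B = 0 ∧ C = 0 ∧ D = 0 := by
  obtain ⟨ε, hε, hball⟩ := Metric.isOpen_iff.1 (hΩ.isOpen_section p.1) p.2 hp
  have hmem : ∀ k : ℝ, 0 ≤ k → k ≤ 3 → (p.1, p.2 + k * (ε / 4)) ∈ Ω := by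
    intro k hk hk'
    refine hball ?_
    rw [Metric.mem_ball, Real.dist_eq, abs_lt]
    constructor <;> nlinarith
  have e0 := h _ (hmem 0 le_rfl (by norm_num))
  have e1 := h _ (hmem 1 (by norm_num) (by norm_num))
  have e2 := h _ (hmem 2 (by norm_num) (by norm_num))
  have e3 := h _ (hmem 3 (by norm_num) (by norm_num))
  have hd : (ε : ℂ) ≠ 0 := by exact_mod_cast hε.ne'
  push_cast at e0 e1 e2 e3
  have hA : A = 0 := by
    have : (ε : ℂ) ^ 3 * A = 0 := by linear_combination 64 / 6 * (e3 - 3 * e2 + 3 * e1 - e0)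
    simpa [hd] using this
  subst hA
  have hB : B = 0 := by
    have : (ε : ℂ) ^ 2 * B = 0 := by linear_combination 16 / 2 * (e2 - 2 * e1 + e0)
    simpa [hd] using this
  subst hB
  have hC : C = 0 := by
    have : (ε : ℂ) * C = 0 := by linear_combination 4 * (e1 - e0)
    simpa [hd] using this
  subst hC
  exact ⟨rfl, rfl, rfl, by simpa using e0⟩

/-- A potential quadratic in `x`. -/
theorem dT_dX_quadratic (hΩ : IsOpen Ω) {a b c : ℝ → ℂ}
    (hV : ∀ p ∈ Ω, V p = a p.1 * (p.2 : ℂ) ^ 2 + b p.1 * (p.2 : ℂ) + c p.1) {p : ℝ × ℝ} (hp : p ∈ Ω)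
    (ha : DifferentiableAt ℝ a p.1) (hb : DifferentiableAt ℝ b p.1)
    (hc : DifferentiableAt ℝ c p.1) :
    dT V p = deriv a p.1 * (p.2 : ℂ) ^ 2 + deriv b p.1 * (p.2 : ℂ) + deriv c p.1 ∧
    dX V p = 2 * a p.1 * (p.2 : ℂ) + b p.1 := by
  have hx : DifferentiableAt ℝ (fun p : ℝ × ℝ => (p.2 : ℂ)) p :=
    ofRealCLM.differentiableAt.comp p differentiableAt_snd
  have hd : DifferentiableAt ℝ
      (fun p : ℝ × ℝ => a p.1 * (p.2 : ℂ) ^ 2 + b p.1 * (p.2 : ℂ) + c p.1) p :=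
    (((ha.comp p differentiableAt_fst).mul (hx.pow 2)).add
      ((hb.comp p differentiableAt_fst).mul hx)).add (hc.comp p differentiableAt_fst)
  have he : V =ᶠ[𝓝 p] fun p : ℝ × ℝ => a p.1 * (p.2 : ℂ) ^ 2 + b p.1 * (p.2 : ℂ) + c p.1 := by
    filter_upwards [hΩ.mem_nhds hp] with q hq using hV q hq
  have e1 : dT V p = dT (fun p : ℝ × ℝ => a p.1 * (p.2 : ℂ) ^ 2 + b p.1 * (p.2 : ℂ) + c p.1) p := by
    unfold dT; rw [he.fderiv_eq]
  have e2 : dX V p = dX (fun p : ℝ × ℝ => a p.1 * (p.2 : ℂ) ^ 2 + b p.1 * (p.2 : ℂ) + c p.1) p := by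
    unfold dX; rw [he.fderiv_eq]
  rw [e1, e2]
  constructor
  · refine (hasDerivAt_dT hd).unique ?_
    exact ((ha.hasDerivAt.mul_const ((p.2 : ℂ) ^ 2)).fun_add
      (hb.hasDerivAt.mul_const (p.2 : ℂ))).fun_add hc.hasDerivAt
  · refine (hasDerivAt_dX hd).unique ?_
    have h1 : HasDerivAt (fun x : ℝ => (x : ℂ)) 1 p.2 := (hasDerivAt_id p.2).ofReal_comp
    have := (((h1.fun_pow 2).const_mul (a p.1)).fun_add (h1.const_mul (b p.1))).add_const (c p.1)
    refine this.congr_deriv ?_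
    simp
    ring

/-- The potential `v(t) x² + i w(t) x`. -/
structure IsReduced (Ω : Set (ℝ × ℝ)) (V : ℝ × ℝ → ℂ) (v w : ℝ → ℝ) : Prop where
  smooth_v : ContDiffOn ℝ ∞ v (timeInterval Ω)
  smooth_w : ContDiffOn ℝ ∞ w (timeInterval Ω)
  eq : ∀ p ∈ Ω, V p = (v p.1 : ℂ) * (p.2 : ℂ) ^ 2 + I * (w p.1 : ℂ) * (p.2 : ℂ)

theorem IsReduced.dT_dX (hΩ : IsPotentialDomain Ω) {v w : ℝ → ℝ} (h : IsReduced Ω V v w)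
    {p : ℝ × ℝ} (hp : p ∈ Ω) :
    dT V p = (deriv v p.1 : ℝ) * (p.2 : ℂ) ^ 2 + I * (deriv w p.1 : ℝ) * (p.2 : ℂ) ∧
    dX V p = 2 * (v p.1 : ℂ) * (p.2 : ℂ) + I * (w p.1 : ℂ) := by
  have hJ := hΩ.isOpen_timeInterval
  have hv := (hasDerivAt_deriv_of_contDiffOn hJ h.smooth_v (mem_timeInterval hp)).ofReal_comp
  have hw := (hasDerivAt_deriv_of_contDiffOn hJ h.smooth_w
    (mem_timeInterval hp)).ofReal_comp.const_mul I
  have := dT_dX_quadratic (V := V) hΩ.isOpen (a := fun t => (v t : ℂ)) (b := fun t => I * (w t : ℂ))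
    (c := fun _ => 0) (fun p hp => by rw [h.eq p hp]; ring) hp hv.differentiableAt
    hw.differentiableAt (by fun_prop)
  rw [hv.deriv, hw.deriv] at this
  simpa using this

/-- Compare the coefficients of `x²`, `x` and `1`. In the coefficient of `x` the real part gives the
equation for `χ` and the imaginary part gives `τ w_t = 0`, because `v`, `w`, `χ` are real. -/
theorem IsReduced.symData_iff (hΩ : IsPotentialDomain Ω) {v w : ℝ → ℝ} (h : IsReduced Ω V v w)
    {τ : ℝ} {χ : ℝ → ℝ} {ρ : ℝ → ℂ} (hχ : ContDiffOn ℝ ∞ χ (timeInterval Ω))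
    (hρ : ContDiffOn ℝ ∞ ρ (timeInterval Ω)) :
    IsSymData σ Ω V τ χ ρ ↔ ∀ t ∈ timeInterval Ω, τ * deriv v t = 0 ∧ τ * deriv w t = 0 ∧
      deriv (deriv χ) t = 4 * v t * χ t ∧ HasDerivAt ρ (I * σ * (ρ t).re - χ t * w t) t := by
  have hJ := hΩ.isOpen_timeInterval
  constructor
  · rintro hs _ ⟨p, hp, rfl⟩
    have hρd := hasDerivAt_deriv_of_contDiffOn hJ hρ (mem_timeInterval hp)
    obtain ⟨-, h2, h1, h0⟩ := cubic_eq_zero hΩ hp (A := 0) (B := τ * (deriv v p.1 : ℝ))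
      (C := τ * (I * (deriv w p.1 : ℝ)) + χ p.1 * (2 * v p.1) - (deriv (deriv χ) p.1 : ℝ) / 2)
      (D := χ p.1 * (I * w p.1) + I * deriv ρ p.1 + σ * ((ρ p.1).re : ℝ)) (fun x hx => by
        have := hs.classifying _ hx
        rw [(h.dT_dX hΩ hx).1, (h.dT_dX hΩ hx).2] at this
        simp only at this
        linear_combination this)
    have hre := congrArg Complex.re h1
    have him := congrArg Complex.im h1
    simp at hre him
    refine ⟨by exact_mod_cast h2, by simpa using him, by linarith, hρd.congr_deriv ?_⟩
    linear_combination -I * h0 + (χ p.1 * w p.1 + deriv ρ p.1) * I_sq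
  · intro hh
    refine ⟨hχ, hρ, fun p hp => ?_⟩
    obtain ⟨e1, e2, e3, e4⟩ := hh _ (mem_timeInterval hp)
    have e1' : (τ : ℂ) * (deriv v p.1 : ℝ) = 0 := by exact_mod_cast e1
    have e2' : (τ : ℂ) * (deriv w p.1 : ℝ) = 0 := by exact_mod_cast e2
    rw [(h.dT_dX hΩ hp).1, (h.dT_dX hΩ hp).2, e3, e4.deriv]
    push_cast
    linear_combination e1' * (p.2 : ℂ) ^ 2 + I * e2' * p.2 + σ * ((ρ p.1).re : ℝ) * I_sq

theorem exists_isG' {J : Set ℝ} (hJ : IsOpen J) (hJc : J.OrdConnected) {w χ : ℝ → ℝ}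
    (hw : ContDiffOn ℝ ∞ w J) (hχ : ContDiffOn ℝ ∞ χ J) : ∃ Q, IsG' σ J w χ Q := by
  have hexp : ∀ a : ℝ, ContDiffOn ℝ ∞ (fun t => Real.exp (a * t)) J := fun a =>
    (Real.contDiff_exp.comp (contDiff_const.mul contDiff_id)).contDiffOn
  obtain ⟨χ₁, h1, h1'⟩ := exists_antiderivative hJ hJc (((hexp σ.im).mul hw).mul hχ)
  obtain ⟨κ, -, h2'⟩ := exists_antiderivative hJ hJc ((hexp (-σ.im)).mul h1)
  exact ⟨_, χ₁, κ, h1', h2', rfl⟩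

/-- The iterated antiderivatives in `G'(χ)` are a quadrature of `ρ_t = i σ Re ρ - χ w`: the real
part `-e^{-σ₂ t} χ̃` is found first with an integrating factor, then the imaginary part. Smoothness
follows from the derivative relations, whichever antiderivatives are chosen. -/
theorem IsG'.exists_symData (hΩ : IsPotentialDomain Ω) {v w : ℝ → ℝ} (h : IsReduced Ω V v w)
    {χ : ℝ → ℝ} {Q : Field} (hχ : ContDiffOn ℝ ∞ χ (timeInterval Ω))
    (hode : ∀ t ∈ timeInterval Ω, deriv (deriv χ) t = 4 * v t * χ t)
    (hQ : IsG' σ (timeInterval Ω) w χ Q) :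
    ∃ ρ, IsSymData σ Ω V 0 χ ρ ∧ ∀ z ∈ phaseDomain Ω, Q z = symField 0 χ ρ z := by
  have hJ := hΩ.isOpen_timeInterval
  have hexp : ∀ a : ℝ, ContDiffOn ℝ ∞ (fun t => Real.exp (a * t)) (timeInterval Ω) := fun a =>
    (Real.contDiff_exp.comp (contDiff_const.mul contDiff_id)).contDiffOn
  obtain ⟨χ₁, κ, h1, h2, rfl⟩ := hQ
  have s1 := contDiffOn_infty_of_hasDerivAt hJ h1 (((hexp σ.im).mul h.smooth_w).mul hχ)
  have s2 := contDiffOn_infty_of_hasDerivAt hJ h2 ((hexp (-σ.im)).mul s1)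
  let ρ : ℝ → ℂ := fun t => -((Real.exp (-σ.im * t) * χ₁ t : ℝ) : ℂ) - I * ((σ.re * κ t : ℝ) : ℂ)
  have sρ : ContDiffOn ℝ ∞ ρ (timeInterval Ω) :=
    (ofRealCLM.contDiff.comp_contDiffOn ((hexp (-σ.im)).mul s1)).neg.sub
      (contDiffOn_const.mul (ofRealCLM.contDiff.comp_contDiffOn (contDiffOn_const.mul s2)))
  refine ⟨ρ, (h.symData_iff hΩ hχ sρ).2 fun t ht => ⟨by simp, by simp, hode t ht, ?_⟩, fun z _ => ?_⟩
  · have e : HasDerivAt (fun t : ℝ => Real.exp (-σ.im * t)) (Real.exp (-σ.im * t) * (-σ.im * 1)) t :=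
      ((hasDerivAt_id t).const_mul (-σ.im)).exp
    have e1 := (e.mul (h1 t ht)).ofReal_comp.neg
    have e2 := ((h2 t ht).const_mul σ.re).ofReal_comp.const_mul I
    have hee : Real.exp (-(σ.im * t)) * Real.exp (σ.im * t) = 1 := by
      rw [← Real.exp_add]; simp
    refine (e1.sub e2).congr_deriv ?_
    apply Complex.ext
    · simp [ρ, -ofReal_exp]
      linear_combination -(w t * χ t) * hee
    · simp [ρ, -ofReal_exp]
  · simp [fieldG, timeMul, fieldI, fieldM, symField, ρ]
    ring

/-- The span of two solutions with nonvanishing Wronskian contains every solution. -/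
theorem exists_solution_eq {J : Set ℝ} (hJ : IsOpen J) (hJc : J.OrdConnected) {v χ χ₁ χ₂ : ℝ → ℝ}
    (hv : ContDiffOn ℝ ∞ v J) (hχ : ContDiffOn ℝ ∞ χ J)
    (h : ∀ t ∈ J, deriv (deriv χ) t = 4 * v t * χ t) (hχ₁ : ContDiffOn ℝ ∞ χ₁ J)
    (h₁ : ∀ t ∈ J, deriv (deriv χ₁) t = 4 * v t * χ₁ t) (hχ₂ : ContDiffOn ℝ ∞ χ₂ J)
    (h₂ : ∀ t ∈ J, deriv (deriv χ₂) t = 4 * v t * χ₂ t) {s : ℝ} (hs : s ∈ J)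
    (hW : χ₁ s * deriv χ₂ s - χ₂ s * deriv χ₁ s ≠ 0) :
    ∃ a b : ℝ, ∀ t ∈ J, χ t = a * χ₁ t + b * χ₂ t := by
  set W := χ₁ s * deriv χ₂ s - χ₂ s * deriv χ₁ s with hWdef
  -- Cramer's rule for the Cauchy data of `χ` at `s`.
  set a := (χ s * deriv χ₂ s - χ₂ s * deriv χ s) / W with ha
  set b := (χ₁ s * deriv χ s - χ s * deriv χ₁ s) / W with hb
  have hlin := fun t (ht : t ∈ J) => deriv_deriv_linear hJ hχ₁ hχ₂ a b ht
  have hs12 : ContDiffOn ℝ ∞ (fun s => a * χ₁ s + b * χ₂ s) J :=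
    (contDiffOn_const.mul hχ₁).add (contDiffOn_const.mul hχ₂)
  have hlin' := fun t (ht : t ∈ J) => deriv_deriv_linear hJ hχ hs12 1 (-1) ht
  refine ⟨a, b, fun t ht => ?_⟩
  have := eq_zero_of_second_order_ode hJ hJc
    (χ := fun s => 1 * χ s + -1 * (a * χ₁ s + b * χ₂ s))
    ((contDiffOn_const.mul hχ).add (contDiffOn_const.mul hs12))
    (fun t ht => ⟨fun t => 4 * v t, (hv.continuousOn.continuousAt (hJ.mem_nhds ht)).const_mul 4, by
      filter_upwards [hJ.mem_nhds ht] with s hs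
      rw [(hlin' s hs).2, (hlin s hs).2, h s hs, h₁ s hs, h₂ s hs]
      ring⟩) hs (by
        rw [ha, hb]; field_simp; rw [hWdef]; ring) (by
        rw [(hlin' s hs).1, (hlin s hs).1, ha, hb]; field_simp; rw [hWdef]; ring) t ht
  linarith

theorem wronskian_linear_independent {J : Set ℝ} (hJ : IsOpen J) {χ₁ χ₂ : ℝ → ℝ}
    (hχ₁ : ContDiffOn ℝ ∞ χ₁ J) (hχ₂ : ContDiffOn ℝ ∞ χ₂ J) {s : ℝ} (hs : s ∈ J)
    (hW : χ₁ s * deriv χ₂ s - χ₂ s * deriv χ₁ s ≠ 0) {a b : ℝ}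
    (h : ∀ t ∈ J, a * χ₁ t + b * χ₂ t = 0) : a = 0 ∧ b = 0 := by
  have h1 := h s hs
  have h2 : a * deriv χ₁ s + b * deriv χ₂ s = 0 := by
    rw [← (deriv_deriv_linear hJ hχ₁ hχ₂ a b hs).1]
    have : (fun s => a * χ₁ s + b * χ₂ s) =ᶠ[𝓝 s] fun _ => 0 := by
      filter_upwards [hJ.mem_nhds hs] with t ht using h t ht
    rw [this.deriv_eq]; simp
  constructor
  · have : (χ₁ s * deriv χ₂ s - χ₂ s * deriv χ₁ s) * a = 0 := by
      linear_combination deriv χ₂ s * h1 - χ₂ s * h2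
    exact (mul_eq_zero.1 this).resolve_left hW
  · have : (χ₁ s * deriv χ₂ s - χ₂ s * deriv χ₁ s) * b = 0 := by
      linear_combination χ₁ s * h2 - deriv χ₁ s * h1
    exact (mul_eq_zero.1 this).resolve_left hW

/-- If the Wronskian vanishes at `s`, then some nontrivial combination has zero Cauchy data at `s`
and is zero by uniqueness, against linear independence. -/
theorem IsFundamentalSystem.wronskian_ne_zero {J : Set ℝ} (hJ : IsOpen J) (hJc : J.OrdConnected)
    {v χ₁ χ₂ : ℝ → ℝ} (hv : ContDiffOn ℝ ∞ v J) (h : IsFundamentalSystem J v χ₁ χ₂) {s : ℝ}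
    (hs : s ∈ J) : χ₁ s * deriv χ₂ s - χ₂ s * deriv χ₁ s ≠ 0 := by
  obtain ⟨⟨s1, o1⟩, ⟨s2, o2⟩, hli⟩ := h
  intro hW
  have key : ∀ a b : ℝ, a * χ₁ s + b * χ₂ s = 0 → a * deriv χ₁ s + b * deriv χ₂ s = 0 →
      a = 0 ∧ b = 0 := by
    intro a b h0 h1
    have hlin := fun t (ht : t ∈ J) => deriv_deriv_linear hJ s1 s2 a b ht
    have hz := eq_zero_of_second_order_ode hJ hJc
      (χ := fun s => a * χ₁ s + b * χ₂ s)
      ((contDiffOn_const.mul s1).add (contDiffOn_const.mul s2))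
      (fun t ht => ⟨fun t => 4 * v t, (hv.continuousOn.continuousAt (hJ.mem_nhds ht)).const_mul 4, by
        filter_upwards [hJ.mem_nhds ht] with s hs
        rw [(hlin s hs).2, o1 s hs, o2 s hs]
        ring⟩) hs h0 (by rw [(hlin s hs).1, h1])
    exact LinearIndependent.pair_iff.1 hli a b (funext fun t => by simpa using hz t t.2)
  -- The coefficients of these two combinations are themselves Cauchy data of the solutions.
  -- Independence forces all of them to vanish, and then even the first solution alone contradicts
  -- independence.
  obtain ⟨k1, k2⟩ := key (χ₂ s) (-χ₁ s) (by ring) (by linarith)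
  obtain ⟨k3, k4⟩ := key (deriv χ₂ s) (-deriv χ₁ s) (by linarith) (by ring)
  obtain ⟨k5, -⟩ := key 1 0 (by rw [neg_eq_zero.1 k2]; ring) (by rw [neg_eq_zero.1 k4]; ring)
  exact one_ne_zero k5

theorem exists_isFundamentalSystem {J : Set ℝ} (hJ : IsOpen J) (hJc : J.OrdConnected)
    (hne : J.Nonempty) {v : ℝ → ℝ} (hv : ContDiffOn ℝ ∞ v J) :
    ∃ χ₁ χ₂, IsFundamentalSystem J v χ₁ χ₂ := by
  obtain ⟨s, hs⟩ := hne
  obtain ⟨χ₁, s1, a1, b1, o1⟩ := exists_second_order_ode_solution hJ hJc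
    (contDiffOn_const.mul hv : ContDiffOn ℝ ∞ (fun t => 4 * v t) J) (f := fun _ => 0)
    contDiffOn_const hs 1 0
  obtain ⟨χ₂, s2, a2, b2, o2⟩ := exists_second_order_ode_solution hJ hJc
    (contDiffOn_const.mul hv : ContDiffOn ℝ ∞ (fun t => 4 * v t) J) (f := fun _ => 0)
    contDiffOn_const hs 0 1
  refine ⟨χ₁, χ₂, ⟨s1, by simpa using o1⟩, ⟨s2, by simpa using o2⟩, LinearIndependent.pair_iff.2 ?_⟩
  intro a b hab
  refine wronskian_linear_independent hJ s1 s2 hs (by simp [a1, a2, b1, b2]) fun t ht => ?_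
  simpa using congrFun hab ⟨t, ht⟩

/-- With `χ` fixed, `ρ` solves an inhomogeneous linear equation. Subtracting the combination of the
particular solutions `ρ₁`, `ρ₂` leaves a homogeneous solution, that is, the part belonging to `M`
and `I'`. -/
theorem IsSymData.sub_rho (hΩ : IsPotentialDomain Ω) {v w : ℝ → ℝ} (h : IsReduced Ω V v w)
    {χ χ₁ χ₂ : ℝ → ℝ} {ρ ρ₁ ρ₂ : ℝ → ℂ} (hs : IsSymData σ Ω V 0 χ ρ)
    (hs₁ : IsSymData σ Ω V 0 χ₁ ρ₁) (hs₂ : IsSymData σ Ω V 0 χ₂ ρ₂) {a b : ℝ}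
    (hab : ∀ t ∈ timeInterval Ω, χ t = a * χ₁ t + b * χ₂ t) :
    ∃ c d : ℝ, ∀ t ∈ timeInterval Ω, ρ t = c * rhoI' σ t + d * I + a * ρ₁ t + b * ρ₂ t := by
  have e := (h.symData_iff hΩ hs.smooth_chi hs.smooth_rho).1 hs
  have e₁ := (h.symData_iff hΩ hs₁.smooth_chi hs₁.smooth_rho).1 hs₁
  have e₂ := (h.symData_iff hΩ hs₂.smooth_chi hs₂.smooth_rho).1 hs₂
  obtain ⟨c, d, hcd⟩ := exists_rho_eq (σ := σ) hΩ.isOpen_timeInterval hΩ.ordConnected_timeInterval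
    (ρ := fun t => ρ t - (a * ρ₁ t + b * ρ₂ t)) (fun t ht => by
      refine ((e t ht).2.2.2.sub (((e₁ t ht).2.2.2.const_mul (a : ℂ)).fun_add
        ((e₂ t ht).2.2.2.const_mul (b : ℂ)))).congr_deriv ?_
      rw [hab t ht]
      simp
      ring)
  exact ⟨c, d, fun t ht => by linear_combination hcd t ht⟩

theorem symField_span (hΩ : IsPotentialDomain Ω) {τ : ℝ} {χ χ₁ χ₂ : ℝ → ℝ} {ρ ρ₁ ρ₂ : ℝ → ℂ}
    (hχ₁ : ContDiffOn ℝ ∞ χ₁ (timeInterval Ω)) (hχ₂ : ContDiffOn ℝ ∞ χ₂ (timeInterval Ω))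
    {a b c d : ℝ} (hab : ∀ t ∈ timeInterval Ω, χ t = a * χ₁ t + b * χ₂ t)
    (hcd : ∀ t ∈ timeInterval Ω, ρ t = c * rhoI' σ t + d * I + a * ρ₁ t + b * ρ₂ t)
    {z : TotalSpace} (hz : z ∈ phaseDomain Ω) :
    symField τ χ ρ z = d • fieldM z + c • fieldI' σ z + τ • fieldDt z
      + a • symField 0 χ₁ ρ₁ z + b • symField 0 χ₂ ρ₂ z := by
  have hJ := hΩ.isOpen_timeInterval
  have ht := fst_mem_timeInterval hz
  have e : χ =ᶠ[𝓝 z.1] fun t => a * χ₁ t + b * χ₂ t := by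
    filter_upwards [hJ.mem_nhds ht] with s hs using hab s hs
  rw [fieldM_eq, fieldI'_eq, fieldDt_eq]
  unfold symField
  rw [e.deriv_eq, (deriv_deriv_linear hJ hχ₁ hχ₂ a b ht).1, hab _ ht, hcd _ ht]
  simp
  ring

theorem symField_span_eq_zero (hΩ : IsPotentialDomain Ω) {τ : ℝ} {χ₁ χ₂ : ℝ → ℝ} {ρ₁ ρ₂ : ℝ → ℂ}
    (hχ₁ : ContDiffOn ℝ ∞ χ₁ (timeInterval Ω)) (hχ₂ : ContDiffOn ℝ ∞ χ₂ (timeInterval Ω))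
    {s : ℝ} (hs : s ∈ timeInterval Ω) (hW : χ₁ s * deriv χ₂ s - χ₂ s * deriv χ₁ s ≠ 0)
    {a b c d : ℝ} (h : ∀ z ∈ phaseDomain Ω, d • fieldM z + c • fieldI' σ z + τ • fieldDt z
      + a • symField 0 χ₁ ρ₁ z + b • symField 0 χ₂ ρ₂ z = 0) :
    d = 0 ∧ c = 0 ∧ τ = 0 ∧ a = 0 ∧ b = 0 := by
  simp only [fieldM_eq, fieldI'_eq, fieldDt_eq] at h
  have hab : a = 0 ∧ b = 0 := by
    refine wronskian_linear_independent hΩ.isOpen_timeInterval hχ₁ hχ₂ hs hW ?_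
    rintro _ ⟨p, hp, rfl⟩
    have := congrArg (fun y : ℝ × ℝ × ℂ => y.2.1) (h (p.1, p.2, 1) ⟨hp, one_ne_zero⟩)
    simpa [symField] using this
  obtain ⟨rfl, rfl⟩ := hab
  obtain ⟨p, hp⟩ := hΩ.exists_mem
  have := h (p.1, p.2, 1) ⟨hp, one_ne_zero⟩
  simp [symField] at this
  obtain ⟨h1, h0⟩ := rho_linear_independent (σ := σ) (t := p.1) (a := c) (b := d)
    (by linear_combination this.2)
  exact ⟨h0, h1, this.1, rfl, rfl⟩

/-- A nonzero derivative of `v` or `w` at a single time already gives `τ = 0`. Then `χ` fixes the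
coefficients of the two `G'` and `ρ` those of `M` and `I'`. -/
theorem IsReduced.hasNonstationaryBasis (hσ : σ ≠ 0) (hV : IsPotential Ω V) {v w χ₁ χ₂ : ℝ → ℝ}
    (h : IsReduced Ω V v w) (hvw : ∃ t ∈ timeInterval Ω, deriv v t ≠ 0 ∨ deriv w t ≠ 0)
    (hχ₁ : ContDiffOn ℝ ∞ χ₁ (timeInterval Ω))
    (h₁ : ∀ t ∈ timeInterval Ω, deriv (deriv χ₁) t = 4 * v t * χ₁ t)
    (hχ₂ : ContDiffOn ℝ ∞ χ₂ (timeInterval Ω))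
    (h₂ : ∀ t ∈ timeInterval Ω, deriv (deriv χ₂) t = 4 * v t * χ₂ t) {s : ℝ}
    (hs : s ∈ timeInterval Ω) (hW : χ₁ s * deriv χ₂ s - χ₂ s * deriv χ₁ s ≠ 0) :
    HasNonstationaryBasis σ Ω V w χ₁ χ₂ := by
  have hdom := hV.domain
  have hJ := hdom.isOpen_timeInterval
  have hJc := hdom.ordConnected_timeInterval
  obtain ⟨P₁, hP₁⟩ := exists_isG' (σ := σ) hJ hJc h.smooth_w hχ₁
  obtain ⟨P₂, hP₂⟩ := exists_isG' (σ := σ) hJ hJc h.smooth_w hχ₂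
  refine ⟨⟨P₁, P₂, hP₁, hP₂⟩, fun Q₁ Q₂ hQ₁ hQ₂ => ?_⟩
  obtain ⟨ρ₁, d₁, q₁⟩ := hQ₁.exists_symData hdom h hχ₁ h₁
  obtain ⟨ρ₂, d₂, q₂⟩ := hQ₂.exists_symData hdom h hχ₂ h₂
  refine hasBasis_of (A := lieSubmodule hσ hV) ?_ ?_ ?_
  · intro i
    fin_cases i
    · exact fieldM_mem hσ hV
    · exact fieldI'_mem hσ hV
    · exact d₁.mem hσ hV q₁
    · exact d₂.mem hσ hV q₂
  · intro f hf
    obtain ⟨τ, χ, ρ, hd, rfl⟩ := (mem_lieAlgebra_iff hσ hV).1 hf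
    have e := (h.symData_iff hdom hd.smooth_chi hd.smooth_rho).1 hd
    obtain rfl : τ = 0 := by
      obtain ⟨t, ht, h' | h'⟩ := hvw
      · exact (mul_eq_zero.1 (e t ht).1).resolve_right h'
      · exact (mul_eq_zero.1 (e t ht).2.1).resolve_right h'
    obtain ⟨a, b, hab⟩ := exists_solution_eq hJ hJc h.smooth_v hd.smooth_chi
      (fun t ht => (e t ht).2.2.1) hχ₁ h₁ hχ₂ h₂ hs hW
    obtain ⟨c, d, hcd⟩ := hd.sub_rho hdom h d₁ d₂ hab
    refine ⟨![d, c, a, b], fun z => ?_⟩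
    rw [domRestrict_apply, symField_span (σ := σ) hdom hχ₁ hχ₂ hab hcd z.2]
    simp [Fin.sum_univ_four, q₁ z z.2, q₂ z z.2]
  · intro c hc
    obtain ⟨k0, k1, -, k2, k3⟩ := symField_span_eq_zero (σ := σ) hdom (τ := 0) (ρ₁ := ρ₁) (ρ₂ := ρ₂)
      (a := c 2) (b := c 3) (c := c 1) (d := c 0) hχ₁ hχ₂ hs hW (fun z hz => by
        rw [← q₁ z hz, ← q₂ z hz]
        simpa [Fin.sum_univ_four] using hc z hz)
    intro i; fin_cases i <;> assumption

/-- Here `∂_t` is a symmetry, and subtracting `τ ∂_t` reduces the computation to symmetries with `τ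
= 0`. -/
theorem IsReduced.hasStationaryBasis (hσ : σ ≠ 0) (hV : IsPotential Ω V) {v w χ₁ χ₂ : ℝ → ℝ}
    (h : IsReduced Ω V v w) (hv : ∀ t ∈ timeInterval Ω, deriv v t = 0)
    (hw : ∀ t ∈ timeInterval Ω, deriv w t = 0) (hχ₁ : ContDiffOn ℝ ∞ χ₁ (timeInterval Ω))
    (h₁ : ∀ t ∈ timeInterval Ω, deriv (deriv χ₁) t = 4 * v t * χ₁ t)
    (hχ₂ : ContDiffOn ℝ ∞ χ₂ (timeInterval Ω))
    (h₂ : ∀ t ∈ timeInterval Ω, deriv (deriv χ₂) t = 4 * v t * χ₂ t) {s : ℝ}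
    (hs : s ∈ timeInterval Ω) (hW : χ₁ s * deriv χ₂ s - χ₂ s * deriv χ₁ s ≠ 0) :
    HasStationaryBasis σ Ω V w χ₁ χ₂ := by
  have hdom := hV.domain
  have hJ := hdom.isOpen_timeInterval
  have hJc := hdom.ordConnected_timeInterval
  obtain ⟨P₁, hP₁⟩ := exists_isG' (σ := σ) hJ hJc h.smooth_w hχ₁
  obtain ⟨P₂, hP₂⟩ := exists_isG' (σ := σ) hJ hJc h.smooth_w hχ₂
  refine ⟨⟨P₁, P₂, hP₁, hP₂⟩, fun Q₁ Q₂ hQ₁ hQ₂ => ?_⟩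
  obtain ⟨ρ₁, d₁, q₁⟩ := hQ₁.exists_symData hdom h hχ₁ h₁
  obtain ⟨ρ₂, d₂, q₂⟩ := hQ₂.exists_symData hdom h hχ₂ h₂
  have hDt : IsSymData σ Ω V 1 (fun _ => 0) (fun _ => 0) :=
    (h.symData_iff hdom contDiffOn_const contDiffOn_const).2 fun t ht =>
      ⟨by simp [hv t ht], by simp [hw t ht], by simp, by simpa using hasDerivAt_const t (0 : ℂ)⟩
  refine hasBasis_of (A := lieSubmodule hσ hV) ?_ ?_ ?_
  · intro i
    fin_cases i
    · exact fieldM_mem hσ hV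
    · exact fieldI'_mem hσ hV
    · exact hDt.mem hσ hV fun z _ => fieldDt_eq z
    · exact d₁.mem hσ hV q₁
    · exact d₂.mem hσ hV q₂
  · intro f hf
    obtain ⟨τ, χ, ρ, hd, rfl⟩ := (mem_lieAlgebra_iff hσ hV).1 hf
    have hd' : IsSymData σ Ω V 0 χ ρ := by simpa using hd.linear hdom hDt 1 (-τ)
    have e := (h.symData_iff hdom hd.smooth_chi hd.smooth_rho).1 hd
    obtain ⟨a, b, hab⟩ := exists_solution_eq hJ hJc h.smooth_v hd.smooth_chi
      (fun t ht => (e t ht).2.2.1) hχ₁ h₁ hχ₂ h₂ hs hW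
    obtain ⟨c, d, hcd⟩ := hd'.sub_rho hdom h d₁ d₂ hab
    refine ⟨![d, c, τ, a, b], fun z => ?_⟩
    rw [domRestrict_apply, symField_span (σ := σ) hdom hχ₁ hχ₂ hab hcd z.2]
    simp [Fin.sum_univ_five, q₁ z z.2, q₂ z z.2]
  · intro c hc
    obtain ⟨k0, k1, k2, k3, k4⟩ := symField_span_eq_zero (σ := σ) hdom (τ := c 2) (ρ₁ := ρ₁)
      (ρ₂ := ρ₂) (a := c 3) (b := c 4) (c := c 1) (d := c 0) hχ₁ hχ₂ hs hW (fun z hz => by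
        rw [← q₁ z hz, ← q₂ z hz]
        simpa [Fin.sum_univ_five] using hc z hz)
    intro i; fin_cases i <;> assumption

end LogNLS

/-! ### The kernel algebra and the bases in Cases 2-5. -/

namespace LogNLS

variable {σ : ℂ} {Ω : Set (ℝ × ℝ)} {V : ℝ × ℝ → ℂ}

/-- The potential `e^t x³` has only kernel symmetries: the terms `τ e^t x³` and `3 χ e^t x²` of the
classifying condition cannot be balanced by its right-hand side, which is affine in `x`. -/
theorem exists_generic_potential (hσ : σ ≠ 0) (hΩ : IsPotentialDomain Ω) :
    ∃ V, IsPotential Ω V ∧ HasBasis Ω (lieAlgebra σ Ω V) ![fieldM, fieldI' σ] := by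
  let V : ℝ × ℝ → ℂ := fun p => ((Real.exp p.1 * p.2 ^ 3 : ℝ) : ℂ)
  have hsm : ContDiff ℝ ∞ V := ofRealCLM.contDiff.comp
    ((Real.contDiff_exp.comp contDiff_fst).mul (contDiff_snd.pow 3))
  have hV : IsPotential Ω V := ⟨hΩ, hsm.contDiffOn⟩
  refine ⟨V, hV, hasBasis_MI' hσ hV ?_⟩
  intro τ χ ρ hs
  have hd : Differentiable ℝ V := hsm.differentiable (by simp)
  have hT : ∀ p, dT V p = ((Real.exp p.1 * p.2 ^ 3 : ℝ) : ℂ) := fun p =>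
    (hasDerivAt_dT (hd p)).unique ((Real.hasDerivAt_exp p.1).mul_const (p.2 ^ 3)).ofReal_comp
  have hX : ∀ p, dX V p = ((Real.exp p.1 * (3 * p.2 ^ 2) : ℝ) : ℂ) := fun p =>
    (hasDerivAt_dX (hd p)).unique
      ((((hasDerivAt_id p.2).fun_pow 3).const_mul (Real.exp p.1)).congr_deriv
        (by simp)).ofReal_comp
  have key : ∀ p ∈ Ω, τ = 0 ∧ χ p.1 = 0 := by
    intro p hp
    obtain ⟨h3, h2, -, -⟩ := cubic_eq_zero hΩ hp (A := τ * (Real.exp p.1 : ℝ))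
      (B := χ p.1 * (3 * (Real.exp p.1 : ℝ))) (C := -(deriv (deriv χ) p.1 : ℝ) / 2)
      (D := I * deriv ρ p.1 + σ * ((ρ p.1).re : ℝ)) (fun x hx => by
        have := hs.classifying _ hx
        rw [hT, hX] at this
        push_cast at this ⊢
        linear_combination this)
    have he := (Real.exp_pos p.1).ne'
    constructor
    · simpa using h3
    · simpa using h2
  obtain ⟨p, hp⟩ := hΩ.exists_mem
  refine ⟨(key p hp).1, ?_⟩
  rintro _ ⟨q, hq, rfl⟩
  exact (key q hq).2

/-- The intersection lies in the algebra of one generic potential, which is already the span of `M`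
and `I'`, and these two belong to every algebra. -/
theorem hasBasis_kernelAlgebra (hσ : σ ≠ 0) (hΩ : IsPotentialDomain Ω) :
    HasBasis Ω (kernelAlgebra σ Ω) ![fieldM, fieldI' σ] := by
  obtain ⟨V₀, hV₀, hli, hspan⟩ := exists_generic_potential hσ hΩ
  refine ⟨hli, ?_⟩
  rw [hspan]
  refine Subset.antisymm ?_ (iInter₂_subset V₀ hV₀)
  refine subset_iInter₂ fun V hV => ?_
  rw [← hspan]
  have : Submodule.span ℝ (range fun i => (phaseDomain Ω).domRestrict
      ((![fieldM, fieldI' σ] : Fin 2 → Field) i)) ≤ lieSubmodule hσ hV := by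
    refine Submodule.span_le.2 ?_
    rintro _ ⟨i, rfl⟩
    fin_cases i
    · exact fieldM_mem hσ hV
    · exact fieldI'_mem hσ hV
  exact this

theorem IsCase2.isReduced {v w : ℝ → ℝ} (h : IsCase2 Ω V v w) : IsReduced Ω V v w :=
  ⟨h.1, h.2.1, h.2.2.2⟩

theorem IsCase3.isReduced {ν : ℝ} (h : IsCase3 Ω V ν) :
    IsReduced Ω V (fun _ => 0) (fun _ => ν) :=
  ⟨contDiffOn_const, contDiffOn_const, fun p hp => by simp [h.2 p hp]⟩

theorem IsCase4.isReduced {μ ν : ℝ} (h : IsCase4 Ω V μ ν) :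
    IsReduced Ω V (fun _ => μ ^ 2) (fun _ => ν) :=
  ⟨contDiffOn_const, contDiffOn_const, fun p hp => by simp [h.2.2 p hp]⟩

theorem IsCase5.isReduced {μ ν : ℝ} (h : IsCase5 Ω V μ ν) :
    IsReduced Ω V (fun _ => -μ ^ 2) (fun _ => ν) :=
  ⟨contDiffOn_const, contDiffOn_const, fun p hp => by simp [h.2.2 p hp]⟩

theorem IsCase2.basis (hσ : σ ≠ 0) (hV : IsPotential Ω V) {v w : ℝ → ℝ} (h : IsCase2 Ω V v w) :
    (∃ χ₁ χ₂, IsFundamentalSystem (timeInterval Ω) v χ₁ χ₂) ∧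
      ∀ χ₁ χ₂, IsFundamentalSystem (timeInterval Ω) v χ₁ χ₂ →
        HasNonstationaryBasis σ Ω V w χ₁ χ₂ := by
  have hJ := hV.domain.isOpen_timeInterval
  have hJc := hV.domain.ordConnected_timeInterval
  obtain ⟨p, hp⟩ := hV.domain.exists_mem
  refine ⟨exists_isFundamentalSystem hJ hJc ⟨_, mem_timeInterval hp⟩ h.1, fun χ₁ χ₂ hf => ?_⟩
  exact h.isReduced.hasNonstationaryBasis hσ hV h.2.2.1 hf.1.1 hf.1.2 hf.2.1.1 hf.2.1.2
    (mem_timeInterval hp) (hf.wronskian_ne_zero hJ hJc h.1 (mem_timeInterval hp))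

theorem IsReduced.hasStationaryBasis_const (hσ : σ ≠ 0) (hV : IsPotential Ω V) {a ν : ℝ}
    {χ₁ χ₂ : ℝ → ℝ} (h : IsReduced Ω V (fun _ => a) (fun _ => ν)) {χ₁' χ₂' : ℝ → ℝ}
    (h₁ : ∀ t, HasDerivAt χ₁ (χ₁' t) t) (h₁' : ∀ t, HasDerivAt χ₁' (4 * a * χ₁ t) t)
    (h₂ : ∀ t, HasDerivAt χ₂ (χ₂' t) t) (h₂' : ∀ t, HasDerivAt χ₂' (4 * a * χ₂ t) t)
    (hχ₁ : ContDiff ℝ ∞ χ₁) (hχ₂ : ContDiff ℝ ∞ χ₂)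
    (hW : ∀ t, χ₁ t * χ₂' t - χ₂ t * χ₁' t ≠ 0) :
    HasStationaryBasis σ Ω V (fun _ => ν) χ₁ χ₂ := by
  obtain ⟨p, hp⟩ := hV.domain.exists_mem
  have e₁ : deriv χ₁ = χ₁' := funext fun t => (h₁ t).deriv
  have e₂ : deriv χ₂ = χ₂' := funext fun t => (h₂ t).deriv
  refine h.hasStationaryBasis hσ hV (by simp) (by simp) hχ₁.contDiffOn (fun t _ => ?_)
    hχ₂.contDiffOn (fun t _ => ?_) (mem_timeInterval hp) ?_
  · rw [e₁, (h₁' t).deriv]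
  · rw [e₂, (h₂' t).deriv]
  · rw [e₁, e₂]; exact hW _

theorem IsCase3.basis (hσ : σ ≠ 0) (hV : IsPotential Ω V) {ν : ℝ} (h : IsCase3 Ω V ν) :
    HasStationaryBasis σ Ω V (fun _ => ν) (fun _ => 1) (fun t => t) :=
  h.isReduced.hasStationaryBasis_const hσ hV (χ₁' := fun _ => 0) (χ₂' := fun _ => 1)
    (fun t => hasDerivAt_const t 1) (fun t => by simpa using hasDerivAt_const t (0 : ℝ))
    (fun t => hasDerivAt_id t) (fun t => by simpa using hasDerivAt_const t (1 : ℝ))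
    contDiff_const contDiff_id (fun t => by simp)

theorem IsCase4.basis (hσ : σ ≠ 0) (hV : IsPotential Ω V) {μ ν : ℝ} (h : IsCase4 Ω V μ ν) :
    HasStationaryBasis σ Ω V (fun _ => ν)
        (fun t => Real.exp (-2 * μ * t)) (fun t => Real.exp (2 * μ * t)) := by
  have key : ∀ a c t : ℝ, HasDerivAt (fun t => c * Real.exp (a * t)) (a * c * Real.exp (a * t)) t :=
    fun a c t => ((((hasDerivAt_id t).const_mul a).exp).const_mul c).congr_deriv (by simp; ring)
  have hμ := h.1
  refine h.isReduced.hasStationaryBasis_const hσ hV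
    (χ₁' := fun t => (-2 * μ) * Real.exp (-2 * μ * t)) (χ₂' := fun t => (2 * μ) * Real.exp (2 * μ * t))
    (fun t => by simpa using key (-2 * μ) 1 t)
    (fun t => (key (-2 * μ) (-2 * μ) t).congr_deriv (by ring))
    (fun t => by simpa using key (2 * μ) 1 t)
    (fun t => (key (2 * μ) (2 * μ) t).congr_deriv (by ring))
    (Real.contDiff_exp.comp (contDiff_const.mul contDiff_id))
    (Real.contDiff_exp.comp (contDiff_const.mul contDiff_id)) (fun t => ?_)
  have h1 := Real.exp_pos (-2 * μ * t)
  have h2 := Real.exp_pos (2 * μ * t)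
  have : 0 < 4 * μ * (Real.exp (-2 * μ * t) * Real.exp (2 * μ * t)) := by positivity
  nlinarith

theorem IsCase5.basis (hσ : σ ≠ 0) (hV : IsPotential Ω V) {μ ν : ℝ} (h : IsCase5 Ω V μ ν) :
    HasStationaryBasis σ Ω V (fun _ => ν)
        (fun t => Real.cos (2 * μ * t)) (fun t => Real.sin (2 * μ * t)) := by
  have kc : ∀ c t : ℝ, HasDerivAt (fun t => c * Real.cos (2 * μ * t))
      (-(2 * μ) * c * Real.sin (2 * μ * t)) t :=
    fun c t => ((((hasDerivAt_id t).const_mul (2 * μ)).cos).const_mul c).congr_deriv (by simp; ring)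
  have ks : ∀ c t : ℝ, HasDerivAt (fun t => c * Real.sin (2 * μ * t))
      ((2 * μ) * c * Real.cos (2 * μ * t)) t :=
    fun c t => ((((hasDerivAt_id t).const_mul (2 * μ)).sin).const_mul c).congr_deriv (by simp; ring)
  have hμ := h.1
  refine h.isReduced.hasStationaryBasis_const hσ hV
    (χ₁' := fun t => -(2 * μ) * Real.sin (2 * μ * t)) (χ₂' := fun t => (2 * μ) * Real.cos (2 * μ * t))
    (fun t => by simpa using kc 1 t)
    (fun t => (ks (-(2 * μ)) t).congr_deriv (by ring))
    (fun t => by simpa using ks 1 t)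
    (fun t => (kc (2 * μ) t).congr_deriv (by ring))
    (Real.contDiff_cos.comp (contDiff_const.mul contDiff_id))
    (Real.contDiff_sin.comp (contDiff_const.mul contDiff_id)) (fun t => ?_)
  have h1 := Real.sin_sq_add_cos_sq (2 * μ * t)
  have : Real.cos (2 * μ * t) * (2 * μ * Real.cos (2 * μ * t))
      - Real.sin (2 * μ * t) * (-(2 * μ) * Real.sin (2 * μ * t)) = 2 * μ := by
    linear_combination 2 * μ * h1
  rw [this]
  positivity

end LogNLS

/-! ### Symmetries along `∂_x` and quadratic potentials. -/

namespace LogNLS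

variable {σ : ℂ} {Ω : Set (ℝ × ℝ)} {V : ℝ × ℝ → ℂ}

/-- `V` is a quadratic polynomial in `x` with a real leading coefficient. -/
def IsQuadratic (Ω : Set (ℝ × ℝ)) (V : ℝ × ℝ → ℂ) : Prop :=
  ∃ (a : ℝ → ℝ) (b c : ℝ → ℂ), ContDiffOn ℝ ∞ a (timeInterval Ω) ∧
    ContDiffOn ℝ ∞ b (timeInterval Ω) ∧ ContDiffOn ℝ ∞ c (timeInterval Ω) ∧
    ∀ p ∈ Ω, V p = a p.1 * (p.2 : ℂ) ^ 2 + b p.1 * (p.2 : ℂ) + c p.1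

theorem eventually_section (hΩ : IsOpen Ω) {p : ℝ × ℝ} (hp : p ∈ Ω) :
    ∀ᶠ x in 𝓝 p.2, (p.1, x) ∈ Ω :=
  (Continuous.prodMk_right p.1).continuousAt.eventually (hΩ.mem_nhds hp)

theorem dX_eq_of_section {F : Type*} [NormedAddCommGroup F] [NormedSpace ℝ F] {f : ℝ × ℝ → F}
    {p : ℝ × ℝ} (hf : DifferentiableAt ℝ f p) {g : ℝ → F} {g' : F} (hg : HasDerivAt g g' p.2)
    (h : ∀ᶠ x in 𝓝 p.2, f (p.1, x) = g x) : dX f p = g' :=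
  (hasDerivAt_dX hf).unique (hg.congr_of_eventuallyEq h)

theorem hasDerivAt_ofReal (x : ℝ) : HasDerivAt (fun x : ℝ => (x : ℂ)) 1 x :=
  (hasDerivAt_id x).ofReal_comp

/-- The function `V_xx` depends on `t` only and is real. Subtracting its contribution and
integrating twice in `x` produces the lower coefficients as smooth functions of `t`. -/
theorem isQuadratic_of_dX (hV : IsPotential Ω V) (h3 : ∀ p ∈ Ω, dX (dX (dX V)) p = 0)
    (him : ∀ p ∈ Ω, (dX (dX V) p).im = 0) : IsQuadratic Ω V := by
  have hdom := hV.domain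
  have hΩ := hdom.isOpen
  have hJ := hdom.isOpen_timeInterval
  have s1 := contDiffOn_dX hΩ hV.smooth
  have s2 := contDiffOn_dX hΩ s1
  obtain ⟨A, hA, eA⟩ := hdom.exists_eq_comp_fst s2 h3
  have hAim : ∀ p ∈ Ω, A p.1 = ((A p.1).re : ℂ) := fun p hp => by
    apply Complex.ext
    · simp
    · have := him p hp
      rw [eA p hp] at this
      simpa using this
  let a : ℝ → ℝ := fun t => (A t).re / 2
  have ha : ContDiffOn ℝ ∞ a (timeInterval Ω) :=
    (reCLM.contDiff.comp_contDiffOn hA).div_const 2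
  have hx : ContDiffOn ℝ ∞ (fun p : ℝ × ℝ => (p.2 : ℂ)) Ω :=
    ofRealCLM.contDiff.comp_contDiffOn contDiff_snd.contDiffOn
  have haC : ContDiffOn ℝ ∞ (fun p : ℝ × ℝ => (a p.1 : ℂ)) Ω :=
    ofRealCLM.contDiff.comp_contDiffOn (contDiffOn_comp_fst ha)
  have sb : ContDiffOn ℝ ∞ (fun p => dX V p - 2 * (a p.1 : ℂ) * (p.2 : ℂ)) Ω :=
    s1.sub ((contDiffOn_const.mul haC).mul hx)
  obtain ⟨b, hb, eb⟩ := hdom.exists_eq_comp_fst sb (fun p hp => by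
    refine dX_eq_of_section (differentiableAt_of_contDiffOn hΩ sb hp)
      (((hasDerivAt_dX (differentiableAt_of_contDiffOn hΩ s1 hp)).fun_sub
        ((hasDerivAt_ofReal p.2).const_mul (2 * (a p.1 : ℂ)))).congr_deriv ?_)
      (Eventually.of_forall fun x => rfl)
    rw [eA p hp, hAim p hp]
    simp [a]
    ring)
  have hbC := contDiffOn_comp_fst hb
  have sc : ContDiffOn ℝ ∞ (fun p => V p - ((a p.1 : ℂ) * (p.2 : ℂ) ^ 2 + b p.1 * (p.2 : ℂ))) Ω :=
    hV.smooth.sub ((haC.mul (hx.pow 2)).add (hbC.mul hx))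
  obtain ⟨c, hc, ec⟩ := hdom.exists_eq_comp_fst sc (fun p hp => by
    refine dX_eq_of_section (differentiableAt_of_contDiffOn hΩ sc hp)
      (((hasDerivAt_dX (hV.differentiableAt hp)).fun_sub
        ((((hasDerivAt_ofReal p.2).fun_pow 2).const_mul (a p.1 : ℂ)).fun_add
          ((hasDerivAt_ofReal p.2).const_mul (b p.1)))).congr_deriv ?_)
      (Eventually.of_forall fun x => rfl)
    rw [← eb p hp]
    simp
    ring)
  exact ⟨a, b, c, ha, hb, hc, fun p hp => by rw [← ec p hp]; ring⟩

theorem eq_zero_of_punctured {F : Type*} [NormedAddCommGroup F] {g : ℝ → F} {t : ℝ}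
    (hg : ContinuousAt g t) (h : ∀ᶠ s in 𝓝[≠] t, g s = 0) : g t = 0 :=
  tendsto_nhds_unique (hg.tendsto.mono_left nhdsWithin_le_nhds)
    (tendsto_const_nhds.congr' (h.mono fun _ hs => hs.symm))

theorem continuousAt_section {F : Type*} [NormedAddCommGroup F] [NormedSpace ℝ F]
    (hΩ : IsOpen Ω) {f : ℝ × ℝ → F} (hf : ContDiffOn ℝ ∞ f Ω) {p : ℝ × ℝ} (hp : p ∈ Ω) :
    ContinuousAt (fun t => f (t, p.2)) p.1 :=
  ContinuousAt.comp (f := fun t : ℝ => (t, p.2)) (g := f)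
    (hf.continuousOn.continuousAt (hΩ.mem_nhds hp))
    (Continuous.prodMk_left p.2).continuousAt

/-- A symmetry without `∂_t` but with `∂_x` forces the potential to be quadratic. -/
theorem IsSymData.isQuadratic (hV : IsPotential Ω V) {χ : ℝ → ℝ} {ρ : ℝ → ℂ}
    (hs : IsSymData σ Ω V 0 χ ρ) (hne : ∃ t ∈ timeInterval Ω, χ t ≠ 0) : IsQuadratic Ω V := by
  have hdom := hV.domain
  have hΩ := hdom.isOpen
  have hJ := hdom.isOpen_timeInterval
  have s1 := contDiffOn_dX hΩ hV.smooth
  have s2 := contDiffOn_dX hΩ s1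
  have s3 := contDiffOn_dX hΩ s2
  have e2 : ∀ p ∈ Ω, (χ p.1 : ℂ) * dX (dX V) p = (deriv (deriv χ) p.1 : ℝ) / 2 := by
    intro p hp
    have h1 := (hasDerivAt_dX (differentiableAt_of_contDiffOn hΩ s1 hp)).const_mul (χ p.1 : ℂ)
    have h2 := ((hasDerivAt_ofReal p.2).const_mul (((deriv (deriv χ) p.1 : ℝ) : ℂ) / 2)).add_const
      (- I * deriv ρ p.1 - σ * ((ρ p.1).re : ℝ))
    rw [mul_one] at h2
    refine h1.unique (h2.congr_of_eventuallyEq ?_)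
    filter_upwards [eventually_section hΩ hp] with x hx
    have := hs.classifying _ hx
    simp only [ofReal_zero, zero_mul, zero_add] at this
    rw [this]; ring
  have e3 : ∀ p ∈ Ω, (χ p.1 : ℂ) * dX (dX (dX V)) p = 0 := by
    intro p hp
    have h1 := (hasDerivAt_dX (differentiableAt_of_contDiffOn hΩ s2 hp)).const_mul (χ p.1 : ℂ)
    refine h1.unique ((hasDerivAt_const p.2 (((deriv (deriv χ) p.1 : ℝ) : ℂ) / 2)).congr_of_eventuallyEq ?_)
    filter_upwards [eventually_section hΩ hp] with x hx using e2 _ hx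
  -- Zeros of `χ` are simple, since a double zero would make `χ` vanish identically by uniqueness
  -- for `χ_tt = 2 Re(V_xx) χ`.
  have hdata : ∀ t ∈ timeInterval Ω, χ t = 0 → deriv χ t ≠ 0 := by
    intro t ht h0 h1
    obtain ⟨s, hs', hsne⟩ := hne
    refine hsne (eq_zero_of_second_order_ode hJ hdom.ordConnected_timeInterval hs.smooth_chi
      ?_ ht h0 h1 s hs')
    rintro _ ⟨p, hp, rfl⟩
    -- The coefficient is `V_xx` along the line `x = p.2`, which lies in `Ω` only for times near
    -- `p.1`. The uniqueness lemma asks for the coefficient only locally for this reason.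
    refine ⟨fun t => 2 * (dX (dX V) (t, p.2)).re,
      (continuous_re.continuousAt.comp (continuousAt_section hΩ s2 hp)).const_mul 2, ?_⟩
    have : ∀ᶠ t in 𝓝 p.1, (t, p.2) ∈ Ω :=
      (Continuous.prodMk_left p.2).continuousAt.eventually (hΩ.mem_nhds hp)
    filter_upwards [this] with t ht
    have := congrArg Complex.re (e2 _ ht)
    rw [re_ofReal_mul, ← ofReal_ofNat, ← ofReal_div, ofReal_re] at this
    linarith
  -- Zeros of `χ` being isolated, identities that hold where `χ ≠ 0` extend by continuity in `t`.
  have hdense : ∀ f : ℝ × ℝ → ℂ, ContDiffOn ℝ ∞ f Ω → (∀ p ∈ Ω, χ p.1 ≠ 0 → f p = 0) →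
      ∀ p ∈ Ω, f p = 0 := by
    intro f hf h p hp
    by_cases h0 : χ p.1 = 0
    · refine eq_zero_of_punctured (continuousAt_section hΩ hf hp) ?_
      have h1 := (hasDerivAt_deriv_of_contDiffOn hJ hs.smooth_chi
        (mem_timeInterval hp)).eventually_ne (c := 0) (hdata _ (mem_timeInterval hp) h0)
      have h2 : ∀ᶠ t in 𝓝 p.1, (t, p.2) ∈ Ω :=
        (Continuous.prodMk_left p.2).continuousAt.eventually (hΩ.mem_nhds hp)
      filter_upwards [h1, h2.filter_mono nhdsWithin_le_nhds] with t ht1 ht2 using h _ ht2 ht1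
    · exact h p hp h0
  refine isQuadratic_of_dX hV (hdense _ s3 fun p hp h0 => ?_) fun p hp => ?_
  · exact (mul_eq_zero.1 (e3 p hp)).resolve_left (by exact_mod_cast h0)
  · have := hdense (fun p => ((dX (dX V) p).im : ℂ))
      (ofRealCLM.contDiff.comp_contDiffOn (imCLM.contDiff.comp_contDiffOn s2)) (fun p hp h0 => by
        have := congrArg Complex.im (e2 _ hp)
        rw [im_ofReal_mul, ← ofReal_ofNat, ← ofReal_div, ofReal_im] at this
        have := (mul_eq_zero.1 this).resolve_left h0
        simpa using this) p hp
    exact_mod_cast this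

end LogNLS

/-! ### Explicit equivalence transformations. -/

namespace LogNLS

/-- Parameters of an equivalence transformation preserving `t`. -/
structure GaugeData (Ω : Set (ℝ × ℝ)) where
  ε : ℝ
  X : ℝ → ℝ
  r : ℝ → ℂ
  sq : ε * ε = 1
  smooth_X : ContDiffOn ℝ ∞ X (timeInterval Ω)
  smooth_r : ContDiffOn ℝ ∞ r (timeInterval Ω)

namespace GaugeData

variable {σ : ℂ} {Ω : Set (ℝ × ℝ)} (G : GaugeData Ω)

/-- The transformation of `(t, x)`. -/
def fwd (p : ℝ × ℝ) : ℝ × ℝ := (p.1, G.ε * p.2 + G.X p.1)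

/-- The inverse transformation of `(t, x)`. -/
def bwd (q : ℝ × ℝ) : ℝ × ℝ := (q.1, G.ε * (q.2 - G.X q.1))

theorem bwd_fwd (p : ℝ × ℝ) : G.bwd (G.fwd p) = p := by
  ext
  · rfl
  · simp only [bwd, fwd]; linear_combination p.2 * G.sq

theorem fwd_bwd (q : ℝ × ℝ) : G.fwd (G.bwd q) = q := by
  ext
  · rfl
  · simp only [bwd, fwd]; linear_combination (q.2 - G.X q.1) * G.sq

/-- The logarithm of the multiplier of `ψ`. -/
noncomputable def phase (p : ℝ × ℝ) : ℂ :=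
  I / 2 * ((G.ε * deriv G.X p.1 : ℝ) : ℂ) * (p.2 : ℂ) + G.r p.1

/-- The transformation of `(t, x, ψ)`. -/
noncomputable def map (z : TotalSpace) : TotalSpace :=
  ((G.fwd (base z)).1, (G.fwd (base z)).2, z.2.2 * exp (G.phase (base z)))

/-- The inverse transformation of `(t, x, ψ)`. -/
noncomputable def mapInv (z : TotalSpace) : TotalSpace :=
  ((G.bwd (base z)).1, (G.bwd (base z)).2, z.2.2 * exp (-G.phase (G.bwd (base z))))

/-- The change of the potential. -/
noncomputable def shift (σ : ℂ) (p : ℝ × ℝ) : ℂ :=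
  ((G.ε * deriv (deriv G.X) p.1 / 2 * p.2 - (deriv G.X p.1) ^ 2 / 4 : ℝ) : ℂ)
    - I * deriv G.r p.1 - σ * ((G.r p.1).re : ℝ)

/-- The transformed domain. -/
def image : Set (ℝ × ℝ) := G.fwd '' Ω

/-- The transformed potential. -/
noncomputable def potential (σ : ℂ) (V : ℝ × ℝ → ℂ) (q : ℝ × ℝ) : ℂ :=
  V (G.bwd q) + G.shift σ (G.bwd q)

theorem mem_image {q : ℝ × ℝ} : q ∈ G.image ↔ G.bwd q ∈ Ω := by
  constructor
  · rintro ⟨p, hp, rfl⟩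
    rwa [bwd_fwd]
  · intro h
    exact ⟨_, h, G.fwd_bwd q⟩

theorem timeInterval_image : timeInterval G.image = timeInterval Ω := by
  ext t
  constructor
  · rintro ⟨_, ⟨p, hp, rfl⟩, rfl⟩
    exact ⟨p, hp, rfl⟩
  · rintro ⟨p, hp, rfl⟩
    exact ⟨_, ⟨p, hp, rfl⟩, rfl⟩

theorem contDiffOn_fwd : ContDiffOn ℝ ∞ G.fwd Ω :=
  contDiff_fst.contDiffOn.prodMk
    ((contDiffOn_const.mul contDiff_snd.contDiffOn).add (contDiffOn_comp_fst G.smooth_X))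

theorem contDiffOn_bwd_strip : ContDiffOn ℝ ∞ G.bwd (timeInterval Ω ×ˢ univ) := by
  have : ContDiffOn ℝ ∞ (fun p : ℝ × ℝ => G.X p.1) (timeInterval Ω ×ˢ univ) :=
    G.smooth_X.comp contDiff_fst.contDiffOn fun p hp => hp.1
  exact contDiff_fst.contDiffOn.prodMk
    (contDiffOn_const.mul (contDiff_snd.contDiffOn.sub this))

theorem image_subset_strip : G.image ⊆ timeInterval Ω ×ˢ univ := by
  rintro _ ⟨p, hp, rfl⟩
  exact ⟨(⟨p, hp, rfl⟩ : p.1 ∈ timeInterval Ω), mem_univ _⟩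

theorem contDiffOn_bwd : ContDiffOn ℝ ∞ G.bwd G.image :=
  G.contDiffOn_bwd_strip.mono G.image_subset_strip

theorem isPotentialDomain_image (hΩ : IsPotentialDomain Ω) : IsPotentialDomain G.image := by
  refine ⟨?_, hΩ.isConnected.image _ G.contDiffOn_fwd.continuousOn, fun t => ?_⟩
  -- The inverse map is continuous on the whole open strip over the time interval, so the image is
  -- open as a preimage of `Ω` in that strip.
  · have : G.image = (timeInterval Ω ×ˢ univ) ∩ G.bwd ⁻¹' Ω := by
      ext q
      exact ⟨fun h => ⟨G.image_subset_strip h, G.mem_image.1 h⟩, fun h => G.mem_image.2 h.2⟩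
    rw [this]
    exact G.contDiffOn_bwd_strip.continuousOn.isOpen_inter_preimage
      (hΩ.isOpen_timeInterval.prod isOpen_univ) hΩ.isOpen
  · have : {x : ℝ | (t, x) ∈ G.image} = (fun x => G.ε * x + G.X t) '' {x : ℝ | (t, x) ∈ Ω} := by
      ext y
      constructor
      · rintro ⟨⟨s, x⟩, hp, hq⟩
        obtain ⟨rfl, rfl⟩ := Prod.mk.inj hq
        exact ⟨x, hp, rfl⟩
      · rintro ⟨x, hx, rfl⟩
        exact ⟨(t, x), hx, rfl⟩
    rw [this]
    exact ((hΩ.ordConnected_section t).isPreconnected.image _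
      (Continuous.continuousOn (by fun_prop))).ordConnected

theorem contDiffOn_phase (hΩ : IsPotentialDomain Ω) : ContDiffOn ℝ ∞ G.phase Ω := by
  have h1 := contDiffOn_comp_fst (contDiffOn_deriv hΩ.isOpen_timeInterval G.smooth_X)
  exact ((contDiffOn_const.mul (ofRealCLM.contDiff.comp_contDiffOn (contDiffOn_const.mul h1))).mul
    (ofRealCLM.contDiff.comp_contDiffOn contDiff_snd.contDiffOn)).add
    (contDiffOn_comp_fst G.smooth_r)

theorem contDiffOn_shift (hΩ : IsPotentialDomain Ω) : ContDiffOn ℝ ∞ (G.shift σ) Ω := by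
  have hJ := hΩ.isOpen_timeInterval
  have h1 := contDiffOn_deriv hJ G.smooth_X
  have h2 := contDiffOn_comp_fst (contDiffOn_deriv hJ h1)
  have h3 := contDiffOn_comp_fst (contDiffOn_deriv hJ G.smooth_r)
  have h4 : ContDiffOn ℝ ∞ (fun p : ℝ × ℝ => (G.r p.1).re) Ω :=
    reCLM.contDiff.comp_contDiffOn (contDiffOn_comp_fst G.smooth_r)
  exact ((ofRealCLM.contDiff.comp_contDiffOn
    (((contDiffOn_const.mul h2).div_const 2).mul contDiff_snd.contDiffOn |>.sub
      (((contDiffOn_comp_fst h1).pow 2).div_const 4))).sub (contDiffOn_const.mul h3)).sub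
    (contDiffOn_const.mul (ofRealCLM.contDiff.comp_contDiffOn h4))

theorem isPotential_potential {V : ℝ × ℝ → ℂ} (hV : IsPotential Ω V) :
    IsPotential G.image (G.potential σ V) := by
  have hm : MapsTo G.bwd G.image Ω := fun q hq => G.mem_image.1 hq
  exact ⟨G.isPotentialDomain_image hV.domain, (hV.smooth.comp G.contDiffOn_bwd hm).add
    ((G.contDiffOn_shift hV.domain).comp G.contDiffOn_bwd hm)⟩

theorem base_map (z : TotalSpace) : base (G.map z) = G.fwd (base z) := rfl

theorem base_mapInv (z : TotalSpace) : base (G.mapInv z) = G.bwd (base z) := rfl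

theorem mapInv_map (z : TotalSpace) : G.mapInv (G.map z) = z := by
  have h : G.bwd (base (G.map z)) = base z := by rw [base_map, bwd_fwd]
  unfold mapInv
  rw [h]
  ext <;> simp [base, map, mul_assoc, ← Complex.exp_add]

theorem map_mapInv (z : TotalSpace) : G.map (G.mapInv z) = z := by
  have h : G.fwd (base (G.mapInv z)) = base z := by rw [base_mapInv, fwd_bwd]
  have h' : base (G.mapInv z) = G.bwd (base z) := rfl
  unfold map
  rw [h, h']
  ext <;> simp [base, mapInv, mul_assoc, ← Complex.exp_add]

theorem mapsTo_map : MapsTo G.map (phaseDomain Ω) (phaseDomain G.image) := fun _ hz =>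
  ⟨⟨_, hz.1, rfl⟩, mul_ne_zero hz.2 (exp_ne_zero _)⟩

theorem mapsTo_mapInv : MapsTo G.mapInv (phaseDomain G.image) (phaseDomain Ω) := fun _ hz =>
  ⟨G.mem_image.1 hz.1, mul_ne_zero hz.2 (exp_ne_zero _)⟩

theorem contDiffOn_map (hΩ : IsPotentialDomain Ω) : ContDiffOn ℝ ∞ G.map (phaseDomain Ω) := by
  have h1 := contDiffOn_comp_base G.contDiffOn_fwd
  have h2 := contDiffOn_comp_base (G.contDiffOn_phase hΩ)
  have h3 : ContDiffOn ℝ ∞ (fun z : TotalSpace => z.2.2) (phaseDomain Ω) :=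
    ContDiff.contDiffOn (by fun_prop)
  exact h1.fst.prodMk (h1.snd.prodMk (h3.mul h2.cexp))

theorem contDiffOn_mapInv (hΩ : IsPotentialDomain Ω) :
    ContDiffOn ℝ ∞ G.mapInv (phaseDomain G.image) := by
  have h1 := contDiffOn_comp_base G.contDiffOn_bwd
  have h2 := contDiffOn_comp_base ((G.contDiffOn_phase hΩ).comp G.contDiffOn_bwd
    fun q hq => G.mem_image.1 hq)
  have h3 : ContDiffOn ℝ ∞ (fun z : TotalSpace => z.2.2) (phaseDomain G.image) :=
    ContDiff.contDiffOn (by fun_prop)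
  exact h1.fst.prodMk (h1.snd.prodMk (h3.mul h2.neg.cexp))

theorem isDiffeoOn_map (hΩ : IsPotentialDomain Ω) :
    IsDiffeoOn G.map (phaseDomain Ω) (phaseDomain G.image) :=
  ⟨G.contDiffOn_map hΩ, G.mapsTo_map, G.mapInv, G.contDiffOn_mapInv hΩ, G.mapsTo_mapInv,
    fun z _ => G.mapInv_map z, fun z _ => G.map_mapInv z⟩

/-- The transformation of the values of the potential. -/
noncomputable def theta (σ : ℂ) (q : TotalSpace × ℂ) : ℂ := q.2 + G.shift σ (base q.1)

theorem isDiffeoOn_theta (hΩ : IsPotentialDomain Ω) :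
    IsDiffeoOn (fun q : TotalSpace × ℂ => (G.map q.1, G.theta σ q))
      (phaseDomain Ω ×ˢ univ) (phaseDomain G.image ×ˢ univ) := by
  have hf : ∀ {S : Set TotalSpace}, MapsTo (fun q : TotalSpace × ℂ => q.1) (S ×ˢ univ) S := by
    intro S q hq
    exact hq.1
  refine ⟨((G.contDiffOn_map hΩ).comp contDiff_fst.contDiffOn hf).prodMk
      (contDiff_snd.contDiffOn.add ((contDiffOn_comp_base (G.contDiffOn_shift hΩ)).comp
        contDiff_fst.contDiffOn hf)), fun q hq => ⟨G.mapsTo_map hq.1, mem_univ _⟩,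
    fun q => (G.mapInv q.1, q.2 - G.shift σ (base (G.mapInv q.1))),
    ((G.contDiffOn_mapInv hΩ).comp contDiff_fst.contDiffOn hf).prodMk
      (contDiff_snd.contDiffOn.sub (((contDiffOn_comp_base (G.contDiffOn_shift hΩ)).comp
        (G.contDiffOn_mapInv hΩ) G.mapsTo_mapInv).comp
        contDiff_fst.contDiffOn hf)), fun q hq => ⟨G.mapsTo_mapInv hq.1, mem_univ _⟩,
    fun q _ => ?_, fun q _ => ?_⟩
  · simp [theta, mapInv_map]
  · simp [theta, map_mapInv]

theorem hasDerivAt_exp_phase (hΩ : IsPotentialDomain Ω) {p : ℝ × ℝ} (hp : p ∈ Ω) :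
    HasDerivAt (fun x => exp (G.phase (p.1, x)))
      (exp (G.phase p) * (I / 2 * ((G.ε * deriv G.X p.1 : ℝ) : ℂ))) p.2 ∧
    HasDerivAt (fun t => exp (G.phase (t, p.2)))
      (exp (G.phase p) * (I / 2 * ((G.ε * deriv (deriv G.X) p.1 : ℝ) : ℂ) * (p.2 : ℂ)
        + deriv G.r p.1)) p.1 := by
  have hJ := hΩ.isOpen_timeInterval
  have hX := hasDerivAt_deriv_of_contDiffOn hJ (contDiffOn_deriv hJ G.smooth_X) (mem_timeInterval hp)
  have hr := hasDerivAt_deriv_of_contDiffOn hJ G.smooth_r (mem_timeInterval hp)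
  obtain ⟨h1, h2, h3⟩ := hasFDerivAt_phase (a := fun t => G.ε * deriv G.X t)
    (hX.const_mul G.ε).differentiableAt hr.differentiableAt
  rw [(hX.const_mul G.ε).deriv] at h2
  constructor
  · rw [← h3]; exact (hasDerivAt_dX h1).cexp
  · rw [← h2]; exact (hasDerivAt_dT h1).cexp

/-- The phase `(i/2) ε X_t x` is chosen so that the `ψ_x` terms created by the moving coordinate
cancel. The zeroth-order terms are collected in `shift`, including `σ Re r` from the logarithm. The
transformed left-hand side is then the original one times the nonvanishing factor `exp (phase)`. -/
theorem transformsEquation {V : ℝ × ℝ → ℂ} (hV : IsPotential Ω V) :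
    TransformsEquation σ Ω V (G.potential σ V) G.map := by
  have hΩ := hV.domain
  have hJ := hΩ.isOpen_timeInterval
  intro p hp u u' hu0 hu hu' huu'
  change ContDiffAt ℝ 2 u' (G.fwd p) at hu'
  change ∀ᶠ q in 𝓝 p, u' (G.fwd q) = u q * exp (G.phase q) at huu'
  change _ ↔ nlsOp σ (G.potential σ V) u' (G.fwd p) = 0
  have hfwd : ContinuousAt G.fwd p :=
    G.contDiffOn_fwd.continuousOn.continuousAt (hΩ.isOpen.mem_nhds hp)
  have d1 : ∀ᶠ q in 𝓝 p, DifferentiableAt ℝ u q :=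
    (hu.eventually (by simp)).mono fun q hq => hq.differentiableAt (by simp)
  have d2 : ∀ᶠ q in 𝓝 p, DifferentiableAt ℝ u' (G.fwd q) :=
    hfwd.eventually ((hu'.eventually (by simp)).mono fun q hq => hq.differentiableAt (by simp))
  have dd1 : DifferentiableAt ℝ (dX u) p :=
    ((hu.fderiv_right (m := 1) (by norm_num)).clm_apply contDiffAt_const).differentiableAt (by simp)
  have dd2 : DifferentiableAt ℝ (dX u') (G.fwd p) :=
    ((hu'.fderiv_right (m := 1) (by norm_num)).clm_apply contDiffAt_const).differentiableAt (by simp)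
  have secx : ∀ {P : ℝ × ℝ → Prop} (q : ℝ × ℝ), (∀ᶠ y in 𝓝 q, P y) → ∀ᶠ x in 𝓝 q.2, P (q.1, x) :=
    fun q h => (Continuous.prodMk_right q.1).continuousAt.eventually h
  have sect : ∀ {P : ℝ × ℝ → Prop} (q : ℝ × ℝ), (∀ᶠ y in 𝓝 q, P y) → ∀ᶠ t in 𝓝 q.1, P (t, q.2) :=
    fun q h => (Continuous.prodMk_left q.2).continuousAt.eventually h
  -- first derivatives with respect to `x`
  have ex : ∀ᶠ q in 𝓝 p, G.ε * dX u' (G.fwd q) =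
      (dX u q + u q * (I / 2 * ((G.ε * deriv G.X q.1 : ℝ) : ℂ))) * exp (G.phase q) := by
    filter_upwards [eventually_eventually_nhds.2 huu', d1, d2, hΩ.isOpen.mem_nhds hp]
      with q hq h1 h2 hqΩ
    have l : HasDerivAt (fun x => G.fwd (q.1, x)) ((0 : ℝ), G.ε) q.2 :=
      (hasDerivAt_const _ _).prodMk
        ((((hasDerivAt_id q.2).const_mul G.ε).add_const (G.X q.1)).congr_deriv (by simp))
    have a1 := h2.hasFDerivAt.comp_hasDerivAt q.2 l
    have a2 := (hasDerivAt_dX h1).mul (G.hasDerivAt_exp_phase hΩ hqΩ).1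
    have := a1.unique (a2.congr_of_eventuallyEq (secx q hq))
    rw [fderiv_prod_apply, zero_smul, zero_add, real_smul] at this
    rw [this]; ring
  have exp' := ex.self_of_nhds
  -- the derivative with respect to `t`
  have et : dT u' (G.fwd p) + deriv G.X p.1 * dX u' (G.fwd p) = (dT u p + u p *
      (I / 2 * ((G.ε * deriv (deriv G.X) p.1 : ℝ) : ℂ) * (p.2 : ℂ) + deriv G.r p.1))
        * exp (G.phase p) := by
    have l : HasDerivAt (fun t => G.fwd (t, p.2)) ((1 : ℝ), deriv G.X p.1) p.1 :=
      (hasDerivAt_id _).prodMk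
        ((hasDerivAt_deriv_of_contDiffOn hJ G.smooth_X (mem_timeInterval hp)).const_add (G.ε * p.2))
    have a1 := d2.self_of_nhds.hasFDerivAt.comp_hasDerivAt p.1 l
    have a2 := (hasDerivAt_dT d1.self_of_nhds).mul (G.hasDerivAt_exp_phase hΩ hp).2
    have := a1.unique (a2.congr_of_eventuallyEq (sect p huu'))
    rw [fderiv_prod_apply, one_smul, real_smul] at this
    rw [this]; ring
  -- second derivatives with respect to `x`
  have exx : dX (dX u') (G.fwd p) = (dX (dX u) p
      + 2 * dX u p * (I / 2 * ((G.ε * deriv G.X p.1 : ℝ) : ℂ))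
      + u p * (I / 2 * ((G.ε * deriv G.X p.1 : ℝ) : ℂ)) ^ 2) * exp (G.phase p) := by
    have l : HasDerivAt (fun x => G.fwd (p.1, x)) ((0 : ℝ), G.ε) p.2 :=
      (hasDerivAt_const _ _).prodMk
        ((((hasDerivAt_id p.2).const_mul G.ε).add_const (G.X p.1)).congr_deriv (by simp))
    have a1 := (dd2.hasFDerivAt.comp_hasDerivAt p.2 l).const_mul (G.ε : ℂ)
    have a2 := ((hasDerivAt_dX dd1).add ((hasDerivAt_dX d1.self_of_nhds).mul_const
      (I / 2 * ((G.ε * deriv G.X p.1 : ℝ) : ℂ)))).mul (G.hasDerivAt_exp_phase hΩ hp).1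
    have := a1.unique (a2.congr_of_eventuallyEq (secx p ex))
    rw [fderiv_prod_apply, zero_smul, zero_add, real_smul] at this
    have hε : (G.ε : ℂ) * G.ε = 1 := by exact_mod_cast G.sq
    simp only [Pi.add_apply] at this
    linear_combination this - dX (dX u') (G.fwd p) * hε
  have hlog : Real.log ‖u' (G.fwd p)‖ = Real.log ‖u p‖ + (G.r p.1).re := by
    rw [huu'.self_of_nhds, norm_mul, Complex.norm_exp, Real.log_mul (by simpa using hu0)
      (Real.exp_pos _).ne', Real.log_exp]
    simp [phase]
  have key : nlsOp σ (G.potential σ V) u' (G.fwd p) = exp (G.phase p) * nlsOp σ V u p := by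
    unfold nlsOp nlsL nlsF
    change I * dT u' (G.fwd p) + dX (dX u') (G.fwd p) + (σ * u' (G.fwd p) * (Real.log ‖u' (G.fwd p)‖ : ℝ)
      + G.potential σ V (G.fwd p) * u' (G.fwd p)) = exp (G.phase p) * (I * dT u p + dX (dX u) p
      + (σ * u p * (Real.log ‖u p‖ : ℝ) + V p * u p))
    have hε : (G.ε : ℂ) * G.ε = 1 := by exact_mod_cast G.sq
    have hux : dX u' (G.fwd p) = G.ε *
        ((dX u p + u p * (I / 2 * ((G.ε * deriv G.X p.1 : ℝ) : ℂ))) * exp (G.phase p)) := by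
      linear_combination (G.ε : ℂ) * exp' - dX u' (G.fwd p) * hε
    have hut : dT u' (G.fwd p) = (dT u p + u p *
      (I / 2 * ((G.ε * deriv (deriv G.X) p.1 : ℝ) : ℂ) * (p.2 : ℂ) + deriv G.r p.1))
        * exp (G.phase p) - deriv G.X p.1 * dX u' (G.fwd p) := by linear_combination et
    rw [hlog, exx, hut, hux, huu'.self_of_nhds, potential, bwd_fwd, shift]
    push_cast
    linear_combination (u p * G.ε * ((deriv (deriv G.X) p.1 : ℝ) : ℂ) * p.2 * exp (G.phase p) / 2
      - ((deriv G.X p.1 : ℝ) : ℂ) ^ 2 * u p * exp (G.phase p) * G.ε ^ 2 / 4) * I_sq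
      + ((deriv G.X p.1 : ℝ) : ℂ) ^ 2 * u p * exp (G.phase p) / 4 * hε
  rw [key, mul_eq_zero]
  simp [exp_ne_zero]

/-- The transformation and the shift of the potential do not depend on `V`, so the same pair acts on
all equations of the class, as an element of the usual equivalence group must. -/
theorem groupEquivalent {V : ℝ × ℝ → ℂ} (hV : IsPotential Ω V) :
    GroupEquivalent σ Ω V G.image (G.potential σ V) := by
  have key : ∀ V, IsPotential Ω V →
      TransformsPotential σ Ω V (G.potential σ V) G.map (G.theta σ) := fun V hV =>
    ⟨fun z _ => by simp [potential, theta, base_map, bwd_fwd], G.transformsEquation hV⟩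
  exact ⟨G.map, G.theta σ, ⟨G.isDiffeoOn_map hV.domain, G.isDiffeoOn_theta hV.domain,
    fun V hV => ⟨_, G.isPotential_potential hV, key V hV⟩⟩, key V hV⟩

end GaugeData

end LogNLS

/-! ### Reduction of potentials to the canonical forms. -/

namespace LogNLS

variable {σ : ℂ} {Ω : Set (ℝ × ℝ)} {V : ℝ × ℝ → ℂ}

theorem hasDerivAt_re {f : ℝ → ℂ} {f' : ℂ} {t : ℝ} (h : HasDerivAt f f' t) :
    HasDerivAt (fun t => (f t).re) f'.re t :=
  reCLM.hasFDerivAt.comp_hasDerivAt t h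

theorem exists_first_order_ode_solution {J : Set ℝ} (hJ : IsOpen J) (hJc : J.OrdConnected)
    {f : ℝ → ℝ} (hf : ContDiffOn ℝ ∞ f J) (c : ℝ) :
    ∃ y : ℝ → ℝ, ContDiffOn ℝ ∞ y J ∧ ∀ t ∈ J, HasDerivAt y (f t - c * y t) t := by
  have he : ∀ c : ℝ, ContDiff ℝ ∞ (fun t : ℝ => Real.exp (c * t)) := fun c =>
    Real.contDiff_exp.comp (contDiff_const.mul contDiff_id)
  obtain ⟨g, hg, hg'⟩ := exists_antiderivative hJ hJc ((he c).contDiffOn.mul hf)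
  refine ⟨fun t => Real.exp (-c * t) * g t, (he (-c)).contDiffOn.mul hg, fun t ht => ?_⟩
  have h1 := ((hasDerivAt_id t).const_mul (-c)).exp
  refine (h1.mul (hg' t ht)).congr_deriv ?_
  have : Real.exp (-c * t) * Real.exp (c * t) = 1 := by rw [← Real.exp_add]; simp
  simp only [id]
  linear_combination f t * this

/-- Writing `r = y + i z`, the imaginary part of the equation is the linear equation `y' + σ₂ y = Im
g`, and the real part then gives `z` by integration. -/
theorem exists_complex_ode_solution {J : Set ℝ} (hJ : IsOpen J) (hJc : J.OrdConnected)
    {g : ℝ → ℂ} (hg : ContDiffOn ℝ ∞ g J) (σ : ℂ) :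
    ∃ r : ℝ → ℂ, ContDiffOn ℝ ∞ r J ∧ ∀ t ∈ J, I * deriv r t + σ * ((r t).re : ℝ) = g t := by
  obtain ⟨y, hy, hy'⟩ := exists_first_order_ode_solution hJ hJc (imCLM.contDiff.comp_contDiffOn hg)
    σ.im
  obtain ⟨z, hz, hz'⟩ := exists_antiderivative hJ hJc
    ((contDiffOn_const (c := σ.re)).mul hy |>.sub (reCLM.contDiff.comp_contDiffOn hg))
  refine ⟨fun t => y t + I * z t, (ofRealCLM.contDiff.comp_contDiffOn hy).add
    (contDiffOn_const.mul (ofRealCLM.contDiff.comp_contDiffOn hz)), fun t ht => ?_⟩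
  have := ((hy' t ht).ofReal_comp.add ((hz' t ht).ofReal_comp.const_mul I)).deriv
  erw [this]
  apply Complex.ext <;> simp

/-- Quadratic potentials are equivalent to reduced ones. -/
theorem exists_gaugeData_reduced (hV : IsPotential Ω V) {a : ℝ → ℝ} {b c : ℝ → ℂ}
    (ha : ContDiffOn ℝ ∞ a (timeInterval Ω)) (hb : ContDiffOn ℝ ∞ b (timeInterval Ω))
    (hc : ContDiffOn ℝ ∞ c (timeInterval Ω))
    (h : ∀ p ∈ Ω, V p = a p.1 * (p.2 : ℂ) ^ 2 + b p.1 * (p.2 : ℂ) + c p.1)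
    (σ : ℂ) {ε : ℝ} (hε : ε * ε = 1) :
    ∃ G : GaugeData Ω, ∀ q ∈ G.image, G.potential σ V q =
      a q.1 * (q.2 : ℂ) ^ 2 + I * ((ε * (b q.1).im : ℝ) : ℂ) * (q.2 : ℂ) := by
  have hJ := hV.domain.isOpen_timeInterval
  have hJc := hV.domain.ordConnected_timeInterval
  obtain ⟨p₀, hp₀⟩ := hV.domain.exists_mem
  -- The shift satisfies `X'' = 4 a X - 2 ε Re b`, which removes the real part of the coefficient of
  -- `x`. The initial values are irrelevant and set to zero.
  obtain ⟨X, hX, -, -, hode⟩ := exists_second_order_ode_solution hJ hJc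
    ((contDiffOn_const (c := (4 : ℝ))).mul ha)
    ((contDiffOn_const (c := -2 * ε)).mul (reCLM.contDiff.comp_contDiffOn hb))
    (mem_timeInterval hp₀) 0 0
  have hX' := contDiffOn_deriv hJ hX
  have hX'' := contDiffOn_deriv hJ hX'
  have cast {f : ℝ → ℝ} (hf : ContDiffOn ℝ ∞ f (timeInterval Ω)) :
    ContDiffOn ℝ ∞ (fun t => (f t : ℂ)) (timeInterval Ω) := ofRealCLM.contDiff.comp_contDiffOn hf
  -- The multiplier is chosen to absorb all terms of the new potential that are free of `x`.
  obtain ⟨r, hr, hr'⟩ := exists_complex_ode_solution hJ hJc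
    (g := fun t => (a t : ℂ) * (X t : ℂ) ^ 2 - b t * ε * X t + c t
      - ((deriv (deriv X) t : ℝ) : ℂ) * X t / 2 - ((deriv X t : ℝ) : ℂ) ^ 2 / 4)
    ((((((cast ha).mul ((cast hX).pow 2)).sub ((hb.mul contDiffOn_const).mul (cast hX))).add hc).sub
      (((cast hX'').mul (cast hX)).div_const 2)).sub (((cast hX').pow 2).div_const 4)) σ
  let G : GaugeData Ω := ⟨ε, X, r, hε, hX, hr⟩
  refine ⟨G, ?_⟩
  rintro _ ⟨p, hp, rfl⟩
  rw [GaugeData.potential, GaugeData.bwd_fwd, GaugeData.shift, h p hp]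
  change _ + (((ε * deriv (deriv X) p.1 / 2 * p.2 - (deriv X p.1) ^ 2 / 4 : ℝ) : ℂ)
    - I * deriv r p.1 - σ * ((r p.1).re : ℝ)) = (a p.1 : ℂ) * ((ε * p.2 + X p.1 : ℝ) : ℂ) ^ 2
      + I * ((ε * (b p.1).im : ℝ) : ℂ) * ((ε * p.2 + X p.1 : ℝ) : ℂ)
  have h1 := hr' p.1 (mem_timeInterval hp)
  have h2 : ((deriv (deriv X) p.1 : ℝ) : ℂ) = 4 * a p.1 * X p.1 - 2 * ε * (b p.1).re := by
    rw [hode p.1 (mem_timeInterval hp)]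
    simp
    ring
  have h3 : b p.1 = (b p.1).re + I * (b p.1).im := by
    rw [mul_comm]; exact (re_add_im _).symm
  have hε' : (ε : ℂ) * ε = 1 := by exact_mod_cast hε
  push_cast
  rw [h2] at h1 ⊢
  linear_combination -h1 + (p.2 + ε * X p.1 : ℂ) * h3
    - ((a p.1 : ℂ) * p.2 ^ 2 + p.2 * ((b p.1).re + I * (b p.1).im)) * hε'

theorem eq_const_of_deriv_eq_zero {J : Set ℝ} (hJ : IsOpen J) (hJc : J.OrdConnected) {f : ℝ → ℝ}
    (hf : ContDiffOn ℝ ∞ f J) (h : ∀ t ∈ J, deriv f t = 0) {a t : ℝ} (ha : a ∈ J) (ht : t ∈ J) :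
    f t = f a :=
  hJ.is_const_of_deriv_eq_zero hJc.isPreconnected
    (fun _ hs => (differentiableAt_of_contDiffOn hJ hf hs).differentiableWithinAt) h ht ha

/-- After removal of the real linear and the free terms only the leading coefficient and the
imaginary part of the linear one are left. If they are not both constant, the result is Case 2;
otherwise the sign of the leading coefficient selects among Cases 3, 4 and 5. -/
theorem IsQuadratic.exists_specialized (hV : IsPotential Ω V) (h : IsQuadratic Ω V) (σ : ℂ) :
    ∃ Ω' V', IsPotential Ω' V' ∧ IsSpecialized Ω' V' ∧ GroupEquivalent σ Ω V Ω' V' := by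
  have hJ := hV.domain.isOpen_timeInterval
  have hJc := hV.domain.ordConnected_timeInterval
  obtain ⟨a, b, c, ha, hb, hc, h⟩ := h
  have him : ContDiffOn ℝ ∞ (fun t => (b t).im) (timeInterval Ω) :=
    imCLM.contDiff.comp_contDiffOn hb
  by_cases hconst : ∃ t ∈ timeInterval Ω, deriv a t ≠ 0 ∨ deriv (fun t => (b t).im) t ≠ 0
  · obtain ⟨G, hG⟩ := exists_gaugeData_reduced hV ha hb hc h σ (one_mul 1)
    refine ⟨_, _, G.isPotential_potential hV, Or.inl ⟨a, fun t => (b t).im, ?_, ?_, ?_, ?_⟩,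
      G.groupEquivalent hV⟩
    · rwa [G.timeInterval_image]
    · rwa [G.timeInterval_image]
    · rwa [G.timeInterval_image]
    · intro q hq
      rw [hG q hq, one_mul]
  push Not at hconst
  obtain ⟨p₀, hp₀⟩ := hV.domain.exists_mem
  have ca := fun t ht => eq_const_of_deriv_eq_zero hJ hJc ha (fun t ht => (hconst t ht).1)
    (mem_timeInterval hp₀) (t := t) ht
  have cb := fun t ht => eq_const_of_deriv_eq_zero hJ hJc him (fun t ht => (hconst t ht).2)
    (mem_timeInterval hp₀) (t := t) ht
  generalize a p₀.1 = a₀ at ca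
  generalize (b p₀.1).im = b₀ at cb
  -- The reflection `x ↦ -x` changes the sign of the coefficient of `i x`; this gives `ν ≥ 0`.
  obtain ⟨ε, hε, hν⟩ : ∃ ε : ℝ, ε * ε = 1 ∧ 0 ≤ ε * b₀ := by
    rcases le_total 0 b₀ with hb₀ | hb₀
    · exact ⟨1, by simp, by simpa⟩
    · exact ⟨-1, by simp, by simpa⟩
  obtain ⟨G, hG⟩ := exists_gaugeData_reduced hV ha hb hc h σ hε
  have hG' : ∀ q ∈ G.image, G.potential σ V q =
      a₀ * (q.2 : ℂ) ^ 2 + I * ((ε * b₀ : ℝ) : ℂ) * (q.2 : ℂ) := fun q hq => by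
    have ht : q.1 ∈ timeInterval Ω := by
      rw [← G.timeInterval_image]; exact mem_timeInterval hq
    rw [hG q hq, ca _ ht, cb _ ht]
  refine ⟨_, _, G.isPotential_potential hV, Or.inr ?_, G.groupEquivalent hV⟩
  rcases lt_trichotomy a₀ 0 with ha₀ | rfl | ha₀
  · refine Or.inr (Or.inr ⟨Real.sqrt (-a₀), ε * b₀, Real.sqrt_pos.2 (by linarith), hν,
      fun q hq => ?_⟩)
    have : ((Real.sqrt (-a₀) : ℝ) : ℂ) ^ 2 = -a₀ := by
      exact_mod_cast Real.sq_sqrt (by linarith : 0 ≤ -a₀)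
    rw [hG' q hq, this, neg_neg]
  · exact Or.inl ⟨ε * b₀, hν, fun q hq => by rw [hG' q hq]; simp⟩
  · refine Or.inr (Or.inl ⟨Real.sqrt a₀, ε * b₀, Real.sqrt_pos.2 ha₀, hν, fun q hq => ?_⟩)
    have : ((Real.sqrt a₀ : ℝ) : ℂ) ^ 2 = a₀ := by exact_mod_cast Real.sq_sqrt ha₀.le
    rw [hG' q hq, this]

/-- A potential with a symmetry that shifts the time is equivalent to a stationary one. -/
theorem IsSymData.exists_stationary (hV : IsPotential Ω V) {χ : ℝ → ℝ} {ρ : ℝ → ℂ}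
    (h : IsSymData σ Ω V 1 χ ρ) :
    ∃ Ω' V', IsPotential Ω' V' ∧ IsStationary Ω' V' ∧ GroupEquivalent σ Ω V Ω' V' := by
  have hJ := hV.domain.isOpen_timeInterval
  have hJc := hV.domain.ordConnected_timeInterval
  have hχ := h.smooth_chi
  have hχ' := contDiffOn_deriv hJ hχ
  -- The conditions `X' = -χ` and `r' = -ρ + (i/2) χ²` say that the new `x` and the new `ψ` are
  -- invariants of the symmetry field, so that the field becomes `∂_t`.
  obtain ⟨X, hX, hX'⟩ := exists_antiderivative hJ hJc hχ.neg
  obtain ⟨r, hr, hr'⟩ := exists_antiderivative hJ hJc (f := fun t => -ρ t + I / 2 * (χ t : ℂ) ^ 2)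
    (h.smooth_rho.neg.add (contDiffOn_const.mul ((ofRealCLM.contDiff.comp_contDiffOn hχ).pow 2)))
  let G : GaugeData Ω := ⟨1, X, r, one_mul 1, hX, hr⟩
  refine ⟨_, _, G.isPotential_potential hV, ?_, G.groupEquivalent hV⟩
  rintro _ ⟨p, hp, rfl⟩
  have ht := mem_timeInterval hp
  have hP := G.isPotential_potential (σ := σ) hV
  have hq : G.fwd p ∈ G.image := ⟨p, hp, rfl⟩
  have hJn := hJ.mem_nhds ht
  have e1 : deriv X =ᶠ[𝓝 p.1] fun t => -χ t := by
    filter_upwards [hJn] with t ht using (hX' t ht).deriv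
  have e2 : deriv (deriv X) =ᶠ[𝓝 p.1] fun t => -deriv χ t := by
    filter_upwards [e1.eventuallyEq_nhds] with t ht
    rw [ht.deriv_eq, deriv.fun_neg]
  have e3 : deriv r =ᶠ[𝓝 p.1] fun t => -ρ t + I / 2 * (χ t : ℂ) ^ 2 := by
    filter_upwards [hJn] with t ht using (hr' t ht).deriv
  have dχ := hasDerivAt_deriv_of_contDiffOn hJ hχ ht
  have dχ' := hasDerivAt_deriv_of_contDiffOn hJ hχ' ht
  have dρ := hasDerivAt_deriv_of_contDiffOn hJ h.smooth_rho ht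
  have hbwd : G.bwd (G.fwd p) = p := G.bwd_fwd p
  set y := (G.fwd p).2 with hy
  have hpy : y - X p.1 = p.2 := by simp [hy, GaugeData.fwd, G]
  -- In the old coordinates a line of constant new `x` is an integral curve of `∂_t + χ ∂_x`;
  -- differentiating along it produces the left-hand side of the classifying condition.
  have curve : HasDerivAt (fun t => (t, y - X t)) ((1 : ℝ), χ p.1) p.1 :=
    (hasDerivAt_id _).prodMk (((hX' p.1 ht).const_sub y).congr_deriv (by simp))
  have dV : HasDerivAt (fun t => V (t, y - X t)) (dT V p + χ p.1 * dX V p) p.1 := by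
    have hv : HasFDerivAt V (fderiv ℝ V p) (p.1, y - X p.1) := by
      rw [hpy]; exact (hV.differentiableAt hp).hasFDerivAt
    refine (hv.comp_hasDerivAt p.1 curve).congr_deriv ?_
    rw [fderiv_prod_apply, one_smul, real_smul]
  have dS : HasDerivAt (fun t => ((-deriv χ t / 2 * (y - X t) - χ t ^ 2 / 4 : ℝ) : ℂ)
      - I * (-ρ t + I / 2 * (χ t : ℂ) ^ 2) - σ * ((r t).re : ℝ)) _ p.1 :=
    (((((dχ'.fun_neg.div_const 2).fun_mul ((hX' p.1 ht).const_sub y)).fun_sub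
      ((dχ.fun_pow 2).div_const 4)).ofReal_comp).fun_sub
      ((dρ.fun_neg.fun_add ((dχ.ofReal_comp.fun_pow 2).const_mul (I / 2))).const_mul I)).fun_sub
      ((hasDerivAt_re (hr' p.1 ht)).ofReal_comp.const_mul σ)
  have hslice : (fun t => G.potential σ V (t, y)) =ᶠ[𝓝 p.1] fun t => V (t, y - X t) +
      (((-deriv χ t / 2 * (y - X t) - χ t ^ 2 / 4 : ℝ) : ℂ)
      - I * (-ρ t + I / 2 * (χ t : ℂ) ^ 2) - σ * ((r t).re : ℝ)) := by
    filter_upwards [e1, e2, e3] with t h1 h2 h3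
    simp [GaugeData.potential, GaugeData.bwd, GaugeData.shift, G, h1, h2, h3]
  have main := (hasDerivAt_dT (hP.differentiableAt hq)).unique
    ((dV.fun_add dS).congr_of_eventuallyEq hslice)
  change dT (G.potential σ V) (G.fwd p) = 0
  rw [main, hpy]
  have hc := h.classifying p hp
  rw [ofReal_one, one_mul] at hc
  rw [hc]
  push_cast
  apply Complex.ext
  · simp [pow_two]
    ring
  · simp [pow_two]

end LogNLS

/-! ### Action of a point transformation on second-order jets. -/

namespace LogNLS

variable {σ : ℂ} {Ω Ω' : Set (ℝ × ℝ)} {V V' : ℝ × ℝ → ℂ} {φ : TotalSpace → TotalSpace}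

/-- A quadratic polynomial with given derivatives at `p`. -/
noncomputable def jetPoly (p : ℝ × ℝ) (c a₁ a₂ b₁ b₂ : ℂ) (q : ℝ × ℝ) : ℂ :=
  c + a₁ * ((q.1 - p.1 : ℝ) : ℂ) + a₂ * ((q.2 - p.2 : ℝ) : ℂ)
    + b₁ / 2 * ((q.1 - p.1 : ℝ) : ℂ) ^ 2 + b₂ / 2 * ((q.2 - p.2 : ℝ) : ℂ) ^ 2

section JetPoly

variable (p : ℝ × ℝ) (c a₁ a₂ b₁ b₂ : ℂ)

theorem contDiff_jetPoly : ContDiff ℝ ∞ (jetPoly p c a₁ a₂ b₁ b₂) := by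
  have h1 : ContDiff ℝ ∞ fun q : ℝ × ℝ => ((q.1 - p.1 : ℝ) : ℂ) :=
    ofRealCLM.contDiff.comp (contDiff_fst.sub contDiff_const)
  have h2 : ContDiff ℝ ∞ fun q : ℝ × ℝ => ((q.2 - p.2 : ℝ) : ℂ) :=
    ofRealCLM.contDiff.comp (contDiff_snd.sub contDiff_const)
  exact (((contDiff_const.add (contDiff_const.mul h1)).add (contDiff_const.mul h2)).add
    (contDiff_const.mul (h1.pow 2))).add (contDiff_const.mul (h2.pow 2))

theorem jetPoly_self : jetPoly p c a₁ a₂ b₁ b₂ p = c := by simp [jetPoly]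

theorem fderiv_jetPoly (q e : ℝ × ℝ) : fderiv ℝ (jetPoly p c a₁ a₂ b₁ b₂) q e =
    e.1 * (a₁ + b₁ * ((q.1 - p.1 : ℝ) : ℂ)) + e.2 * (a₂ + b₂ * ((q.2 - p.2 : ℝ) : ℂ)) := by
  apply fderiv_apply_eq ((contDiff_jetPoly p c a₁ a₂ b₁ b₂).differentiable (by simp) q)
  have h (x y z : ℝ) : HasDerivAt (fun s : ℝ => ((x + s * y - z : ℝ) : ℂ)) (y : ℂ) 0 :=
    ((((hasDerivAt_id (0 : ℝ)).mul_const y).const_add x).sub_const z).congr_deriv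
      (one_mul y) |>.ofReal_comp
  have h1 := h q.1 e.1 p.1
  have h2 := h q.2 e.2 p.2
  refine (((((h1.const_mul a₁).const_add c).fun_add (h2.const_mul a₂)).fun_add
    ((h1.fun_pow 2).const_mul (b₁ / 2))).fun_add ((h2.fun_pow 2).const_mul (b₂ / 2))).congr_deriv ?_
  simp
  ring

theorem nlsOp_jetPoly (z : TotalSpace) : nlsOp σ V (jetPoly (base z) z.2.2 a₁ a₂ b₁ b₂) (base z) =
    I * a₁ + b₂ + nlsF σ V z := by
  have h2 : fderiv ℝ (fun q => fderiv ℝ (jetPoly (base z) z.2.2 a₁ a₂ b₁ b₂) q (0, 1)) (base z)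
      (0, 1) = b₂ := by
    have e : (fun q => fderiv ℝ (jetPoly (base z) z.2.2 a₁ a₂ b₁ b₂) q (0, 1)) =
        jetPoly (base z) a₂ 0 b₂ 0 0 := by
      ext q
      rw [fderiv_jetPoly]
      simp [jetPoly]
    rw [e, fderiv_jetPoly]
    simp
  rw [nlsOp, h2, fderiv_jetPoly, jetPoly_self]
  simp [nlsL, base]

end JetPoly

/-- This product rule is applied twice along the same line in the proof of `TransformsEquation.jet`:
to the differential of `φ` and to that of the transformed function. -/
theorem hasDerivAt_clm_apply_curve {E F H : Type*} [NormedAddCommGroup E] [NormedSpace ℝ E]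
    [NormedAddCommGroup F] [NormedSpace ℝ F] [NormedAddCommGroup H] [NormedSpace ℝ H]
    {L : E → F →L[ℝ] H} {L' : E →L[ℝ] F →L[ℝ] H} {z : E} (hL : HasFDerivAt L L' z) {c : ℝ → E}
    {c' : E} (hc0 : c 0 = z) (hc : HasDerivAt c c' 0) {v : ℝ → F} {v₀ v' : F} (hv0 : v 0 = v₀)
    (hv : HasDerivAt v v' 0) :
    HasDerivAt (fun s => L (c s) (v s)) (L' c' v₀ + L z v') 0 := by
  subst hc0 hv0
  exact (hL.comp_hasDerivAt 0 hc).clm_apply hv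

/-- The transformation of the second-order jets of solutions. -/
theorem TransformsEquation.jet (hΩ : IsOpen Ω) (hφ : ContDiffOn ℝ ∞ φ (phaseDomain Ω))
    (h : TransformsEquation σ Ω V V' φ) {z : TotalSpace} (hz : z ∈ phaseDomain Ω) (a₁ a₂ b : ℂ)
    {f e : ℝ × ℝ} (hf : base (fderiv ℝ φ z (f.1, f.2, f.1 * a₁ + f.2 * a₂)) = (1, 0))
    (he : base (fderiv ℝ φ z (e.1, e.2, e.1 * a₁ + e.2 * a₂)) = (0, 1)) {W : TotalSpace}
    (hW : W = fderiv ℝ (fderiv ℝ φ) z (e.1, e.2, e.1 * a₁ + e.2 * a₂)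
        (e.1, e.2, e.1 * a₁ + e.2 * a₂)
      + fderiv ℝ φ z (0, 0, e.1 ^ 2 * b + e.2 ^ 2 * (-(I * a₁) - nlsF σ V z))) :
    I * (fderiv ℝ φ z (f.1, f.2, f.1 * a₁ + f.2 * a₂)).2.2
      + (W.2.2 - W.1 * (fderiv ℝ φ z (f.1, f.2, f.1 * a₁ + f.2 * a₂)).2.2
        - W.2.1 * (fderiv ℝ φ z (e.1, e.2, e.1 * a₁ + e.2 * a₂)).2.2) + nlsF σ V' (φ z) = 0 := by
  have hD := isOpen_phaseDomain hΩ
  -- The test function has arbitrary `ψ_t = a₁`, `ψ_x = a₂`, `ψ_tt = b` and zero `ψ_tx`, while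
  -- `ψ_xx` is determined by the equation at the point.
  set b₂ := -(I * a₁) - nlsF σ V z with hb₂
  set u := jetPoly (base z) z.2.2 a₁ a₂ b b₂ with hu
  have hus : ContDiff ℝ ∞ u := contDiff_jetPoly _ _ _ _ _ _
  have hup : u (base z) = z.2.2 := jetPoly_self _ _ _ _ _ _
  let γ : ℝ × ℝ → TotalSpace := fun q => (q.1, q.2, u q)
  have hγs : ContDiff ℝ ∞ γ := contDiff_fst.prodMk (contDiff_snd.prodMk hus)
  have hγp : γ (base z) = z := by simp only [γ, hup]; rfl
  let dγ : ℝ × ℝ → ℝ × ℝ → TotalSpace := fun q v => (v.1, v.2, fderiv ℝ u q v)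
  have hdγ : ∀ q v, fderiv ℝ γ q v = dγ q v := fun q v => by
    have h1 := (hasFDerivAt_fst (𝕜 := ℝ) (E := ℝ) (F := ℝ) (p := q)).prodMk
      ((hasFDerivAt_snd (𝕜 := ℝ) (E := ℝ) (F := ℝ) (p := q)).prodMk
        (hus.differentiable (by simp) q).hasFDerivAt)
    have : fderiv ℝ γ q = _ := h1.fderiv
    rw [this]
    rfl
  have hdγp : ∀ v, dγ (base z) v = (v.1, v.2, v.1 * a₁ + v.2 * a₂) := fun v => by
    simp [dγ, hu, fderiv_jetPoly]
  rw [← hdγp] at hf he hW ⊢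
  rw [← hdγp]
  -- the transformed curve and its local parametrization
  let Φ : ℝ × ℝ → TotalSpace := fun q => φ (γ q)
  have hφz : ContDiffAt ℝ ∞ φ (γ (base z)) := by rw [hγp]; exact hφ.contDiffAt (hD.mem_nhds hz)
  have hΦs : ContDiffAt ℝ ∞ Φ (base z) := hφz.comp _ hγs.contDiffAt
  have hev : ∀ᶠ q in 𝓝 (base z), γ q ∈ phaseDomain Ω :=
    hγs.continuous.continuousAt.eventually (by rw [hγp]; exact hD.mem_nhds hz)
  have hΦd : ∀ q, γ q ∈ phaseDomain Ω → HasFDerivAt Φ ((fderiv ℝ φ (γ q)).comp (fderiv ℝ γ q)) q :=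
    fun q hq => (differentiableAt_of_contDiffOn hD hφ hq).hasFDerivAt.comp q
      (hγs.differentiable (by simp) q).hasFDerivAt
  let g : ℝ × ℝ → ℝ × ℝ := fun q => baseL (Φ q)
  have hgs : ContDiffAt ℝ ∞ g (base z) := baseL.contDiff.contDiffAt.comp _ hΦs
  have hgd : ∀ q, γ q ∈ phaseDomain Ω →
      HasFDerivAt g (baseL.comp ((fderiv ℝ φ (γ q)).comp (fderiv ℝ γ q))) q := fun q hq =>
    baseL.hasFDerivAt.comp q (hΦd q hq)
  set A := baseL.comp ((fderiv ℝ φ (γ (base z))).comp (fderiv ℝ γ (base z))) with hA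
  have hAv : ∀ v, A v = base (fderiv ℝ φ z (dγ (base z) v)) := fun v => by
    rw [← hdγ, hA, hγp]; rfl
  -- The vectors `f` and `e` are preimages of the new coordinate directions. Their existence means
  -- that the image of the graph is again a graph near the point.
  have hAsurj : Function.Surjective A := fun w => by
    refine ⟨w.1 • f + w.2 • e, ?_⟩
    rw [map_add, map_smul, map_smul, hAv, hAv, hf, he]
    simp
  have hAinj : Function.Injective A :=
    (LinearMap.injective_iff_surjective (f := (A : ℝ × ℝ →ₗ[ℝ] ℝ × ℝ))).2 hAsurj
  let A' : (ℝ × ℝ) ≃L[ℝ] ℝ × ℝ := ContinuousLinearEquiv.ofBijective A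
    (LinearMap.ker_eq_bot.2 hAinj) (LinearMap.range_eq_top.2 hAsurj)
  have hA' : HasFDerivAt g (A' : ℝ × ℝ →L[ℝ] ℝ × ℝ) (base z) := by
    convert! hgd _ (by rw [hγp]; exact hz) using 1
  let ι := hgs.localInverse hA' (by simp)
  have hιs : ContDiffAt ℝ ∞ ι (g (base z)) := hgs.to_localInverse hA' (by simp)
  have hιp : ι (g (base z)) = base z := hgs.localInverse_apply_image hA' (by simp)
  have hιl : ∀ᶠ q in 𝓝 (base z), ι (g q) = q :=
    (hgs.hasStrictFDerivAt' hA' (by simp)).eventually_left_inverse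
  -- The transformed function is the last component of `φ` on the graph, reparametrized by the local
  -- inverse of the base map.
  let u' : ℝ × ℝ → ℂ := fun y => (Φ (ι y)).2.2
  have hu's : ContDiffAt ℝ ∞ u' (g (base z)) := by
    have h1 : ContDiffAt ℝ ∞ (fun y => Φ (ι y)) (g (base z)) :=
      ContDiffAt.comp (g := Φ) _ (by rw [hιp]; exact hΦs) hιs
    exact h1.snd.snd
  have hu'g : ∀ᶠ q in 𝓝 (base z), u' (g q) = (Φ q).2.2 :=
    hιl.mono fun q hq => by simp only [u', hq]
  have hgz : g (base z) = base (φ z) := by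
    change base (φ (γ (base z))) = _
    rw [hγp]
  -- the first derivatives
  have hu'd : ∀ᶠ y in 𝓝 (g (base z)), DifferentiableAt ℝ u' y := by
    have := (hu's.of_le two_le_infty).eventually (by simp)
    exact this.mono fun y hy => hy.differentiableAt (by simp)
  have first : ∀ᶠ q in 𝓝 (base z), ∀ v, fderiv ℝ u' (g q) (baseL (fderiv ℝ φ (γ q) (dγ q v))) =
      (fderiv ℝ φ (γ q) (dγ q v)).2.2 := by
    filter_upwards [eventually_eventually_nhds.2 hu'g, hgs.continuousAt.eventually hu'd, hev]
      with q h1 h2 h3 v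
    have d1 := h2.hasFDerivAt.comp q (hgd q h3)
    have d2 := (hasFDerivAt_psi (Φ q)).comp q (hΦd q h3)
    have := DFunLike.congr_fun (d1.unique (d2.congr_of_eventuallyEq h1)) v
    rw [← hdγ]
    exact this
  have firstp := first.self_of_nhds
  rw [hγp] at firstp
  have e1 : fderiv ℝ u' (g (base z)) (1, 0) = (fderiv ℝ φ z (dγ (base z) f)).2.2 := by
    rw [← firstp f]; congr 1; exact hf.symm
  have e2 : fderiv ℝ u' (g (base z)) (0, 1) = (fderiv ℝ φ z (dγ (base z) e)).2.2 := by
    rw [← firstp e]; congr 1; exact he.symm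
  -- the second derivative
  have line : HasDerivAt (fun s : ℝ => base z + s • e) e 0 :=
    (((hasDerivAt_id (0 : ℝ)).smul_const e).const_add (base z)).congr_deriv (one_smul ℝ e)
  have line0 : base z + (0 : ℝ) • e = base z := by simp
  have hγc : HasDerivAt (fun s : ℝ => γ (base z + s • e)) (dγ (base z) e) 0 := by
    have := (hγs.differentiable (by simp) (base z + (0 : ℝ) • e)).hasFDerivAt.comp_hasDerivAt 0 line
    rw [line0, hdγ] at this
    exact this
  have hdγc : HasDerivAt (fun s : ℝ => dγ (base z + s • e) e)
      ((0, 0, e.1 ^ 2 * b + e.2 ^ 2 * b₂) : TotalSpace) 0 := by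
    refine (hasDerivAt_const _ _).prodMk ((hasDerivAt_const _ _).prodMk ?_)
    have e3 : (fun s : ℝ => fderiv ℝ u (base z + s • e) e) = fun s : ℝ =>
        (e.1 * a₁ + e.2 * a₂) + (s : ℂ) * (e.1 ^ 2 * b + e.2 ^ 2 * b₂) := by
      ext s
      rw [hu, fderiv_jetPoly]
      simp
      ring
    rw [e3]
    exact (((hasDerivAt_id (0 : ℝ)).ofReal_comp.mul_const _).const_add _).congr_deriv (by simp)
  have hφ' : ContDiffOn ℝ ∞ (fderiv ℝ φ) (phaseDomain Ω) :=
    ((contDiffOn_infty_iff_fderiv_of_isOpen hD).1 hφ).2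
  have hWc : HasDerivAt (fun s : ℝ => fderiv ℝ φ (γ (base z + s • e)) (dγ (base z + s • e) e))
      W 0 := by
    rw [hW]
    exact hasDerivAt_clm_apply_curve (differentiableAt_of_contDiffOn hD hφ' hz).hasFDerivAt
      (by rw [line0, hγp]) hγc (by rw [line0]) hdγc
  have hu'1 : DifferentiableAt ℝ (fderiv ℝ u') (g (base z)) :=
    (hu's.fderiv_right (m := 1) (by exact two_le_infty)).differentiableAt (by simp)
  have hgc : HasDerivAt (fun s : ℝ => g (base z + s • e)) ((0, 1) : ℝ × ℝ) 0 := by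
    have d1 : HasFDerivAt g A (base z + (0 : ℝ) • e) := by rw [line0]; exact hA'
    refine (d1.comp_hasDerivAt 0 line).congr_deriv ?_
    rw [hAv, he]
  have left : HasDerivAt (fun s : ℝ => fderiv ℝ u' (g (base z + s • e))
      (baseL (fderiv ℝ φ (γ (base z + s • e)) (dγ (base z + s • e) e))))
      (fderiv ℝ (fderiv ℝ u') (g (base z)) (0, 1) (0, 1) + fderiv ℝ u' (g (base z)) (baseL W)) 0 := by
    refine hasDerivAt_clm_apply_curve hu'1.hasFDerivAt (by rw [line0]) hgc ?_
      (baseL.hasFDerivAt.comp_hasDerivAt 0 hWc)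
    simp only [line0, hγp]
    exact he
  have right := ((ContinuousLinearMap.snd ℝ ℝ ℂ).comp
    (ContinuousLinearMap.snd ℝ ℝ (ℝ × ℂ))).hasFDerivAt.comp_hasDerivAt 0 hWc
  have lc : Tendsto (fun s : ℝ => base z + s • e) (𝓝 0) (𝓝 (base z)) := by
    have := line.continuousAt.tendsto
    rwa [line0] at this
  have second := left.unique (right.congr_of_eventuallyEq
    ((lc.eventually first).mono fun s hs => hs e))
  have hbW : baseL W = W.1 • ((1, 0) : ℝ × ℝ) + W.2.1 • ((0, 1) : ℝ × ℝ) := by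
    simp [baseL]
  rw [hbW, map_add, map_smul, map_smul, e1, e2, real_smul, real_smul] at second
  -- the transformed equation
  have hut := h (base z) hz.1 u u' (by rw [hup]; exact hz.2) ((hus.of_le two_le_infty).contDiffAt)
  rw [hup] at hut
  have hzz : ((base z).1, (base z).2, z.2.2) = z := rfl
  rw [hzz, ← hgz] at hut
  have hop := (hut (hu's.of_le two_le_infty) hu'g).1 (by
    rw [hu, nlsOp_jetPoly, hb₂]; ring)
  have hu'p : u' (g (base z)) = (φ z).2.2 := by
    rw [hu'g.self_of_nhds]; simp only [Φ, hγp]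
  have e4 : fderiv ℝ (fun q => fderiv ℝ u' q (0, 1)) (g (base z)) (0, 1) =
      fderiv ℝ (fderiv ℝ u') (g (base z)) (0, 1) (0, 1) := by
    rw [fderiv_clm_apply hu'1 (by fun_prop)]
    simp
  rw [nlsOp, nlsL, e4, e1, hu'p] at hop
  have hzz' : ((g (base z)).1, (g (base z)).2, (φ z).2.2) = φ z := by rw [hgz]; rfl
  rw [hzz'] at hop
  have second' : _ = W.2.2 := second
  linear_combination hop - second'

end LogNLS

/-! ### Pointwise constraints on a point transformation. -/

namespace LogNLS

variable {σ : ℂ} {Ω Ω' : Set (ℝ × ℝ)} {V V' : ℝ × ℝ → ℂ} {φ : TotalSpace → TotalSpace}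

theorem IsDiffeoOn.bijective_fderiv {E : Type} [NormedAddCommGroup E] [NormedSpace ℝ E]
    {f : E → E} {s t : Set E} (h : IsDiffeoOn f s t) (hs : IsOpen s) (ht : IsOpen t) {z : E}
    (hz : z ∈ s) : Function.Bijective (fderiv ℝ f z) := by
  obtain ⟨hf, hm, g, hg, hm', hl, hr⟩ := h
  have d1 := (differentiableAt_of_contDiffOn hs hf hz).hasFDerivAt
  have d2 := (differentiableAt_of_contDiffOn ht hg (hm hz)).hasFDerivAt
  have d3 : HasFDerivAt f (fderiv ℝ f z) (g (f z)) := by rw [hl hz]; exact d1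
  have h1 : (fderiv ℝ g (f z)).comp (fderiv ℝ f z) = ContinuousLinearMap.id ℝ E :=
    (d2.comp z d1).unique ((hasFDerivAt_id z).congr_of_eventuallyEq
      (by filter_upwards [hs.mem_nhds hz] with y hy using hl hy))
  have h2 : (fderiv ℝ f z).comp (fderiv ℝ g (f z)) = ContinuousLinearMap.id ℝ E :=
    (d3.comp (f z) d2).unique ((hasFDerivAt_id (f z)).congr_of_eventuallyEq
      (by filter_upwards [ht.mem_nhds (hm hz)] with y hy using hr hy))
  exact ⟨Function.LeftInverse.injective fun v => DFunLike.congr_fun h1 v,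
    Function.RightInverse.surjective fun v => DFunLike.congr_fun h2 v⟩

section LinearAlgebra

variable {L : TotalSpace →L[ℝ] TotalSpace}

theorem clm_basis (L : TotalSpace →L[ℝ] TotalSpace) (a b : ℝ) (a₁ a₂ : ℂ) :
    L (a, b, a * a₁ + b * a₂) = a • L (1, 0, a₁) + b • L (0, 1, a₂) := by
  rw [← map_smul, ← map_smul, ← map_add]
  simp

theorem clm_split (L : TotalSpace →L[ℝ] TotalSpace) (a b : ℝ) (c : ℂ) :
    L (a, b, c) = L (a, b, 0) + L (0, 0, c) := by
  rw [← map_add]; simp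

theorem clm_fiber_smul (L : TotalSpace →L[ℝ] TotalSpace) (s : ℝ) (c : ℂ) :
    L (0, 0, s * c) = s • L (0, 0, c) := by
  rw [← map_smul]; simp

theorem clm_fiber_add (L : TotalSpace →L[ℝ] TotalSpace) (c d : ℂ) :
    L (0, 0, c + d) = L (0, 0, c) + L (0, 0, d) := by
  rw [← map_add]; simp

/-- A generic graph is projected diffeomorphically. -/
theorem exists_transversal (hL : Function.Surjective L) : ∃ a₁ a₂ : ℂ,
    (L (1, 0, a₁)).1 * (L (0, 1, a₂)).2.1 - (L (0, 1, a₂)).1 * (L (1, 0, a₁)).2.1 ≠ 0 := by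
  by_contra! h
  -- Preimages of the two base directions have base minor `1`. Expanding it bilinearly expresses
  -- this minor through the determinants assumed to vanish.
  obtain ⟨⟨t₁, x₁, c₁⟩, h₁⟩ := hL (1, 0, 0)
  obtain ⟨⟨t₂, x₂, c₂⟩, h₂⟩ := hL (0, 1, 0)
  have e (t x : ℝ) (c : ℂ) :
      L (t, x, c) = t • L (1, 0, 0) + x • L (0, 1, 0) + L (0, 0, c) := by
    rw [clm_split]
    congr 1
    simpa using clm_basis L t x 0 0
  have k00 := h 0 0
  have k01 := h 0 c₁
  have k02 := h 0 c₂
  have k10 := h c₁ 0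
  have k20 := h c₂ 0
  have k12 := h c₁ c₂
  rw [e] at h₁ h₂
  rw [clm_split L 1 0, clm_split L 0 1] at k00 k01 k02 k10 k20 k12
  generalize L (1, 0, 0) = P at *
  generalize L (0, 1, 0) = Q at *
  have z : L (0, 0, 0) = 0 := map_zero L
  rw [z] at k00 k01 k02 k10 k20
  generalize L (0, 0, c₁) = R at *
  generalize L (0, 0, c₂) = S at *
  have a1 := congrArg Prod.fst h₁
  have a2 := congrArg (fun v => v.2.1) h₁
  have b1 := congrArg Prod.fst h₂
  have b2 := congrArg (fun v => v.2.1) h₂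
  simp at a1 a2 b1 b2 k00 k01 k02 k10 k20 k12
  have : (t₁ * P.1 + x₁ * Q.1 + R.1) * (t₂ * P.2.1 + x₂ * Q.2.1 + S.2.1)
      - (t₂ * P.1 + x₂ * Q.1 + S.1) * (t₁ * P.2.1 + x₁ * Q.2.1 + R.2.1) = 0 := by
    linear_combination (t₁ * x₂ - x₁ * t₂) * k00 + t₁ * (k02 - k00) - x₁ * (k20 - k00)
      - t₂ * (k01 - k00) + x₂ * (k10 - k00) + k12 - k02 - k10 + k00
  rw [a1, a2, b1, b2] at this
  norm_num at this

/-- The hypothesis `h` says that the image of a vertical vector is tangent to the image of the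
graph. By injectivity the vertical vector is tangent to the graph itself, hence zero. -/
theorem eq_zero_of_vertical (hL : Function.Injective L) {a₁ a₂ c : ℂ} {f e : ℝ × ℝ}
    (hf : base (L (f.1, f.2, f.1 * a₁ + f.2 * a₂)) = (1, 0))
    (he : base (L (e.1, e.2, e.1 * a₁ + e.2 * a₂)) = (0, 1))
    (h : (L (0, 0, c)).2.2 - (L (0, 0, c)).1 * (L (f.1, f.2, f.1 * a₁ + f.2 * a₂)).2.2
      - (L (0, 0, c)).2.1 * (L (e.1, e.2, e.1 * a₁ + e.2 * a₂)).2.2 = 0) : c = 0 := by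
  set R := L (0, 0, c) with hR
  have hv : ((0, 0, c) : TotalSpace) - R.1 • ((f.1, f.2, f.1 * a₁ + f.2 * a₂) : TotalSpace)
      - R.2.1 • ((e.1, e.2, e.1 * a₁ + e.2 * a₂) : TotalSpace) = 0 := by
    apply hL
    rw [map_sub, map_sub, map_smul, map_smul, map_zero, ← hR]
    obtain ⟨f1, f2⟩ := Prod.mk.inj hf
    obtain ⟨g1, g2⟩ := Prod.mk.inj he
    ext1
    · simp [f1, g1]
    · ext1
      · simp [f2, g2]
      · simpa using h
  have h1 := congrArg Prod.fst hv
  have h2 := congrArg (fun v => v.2.1) hv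
  have h3 := congrArg (fun v => v.2.2) hv
  simp at h1 h2 h3
  have h1' : (-(R.1 * f.1) - R.2.1 * e.1 : ℂ) = 0 := by exact_mod_cast h1
  have h2' : (-(R.1 * f.2) - R.2.1 * e.2 : ℂ) = 0 := by exact_mod_cast h2
  linear_combination h3 - a₁ * h1' - a₂ * h2'

end LinearAlgebra

/-- The transformed time depends on the time only. -/
theorem TransformsEquation.time (hΩ : IsOpen Ω) (hΩ' : IsOpen Ω')
    (hφ : IsDiffeoOn φ (phaseDomain Ω) (phaseDomain Ω')) (h : TransformsEquation σ Ω V V' φ)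
    {z : TotalSpace} (hz : z ∈ phaseDomain Ω) :
    (fderiv ℝ φ z (0, 1, 0)).1 = 0 ∧ ∀ c, (fderiv ℝ φ z (0, 0, c)).1 = 0 := by
  obtain ⟨hinj, hsurj⟩ := hφ.bijective_fderiv (isOpen_phaseDomain hΩ) (isOpen_phaseDomain hΩ') hz
  have jet := @TransformsEquation.jet σ Ω V V' φ hΩ hφ.1 h z hz
  set L := fderiv ℝ φ z with hLdef
  have key : ∀ a₁ a₂ : ℂ,
      (L (1, 0, a₁)).1 * (L (0, 1, a₂)).2.1 - (L (0, 1, a₂)).1 * (L (1, 0, a₁)).2.1 ≠ 0 →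
      (L (0, 1, a₂)).1 = 0 := by
    intro a₁ a₂ hJ
    set J := (L (1, 0, a₁)).1 * (L (0, 1, a₂)).2.1 - (L (0, 1, a₂)).1 * (L (1, 0, a₁)).2.1 with hJd
    -- Cramer's rule for the preimages of the new coordinate directions in the tangent plane of the
    -- graph.
    let e : ℝ × ℝ := (-(L (0, 1, a₂)).1 / J, (L (1, 0, a₁)).1 / J)
    let f : ℝ × ℝ := ((L (0, 1, a₂)).2.1 / J, -(L (1, 0, a₁)).2.1 / J)
    have he : base (L (e.1, e.2, e.1 * a₁ + e.2 * a₂)) = (0, 1) := by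
      rw [clm_basis]
      ext
      · simp [base, e]; field_simp; ring
      · simp [base, e]; field_simp; rw [hJd]; ring
    have hf : base (L (f.1, f.2, f.1 * a₁ + f.2 * a₂)) = (1, 0) := by
      rw [clm_basis]
      ext
      · simp [base, f]; field_simp; rw [hJd]; ring
      · simp [base, f]; field_simp; ring
    -- The equation does not contain `ψ_tt`, so the identity cannot depend on it. The difference of
    -- its instances for `1` and `0` gives `e.1² = 0`: the new `x`-direction has no `t`-component.
    have j1 := jet a₁ a₂ 1 hf he rfl
    have j0 := jet a₁ a₂ 0 hf he rfl
    rw [mul_one, clm_fiber_add] at j1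
    rw [mul_zero, zero_add] at j0
    have := eq_zero_of_vertical hinj hf he (c := (e.1 : ℂ) ^ 2) (by
      simp only [Prod.fst_add, Prod.snd_add, ofReal_add] at j0 j1
      linear_combination j1 - j0)
    have he1 : e.1 = 0 := by simpa using this
    simpa [e, hJ] using he1
  obtain ⟨a₁, a₂, hJ⟩ := exists_transversal hsurj
  have h0 := key a₁ a₂ hJ
  have hψ : ∀ c, (L (0, 0, c)).1 = 0 := by
    intro c
    set Y := (L (0, 0, c)).2.1 with hY
    set Z := (L (0, 0, c)).1 with hZ
    set K := (L (1, 0, a₁)).1 * Y - Z * (L (1, 0, a₁)).2.1 with hK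
    set J := (L (1, 0, a₁)).1 * (L (0, 1, a₂)).2.1 - (L (0, 1, a₂)).1 * (L (1, 0, a₁)).2.1 with hJd
    -- A perturbation of `ψ_x` along `c` that preserves transversality; `s = 1` or `s = -1` works
    -- because `J ≠ 0`. Comparison with the unperturbed value isolates the `ψ`-derivative of the
    -- time.
    obtain ⟨s, hs, hs'⟩ : ∃ s : ℝ, s ≠ 0 ∧ J + s * K ≠ 0 := by
      by_cases h1 : J + K = 0
      · refine ⟨-1, by norm_num, fun h2 => hJ (by linarith)⟩
      · exact ⟨1, one_ne_zero, by simpa using h1⟩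
    have e1 : L (0, 1, a₂ + s * c) = L (0, 1, a₂) + s • L (0, 0, c) := by
      rw [← map_smul, ← map_add]; simp
    have := key a₁ (a₂ + s * c) (by
      rw [e1]
      simp only [Prod.fst_add, Prod.snd_add, Prod.smul_fst, Prod.smul_snd, smul_eq_mul]
      convert! hs' using 1
      rw [hJd, hK, hY, hZ]
      ring)
    rw [e1] at this
    simpa [h0, hs] using this
  refine ⟨?_, hψ⟩
  rw [clm_split] at h0
  simpa [hψ] using h0

/-- The pointwise consequences of the transformation of the equation. -/
structure PointForm (σ : ℂ) (V V' : ℝ × ℝ → ℂ) (φ : TotalSpace → TotalSpace) (z : TotalSpace)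
    (m : ℝ) : Prop where
  sq : m * m = 1
  time_x : (fderiv ℝ φ z (0, 1, 0)).1 = 0
  time_psi : ∀ c, (fderiv ℝ φ z (0, 0, c)).1 = 0
  space_psi : ∀ c, (fderiv ℝ φ z (0, 0, c)).2.1 = 0
  space_ne : (fderiv ℝ φ z (0, 1, 0)).2.1 ≠ 0
  time_t : (fderiv ℝ φ z (1, 0, 0)).1 = m * (fderiv ℝ φ z (0, 1, 0)).2.1 ^ 2
  rot : ∀ c, (fderiv ℝ φ z (0, 0, I * c)).2.2 = m * I * (fderiv ℝ φ z (0, 0, c)).2.2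
  psi_ne : ∀ c, (fderiv ℝ φ z (0, 0, c)).2.2 = 0 → c = 0
  eqn : ∀ a : ℂ, m * I * ((fderiv ℝ φ z (1, 0, 0)).2.2 - (fderiv ℝ φ z (1, 0, 0)).2.1 *
      ((fderiv ℝ φ z (0, 1, a)).2.2 / (fderiv ℝ φ z (0, 1, 0)).2.1))
    + (fderiv ℝ (fderiv ℝ φ) z (0, 1, a) (0, 1, a)).2.2 - (fderiv ℝ φ z (0, 0, nlsF σ V z)).2.2
    - (fderiv ℝ (fderiv ℝ φ) z (0, 1, a) (0, 1, a)).2.1 *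
      ((fderiv ℝ φ z (0, 1, a)).2.2 / (fderiv ℝ φ z (0, 1, 0)).2.1)
    + (fderiv ℝ φ z (0, 1, 0)).2.1 ^ 2 * nlsF σ V' (φ z) = 0

/-- With `T` depending on `t` only, the jet identity is affine in `ψ_t`. Its linear part compares `i
ψ_t` in both equations and yields `T_t = ± X_x²` and complex linearity or antilinearity in `ψ`; the
value at `ψ_t = 0` is the remaining equation in `ψ_x`. -/
theorem TransformsEquation.exists_pointForm (hΩ : IsOpen Ω) (hΩ' : IsOpen Ω')
    (hφ : IsDiffeoOn φ (phaseDomain Ω) (phaseDomain Ω')) (h : TransformsEquation σ Ω V V' φ)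
    {z : TotalSpace} (hz : z ∈ phaseDomain Ω) : ∃ m, PointForm σ V V' φ z m := by
  have hD := isOpen_phaseDomain hΩ
  obtain ⟨hinj, hsurj⟩ := hφ.bijective_fderiv hD (isOpen_phaseDomain hΩ') hz
  have htime := fun y hy => h.time hΩ hΩ' hφ (z := y) hy
  have jet := @TransformsEquation.jet σ Ω V V' φ hΩ hφ.1 h z hz
  obtain ⟨tx, tψ⟩ := htime z hz
  have hSt : ∀ a : ℂ, ∀ v, (fderiv ℝ (fderiv ℝ φ) z v (0, 1, a)).1 = 0 := by
    intro a v
    rw [← fderiv_fderiv_apply hD hφ.1 hz]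
    have d := (differentiableAt_of_contDiffOn hD (contDiffOn_fderiv_apply hD hφ.1 (0, 1, a))
      hz).hasFDerivAt
    have d' := d.fst.unique ((hasFDerivAt_const (0 : ℝ) z).congr_of_eventuallyEq (by
      filter_upwards [hD.mem_nhds hz] with y hy
      rw [clm_split]
      simp [htime y hy]))
    exact DFunLike.congr_fun d' v
  set L := fderiv ℝ φ z with hLdef
  set B := fderiv ℝ (fderiv ℝ φ) z with hB
  have t0 : ∀ (b : ℝ) (c : ℂ), (L (0, b, c)).1 = 0 := fun b c => by
    have e : L (0, b, c) = b • L (0, 1, 0) + L (0, 0, c) := by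
      rw [← map_smul, ← map_add]; simp
    rw [e]
    simp [tx, tψ]
  have e3 (a b : ℝ) (c : ℂ) : L (a, b, c) = a • L (1, 0, 0) + b • L (0, 1, 0) + L (0, 0, c) := by
    rw [clm_split]
    congr 1
    simpa using clm_basis L a b 0 0
  set τ := (L (1, 0, 0)).1 with hτ
  have τ_ne : τ ≠ 0 := by
    obtain ⟨⟨a, b, c⟩, hv⟩ := hsurj (1, 0, 0)
    rw [e3] at hv
    have := congrArg Prod.fst hv
    simp [tx, tψ, ← hτ] at this
    exact right_ne_zero_of_mul_eq_one this
  have gen : ∀ a₁ a : ℂ, (L (0, 1, a)).2.1 ≠ 0 →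
      I * ((L (1, 0, a₁)).2.2 - (L (1, 0, a₁)).2.1 * ((L (0, 1, a)).2.2 / (L (0, 1, a)).2.1)) / τ
      + ((B (0, 1, a) (0, 1, a)).2.2 + (L (0, 0, -(I * a₁) - nlsF σ V z)).2.2
        - ((B (0, 1, a) (0, 1, a)).2.1 + (L (0, 0, -(I * a₁) - nlsF σ V z)).2.1)
          * ((L (0, 1, a)).2.2 / (L (0, 1, a)).2.1)) / (L (0, 1, a)).2.1 ^ 2
      + nlsF σ V' (φ z) = 0 ∧
      ∀ c : ℂ, (L (0, 0, c)).2.2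
        - (L (0, 0, c)).2.1 * ((L (0, 1, a)).2.2 / (L (0, 1, a)).2.1) = 0 → c = 0 := by
    intro a₁ a hξ
    set ξ := (L (0, 1, a)).2.1 with hξd
    have hp1 : (L (1, 0, a₁)).1 = τ := by rw [clm_split]; simp [tψ, hτ]
    let e : ℝ × ℝ := (0, 1 / ξ)
    let f : ℝ × ℝ := (1 / τ, -(L (1, 0, a₁)).2.1 / (τ * ξ))
    have Le : L (e.1, e.2, e.1 * a₁ + e.2 * a) = (1 / ξ) • L (0, 1, a) := by
      rw [clm_basis]; simp [e]
    have Lf : L (f.1, f.2, f.1 * a₁ + f.2 * a) = (1 / τ) • L (1, 0, a₁) +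
        (-(L (1, 0, a₁)).2.1 / (τ * ξ)) • L (0, 1, a) := by
      rw [clm_basis]
    have he : base (L (e.1, e.2, e.1 * a₁ + e.2 * a)) = (0, 1) := by
      rw [Le]
      ext
      · simp [base, t0]
      · simp [base, ← hξd, hξ]
    have hf : base (L (f.1, f.2, f.1 * a₁ + f.2 * a)) = (1, 0) := by
      rw [Lf]
      ext
      · simp [base, t0, hp1, τ_ne]
      · simp [base, ← hξd]; field_simp; ring
    have hξ' : (ξ : ℂ) ≠ 0 := by exact_mod_cast hξ
    have hτ' : (τ : ℂ) ≠ 0 := by exact_mod_cast τ_ne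
    constructor
    · have ev : ((e.1, e.2, e.1 * a₁ + e.2 * a) : TotalSpace) = (1 / ξ) • ((0, 1, a) : TotalSpace) := by
        simp [e]
      have hW : ((1 / ξ ^ 2) • (B (0, 1, a) (0, 1, a) + L (0, 0, -(I * a₁) - nlsF σ V z)) : TotalSpace)
          = B (e.1, e.2, e.1 * a₁ + e.2 * a) (e.1, e.2, e.1 * a₁ + e.2 * a)
            + L (0, 0, e.1 ^ 2 * 0 + e.2 ^ 2 * (-(I * a₁) - nlsF σ V z)) := by
        have e4 : (e.1 ^ 2 * 0 + e.2 ^ 2 * (-(I * a₁) - nlsF σ V z) : ℂ) =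
            ((1 / ξ ^ 2 : ℝ) : ℂ) * (-(I * a₁) - nlsF σ V z) := by simp [e]
        rw [e4, clm_fiber_smul, ev, map_smul, map_smul, smul_add]
        simp [smul_smul]
        ring_nf
      have j := jet a₁ a 0 hf he hW
      rw [Le, Lf] at j
      simp [hSt, tψ] at j
      field_simp at j ⊢
      linear_combination j
    · intro c hc
      refine eq_zero_of_vertical hinj hf he ?_
      rw [Le, tψ]
      simp
      field_simp at hc ⊢
      linear_combination hc
  -- Applying the relation to `1` and to `I` composes the two rotations by `i`, which gives `(D_x
  -- X)⁴ = T_t²` for every admissible `ψ_x`.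
  have quart : ∀ a : ℂ, (L (0, 1, a)).2.1 ≠ 0 → ((L (0, 1, a)).2.1 ^ 2) ^ 2 = τ ^ 2 ∧
      ∀ d, I * ((L (0, 0, d)).2.2 - (L (0, 0, d)).2.1 * ((L (0, 1, a)).2.2 / (L (0, 1, a)).2.1)) *
        (L (0, 1, a)).2.1 ^ 2 = τ * ((L (0, 0, I * d)).2.2 - (L (0, 0, I * d)).2.1 *
          ((L (0, 1, a)).2.2 / (L (0, 1, a)).2.1)) := by
    intro a hξ
    have hξ' : ((L (0, 1, a)).2.1 : ℂ) ≠ 0 := by exact_mod_cast hξ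
    have hτ' : (τ : ℂ) ≠ 0 := by exact_mod_cast τ_ne
    have rel : ∀ d, I * ((L (0, 0, d)).2.2 - (L (0, 0, d)).2.1 * ((L (0, 1, a)).2.2 / (L (0, 1, a)).2.1)) *
        (L (0, 1, a)).2.1 ^ 2 = τ * ((L (0, 0, I * d)).2.2 - (L (0, 0, I * d)).2.1 *
          ((L (0, 1, a)).2.2 / (L (0, 1, a)).2.1)) := by
      intro d
      have g1 := (gen d a hξ).1
      have g0 := (gen 0 a hξ).1
      have e5 : L (0, 0, -(I * d) - nlsF σ V z) = -L (0, 0, I * d) + L (0, 0, -(I * 0) - nlsF σ V z) := by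
        rw [← map_neg, ← map_add]; simp [sub_eq_add_neg]
      rw [clm_split L 1 0 d, e5] at g1
      generalize (L (0, 1, a)).2.2 / ((L (0, 1, a)).2.1 : ℂ) = y at *
      simp only [Prod.fst_add, Prod.snd_add, Prod.snd_neg, Prod.fst_neg, ofReal_add, ofReal_neg] at g1
      field_simp at g0 g1
      linear_combination g1 - g0
    refine ⟨?_, rel⟩
    have r1 := rel 1
    have r2 := rel I
    rw [mul_one] at r1
    have e6 : L (0, 0, I * I) = -L (0, 0, 1) := by rw [← map_neg]; simp
    have hne := mt ((gen 0 a hξ).2 1) one_ne_zero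
    rw [e6] at r2
    generalize (L (0, 1, a)).2.2 / ((L (0, 1, a)).2.1 : ℂ) = y at *
    simp only [Prod.snd_neg, Prod.fst_neg, ofReal_neg] at r2
    have : ((((L (0, 1, a)).2.1 ^ 2) ^ 2 : ℝ) : ℂ) = ((τ ^ 2 : ℝ) : ℂ) := by
      push_cast
      apply mul_right_cancel₀ hne
      linear_combination (-(τ : ℂ)) * r2 - I * ((L (0, 1, a)).2.1 : ℂ) ^ 2 * r1 + ((L (0, 0, 1)).2.2 - (L (0, 0, 1)).2.1 * y) * ((L (0, 1, a)).2.1 : ℂ) ^ 4 * I_sq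
    exact_mod_cast this
  have xψ : ∀ c, (L (0, 0, c)).2.1 = 0 := by
    intro c
    by_contra hc
    -- If `X_ψ ≠ 0`, then `D_x X` takes every real value as `ψ_x` varies; the values `1` and `2`
    -- cannot have the same fourth power.
    have hval : ∀ r : ℝ, ∃ a, (L (0, 1, a)).2.1 = r := fun r => by
      refine ⟨(((r - (L (0, 1, 0)).2.1) / (L (0, 0, c)).2.1 : ℝ) : ℂ) * c, ?_⟩
      rw [clm_split, clm_fiber_smul]
      simp
      field_simp
      ring
    obtain ⟨a, ha⟩ := hval 1
    obtain ⟨b, hb⟩ := hval 2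
    have h1 := (quart a (by rw [ha]; norm_num)).1
    have h2 := (quart b (by rw [hb]; norm_num)).1
    rw [ha] at h1
    rw [hb, ← h1] at h2
    norm_num at h2
  have hx1 : ∀ a, (L (0, 1, a)).2.1 = (L (0, 1, 0)).2.1 := fun a => by
    rw [clm_split]; simp [xψ]
  have x_ne : (L (0, 1, 0)).2.1 ≠ 0 := by
    obtain ⟨⟨a, b, c⟩, hv⟩ := hsurj (0, 1, 0)
    rw [e3] at hv
    have h1 := congrArg Prod.fst hv
    have h2 := congrArg (fun v => v.2.1) hv
    simp [tx, tψ, ← hτ, τ_ne] at h1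
    simp [h1, xψ] at h2
    exact right_ne_zero_of_mul_eq_one h2
  set x₀ := (L (0, 1, 0)).2.1 with hx₀
  have q1 := (quart 0 x_ne).1
  have hx0' : (x₀ : ℂ) ≠ 0 := by exact_mod_cast x_ne
  have hmsq : τ / x₀ ^ 2 * (τ / x₀ ^ 2) = 1 := by
    field_simp
    rw [q1.symm]
    ring
  refine ⟨τ / x₀ ^ 2, hmsq, tx, tψ, xψ, x_ne, ?_, ?_, ?_, ?_⟩
  · rw [← hLdef, ← hx₀, ← hτ]
    field_simp
  · intro c
    have := (quart 0 x_ne).2 c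
    simp only [xψ, ofReal_zero, zero_mul, sub_zero] at this
    have hτ' : (τ : ℂ) ≠ 0 := by exact_mod_cast τ_ne
    have q2 : ((x₀ : ℂ) ^ 2) ^ 2 = (τ : ℂ) ^ 2 := by exact_mod_cast q1
    rw [← hLdef, ofReal_div, ofReal_pow]
    field_simp
    apply mul_left_cancel₀ hτ'
    linear_combination (-(x₀ : ℂ) ^ 2) * this + I * (L (0, 0, c)).2.2 * q2
  · intro c hc
    refine (gen 0 0 x_ne).2 c ?_
    simpa [xψ] using hc
  · intro a
    have g := (gen 0 a (by rw [hx1]; exact x_ne)).1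
    rw [hx1] at g
    simp only [xψ, ofReal_zero, mul_zero, neg_zero, zero_sub, add_zero] at g
    have e7 : L (0, 0, -nlsF σ V z) = -L (0, 0, nlsF σ V z) := by rw [← map_neg]; simp
    rw [e7] at g
    have hτ' : (τ : ℂ) ≠ 0 := by exact_mod_cast τ_ne
    have q2 : ((x₀ : ℂ) ^ 2) ^ 2 = (τ : ℂ) ^ 2 := by exact_mod_cast q1
    have hm : ((τ / x₀ ^ 2 : ℝ) : ℂ) = (x₀ : ℂ) ^ 2 / τ := by
      push_cast
      field_simp
      linear_combination -q2
    rw [hm, ← hLdef, ← hB, ← hx₀]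
    simp only [Prod.snd_neg] at g
    generalize (L (0, 1, a)).2.2 / (x₀ : ℂ) = y at *
    field_simp at g ⊢
    simp at g
    linear_combination g

end LogNLS

/-! ### Global form of point transformations. -/

namespace LogNLS

variable {σ : ℂ} {Ω Ω' : Set (ℝ × ℝ)} {V V' : ℝ × ℝ → ℂ} {φ : TotalSpace → TotalSpace}

/-- The sign is the continuous function `T_t / X_x²` with values `±1` on a connected set. -/
theorem exists_uniform_pointForm (hΩ : IsPotentialDomain Ω)
    (hφ : ContDiffOn ℝ ∞ φ (phaseDomain Ω))
    (h : ∀ z ∈ phaseDomain Ω, ∃ m, PointForm σ V V' φ z m) :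
    ∃ m : ℝ, m * m = 1 ∧ ∀ z ∈ phaseDomain Ω, PointForm σ V V' φ z m := by
  have hD := isOpen_phaseDomain hΩ.isOpen
  let f : TotalSpace → ℝ := fun z => (fderiv ℝ φ z (1, 0, 0)).1 / (fderiv ℝ φ z (0, 1, 0)).2.1 ^ 2
  have hf : ∀ z ∈ phaseDomain Ω, PointForm σ V V' φ z (f z) := fun z hz => by
    obtain ⟨m, hm⟩ := h z hz
    have : f z = m := by
      have := hm.space_ne
      simp only [f, hm.time_t]
      field_simp
    rwa [this]
  have c1 := (contDiffOn_fderiv_apply hD hφ (1, 0, 0)).continuousOn.fst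
  have c2 := (contDiffOn_fderiv_apply hD hφ (0, 1, 0)).continuousOn.snd.fst
  have hc : ContinuousOn f (phaseDomain Ω) :=
    c1.div (c2.pow 2) fun z hz => pow_ne_zero 2 (hf z hz).space_ne
  have hsq : EqOn (f ^ 2) 1 (phaseDomain Ω) := fun z hz => by
    have := (hf z hz).sq
    simpa [sq] using this
  rcases (isPreconnected_phaseDomain hΩ.isConnected.isPreconnected).eq_one_or_eq_neg_one_of_sq_eq
    hc hsq with h1 | h1
  · exact ⟨1, by norm_num, fun z hz => by simpa [h1 hz] using hf z hz⟩
  · exact ⟨-1, by norm_num, fun z hz => by simpa [h1 hz] using hf z hz⟩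

/-- The identity or the conjugation of the complex numbers. -/
theorem exists_conjugation {m : ℝ} (hm : m * m = 1) : ∃ C : ℂ →L[ℝ] ℂ, (∀ v w, C (v * w) = C v * C w) ∧
    (∀ r : ℝ, C r = r) ∧ (C I = m * I) ∧ ∀ w, ‖C w‖ = ‖w‖ := by
  rcases mul_self_eq_one_iff.1 hm with rfl | rfl
  · exact ⟨ContinuousLinearMap.id ℝ ℂ, by simp, by simp, by simp, by simp⟩
  · refine ⟨conjCLE.toContinuousLinearMap, fun v w => ?_, fun r => ?_, ?_, fun w => ?_⟩
    · simp
    · simp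
    · simp
    · simp

/-- The form of a point transformation between two equations of the class. -/
structure TransformationForm (σ : ℂ) (Ω : Set (ℝ × ℝ)) (V V' : ℝ × ℝ → ℂ)
    (φ : TotalSpace → TotalSpace) (m : ℝ) (C : ℂ →L[ℝ] ℂ) (T : ℝ → ℝ) (X : ℝ × ℝ → ℝ)
    (α : ℝ × ℝ → ℂ) : Prop where
  smooth_T : ContDiffOn ℝ ∞ T (timeInterval Ω)
  smooth_X : ContDiffOn ℝ ∞ X Ω
  smooth_a : ContDiffOn ℝ ∞ α Ω
  base_eq : ∀ z ∈ phaseDomain Ω, base (φ z) = (T z.1, X (base z))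
  a_ne : ∀ p ∈ Ω, α p ≠ 0
  deriv_T : ∀ p ∈ Ω, deriv T p.1 = m * dX X p ^ 2
  linear : ∀ p ∈ Ω, 2 * dX α p * ((dX X p : ℝ) : ℂ) = α p * (I * ((dT X p : ℝ) : ℂ) + ((dX (dX X) p : ℝ) : ℂ))
  const : ∀ p ∈ Ω, ∀ c : ℂ, c ≠ 0 → I * (dT α p - ((dT X p : ℝ) : ℂ) * (dX α p / ((dX X p : ℝ) : ℂ))) + dX (dX α) p
    - α p * (σ * (Real.log ‖c‖ : ℝ) + V p) - ((dX (dX X) p : ℝ) : ℂ) * (dX α p / ((dX X p : ℝ) : ℂ))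
    + ((dX X p : ℝ) : ℂ) ^ 2 * (α p * (C σ * (Real.log ‖α p * c‖ : ℝ) + C (V' (T p.1, X p)))) = 0

/-- Applying `C`, the identity or the conjugation according to the sign `m`, makes the new dependent
variable complex linear in its `ψ`-derivative, so `eta_structure` applies and the two signs are
treated together. -/
theorem exists_transformationForm (hΩ : IsPotentialDomain Ω)
    (hφ : ContDiffOn ℝ ∞ φ (phaseDomain Ω)) (hmaps : MapsTo φ (phaseDomain Ω) (phaseDomain Ω'))
    {m : ℝ} (h : ∀ z ∈ phaseDomain Ω, PointForm σ V V' φ z m) {C : ℂ →L[ℝ] ℂ}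
    (Cmul : ∀ v w, C (v * w) = C v * C w) (Creal : ∀ r : ℝ, C r = r) (CI : C I = m * I)
    (Cnorm : ∀ w, ‖C w‖ = ‖w‖) (hm : m * m = 1) :
    ∃ T X α, TransformationForm σ Ω V V' φ m C T X α := by
  have hO := hΩ.isOpen
  have hD := isOpen_phaseDomain hO
  have hdφ : ∀ z ∈ phaseDomain Ω, HasFDerivAt φ (fderiv ℝ φ z) z := fun z hz =>
    (differentiableAt_of_contDiffOn hD hφ hz).hasFDerivAt
  have hddφ : ∀ z ∈ phaseDomain Ω, ∀ v, HasFDerivAt (fun y => fderiv ℝ φ y v)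
      (fderiv ℝ (fun y => fderiv ℝ φ y v) z) z := fun z hz v =>
    (differentiableAt_of_contDiffOn hD (contDiffOn_fderiv_apply hD hφ v) hz).hasFDerivAt
  have sT : ContDiffOn ℝ ∞ (fun z => (φ z).1) (phaseDomain Ω) := hφ.fst
  have sX : ContDiffOn ℝ ∞ (fun z => (φ z).2.1) (phaseDomain Ω) := hφ.snd.fst
  have dT' : ∀ z ∈ phaseDomain Ω, ∀ v, fderiv ℝ (fun z => (φ z).1) z v = (fderiv ℝ φ z v).1 :=
    fun z hz v => DFunLike.congr_fun (hdφ z hz).fst.fderiv v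
  have dX' : ∀ z ∈ phaseDomain Ω, ∀ v, fderiv ℝ (fun z => (φ z).2.1) z v = (fderiv ℝ φ z v).2.1 :=
    fun z hz v => DFunLike.congr_fun (hdφ z hz).snd.fst.fderiv v
  have hlift : ∀ p ∈ Ω, ((p.1, p.2, 1) : TotalSpace) ∈ phaseDomain Ω := fun p hp =>
    ⟨hp, one_ne_zero⟩
  obtain ⟨T₁, hT₁, eT₁⟩ := exists_eq_comp_base hO sT fun z hz c => by
    rw [dT' z hz]; exact (h z hz).time_psi c
  obtain ⟨X, hX, eX⟩ := exists_eq_comp_base hO sX fun z hz c => by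
    rw [dX' z hz]; exact (h z hz).space_psi c
  have fT := fun z hz => fderiv_eq_of_eq_comp_base (z := z) hO hT₁ eT₁ hz
  have fX := fun z hz => fderiv_eq_of_eq_comp_base (z := z) hO hX eX hz
  obtain ⟨T, hT, eT⟩ := hΩ.exists_eq_comp_fst hT₁ fun p hp => by
    have := fT _ (hlift p hp) 0 1 0
    rw [dT' _ (hlift p hp), (h _ (hlift p hp)).time_x] at this
    simpa [base] using this.symm
  have hJ := hΩ.isOpen_timeInterval
  have fT' : ∀ z ∈ phaseDomain Ω, (fderiv ℝ φ z (1, 0, 0)).1 = deriv T z.1 := fun z hz => by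
    rw [← dT' z hz, fT z hz]
    have : T₁ =ᶠ[𝓝 (base z)] fun p => T p.1 := by
      filter_upwards [hO.mem_nhds hz.1] with p hp using eT p hp
    rw [dT, this.fderiv_eq]
    have e := dT_comp_fst (p := base z)
      (hasDerivAt_deriv_of_contDiffOn hJ hT (mem_timeInterval hz.1)).differentiableAt
    rw [dT] at e
    rw [e]
    simp [base]
  have fXx : ∀ z ∈ phaseDomain Ω, ∀ (a b : ℝ) (c : ℂ),
      (fderiv ℝ φ z (a, b, c)).2.1 = a * dT X (base z) + b * dX X (base z) := fun z hz a b c => by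
    rw [← dX' z hz, fX z hz]; simp
  have fXxx : ∀ z ∈ phaseDomain Ω, ∀ a : ℂ,
      (fderiv ℝ (fderiv ℝ φ) z (0, 1, a) (0, 1, a)).2.1 = dX (dX X) (base z) := fun z hz a => by
    rw [← fderiv_fderiv_apply hD hφ hz]
    have e1 : fderiv ℝ (fun y => (fderiv ℝ φ y (0, 1, a)).2.1) z (0, 1, a) = _ :=
      DFunLike.congr_fun (hddφ z hz (0, 1, a)).snd.fst.fderiv (0, 1, a)
    refine e1.symm.trans ?_
    rw [fderiv_eq_of_eq_comp_base hO (contDiffOn_dX hO hX) (fun y hy => ?_) hz]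
    · simp
    · rw [fXx y hy]; simp
  -- the transformed dependent variable
  let η : TotalSpace → ℂ := fun z => C (φ z).2.2
  have sη : ContDiffOn ℝ ∞ η (phaseDomain Ω) := C.contDiff.comp_contDiffOn hφ.snd.snd
  have dη : ∀ z ∈ phaseDomain Ω, ∀ v, fderiv ℝ η z v = C (fderiv ℝ φ z v).2.2 := fun z hz v =>
    DFunLike.congr_fun (C.hasFDerivAt.comp z (hdφ z hz).snd.snd).fderiv v
  have ddη : ∀ z ∈ phaseDomain Ω, ∀ v w, fderiv ℝ (fderiv ℝ η) z v w =
      C (fderiv ℝ (fderiv ℝ φ) z v w).2.2 := fun z hz v w => by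
    rw [← fderiv_fderiv_apply hD hφ hz, ← fderiv_fderiv_apply hD sη hz]
    have e1 : (fun y => fderiv ℝ η y w) =ᶠ[𝓝 z] fun y => C (fderiv ℝ φ y w).2.2 := by
      filter_upwards [hD.mem_nhds hz] with y hy using dη y hy w
    rw [e1.fderiv_eq]
    exact DFunLike.congr_fun (C.hasFDerivAt.comp z (hddφ z hz w).snd.snd).fderiv v
  have ηrot : ∀ z ∈ phaseDomain Ω, ∀ c, fderiv ℝ η z (0, 0, I * c) = I * fderiv ℝ η z (0, 0, c) :=
    fun z hz c => by
      rw [dη z hz, dη z hz, (h z hz).rot, Cmul, Cmul, Creal, CI]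
      have : (m : ℂ) * m = 1 := by exact_mod_cast hm
      linear_combination I * C (fderiv ℝ φ z (0, 0, c)).2.2 * this
  have ηlin : ∀ z ∈ phaseDomain Ω, ∀ c, fderiv ℝ η z (0, 0, c) = c * fderiv ℝ η z (0, 0, 1) :=
    fun z hz c => by
      have e1 : ((0, 0, c) : TotalSpace) = c.re • ((0, 0, 1) : TotalSpace)
          + c.im • ((0, 0, I * 1) : TotalSpace) := by
        simp [mul_comm I, re_add_im]
      rw [e1, map_add, map_smul, map_smul, ηrot z hz, real_smul, real_smul]
      conv_rhs => rw [← re_add_im c]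
      ring
  -- the equation for `η`
  have main : ∀ z ∈ phaseDomain Ω, ∀ a : ℂ,
      I * (fderiv ℝ η z (1, 0, 0) - ((dT X (base z) : ℝ) : ℂ) * (fderiv ℝ η z (0, 1, a) / ((dX X (base z) : ℝ) : ℂ)))
      + fderiv ℝ (fderiv ℝ η) z (0, 1, a) (0, 1, a) - fderiv ℝ η z (0, 0, nlsF σ V z)
      - ((dX (dX X) (base z) : ℝ) : ℂ) * (fderiv ℝ η z (0, 1, a) / ((dX X (base z) : ℝ) : ℂ))
      + ((dX X (base z) : ℝ) : ℂ) ^ 2 * C (nlsF σ V' (φ z)) = 0 := by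
    intro z hz a
    have e := congrArg C ((h z hz).eqn a)
    have hm' : (m : ℂ) * m = 1 := by exact_mod_cast hm
    have Cdiv : ∀ (w : ℂ) (r : ℝ), C (w / r) = C w / r := fun w r => by
      rw [div_eq_mul_inv, ← ofReal_inv, Cmul, Creal, ofReal_inv, div_eq_mul_inv]
    have Cpow : ∀ r : ℝ, C ((r : ℂ) ^ 2) = (r : ℂ) ^ 2 := fun r => by
      rw [← ofReal_pow, Creal]
    simp only [map_add, map_sub, Cmul, Creal, CI, Cdiv, Cpow, map_zero, fXxx z hz, fXx z hz] at e
    rw [dη z hz, dη z hz, dη z hz, ddη z hz]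
    simp at e
    generalize C (fderiv ℝ φ z (0, 1, a)).2.2 / ((dX X (base z) : ℝ) : ℂ) = y at *
    linear_combination e - I * (C (fderiv ℝ φ z (1, 0, 0)).2.2 - ((dT X (base z) : ℝ) : ℂ) * y) * hm'
  have hadd : ∀ z (a : ℂ), fderiv ℝ η z (0, 1, a) = fderiv ℝ η z (0, 1, 0) + fderiv ℝ η z (0, 0, a) :=
    fun z a => by rw [← map_add]; simp
  have hneg : ∀ z (a : ℂ), fderiv ℝ η z (0, 0, -a) = -fderiv ℝ η z (0, 0, a) :=
    fun z a => by rw [← map_neg]; simp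
  have haddB : ∀ z (a : ℂ), fderiv ℝ (fderiv ℝ η) z (0, 1, a) (0, 1, a) =
      fderiv ℝ (fderiv ℝ η) z (0, 1, 0) (0, 1, 0) + (fderiv ℝ (fderiv ℝ η) z (0, 1, 0) (0, 0, a)
        + fderiv ℝ (fderiv ℝ η) z (0, 0, a) (0, 1, 0))
        + fderiv ℝ (fderiv ℝ η) z (0, 0, a) (0, 0, a) := fun z a => by
    have : ((0, 1, a) : TotalSpace) = (0, 1, 0) + (0, 0, a) := by simp
    rw [this, map_add, map_add, add_apply, add_apply]
    ring
  have hnegB : ∀ z (a : ℂ), fderiv ℝ (fderiv ℝ η) z (0, 1, -a) (0, 1, -a) =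
      fderiv ℝ (fderiv ℝ η) z (0, 1, 0) (0, 1, 0) - (fderiv ℝ (fderiv ℝ η) z (0, 1, 0) (0, 0, a)
        + fderiv ℝ (fderiv ℝ η) z (0, 0, a) (0, 1, 0))
        + fderiv ℝ (fderiv ℝ η) z (0, 0, a) (0, 0, a) := fun z a => by
    have : ((0, 1, -a) : TotalSpace) = (0, 1, 0) - (0, 0, a) := by simp
    rw [this, map_sub, map_sub, sub_apply, sub_apply]
    ring
  -- The part of the equation that is even in `ψ_x` forces the fiber Hessian to vanish.
  obtain ⟨α, β, hα, hβ, hηeq⟩ := eta_structure hO sη ηlin fun z hz a => by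
    have h0 := main z hz 0
    have h1 := main z hz a
    have h2 := main z hz (-a)
    rw [hadd, haddB] at h1
    rw [hadd, hnegB, hneg] at h2
    linear_combination (h1 + h2) / 2 - h0
  have dα := fun p hp => differentiableAt_of_contDiffOn hO hα (x := p) hp
  have dβ := fun p hp => differentiableAt_of_contDiffOn hO hβ (x := p) hp
  have fη : ∀ z ∈ phaseDomain Ω, ∀ (a b : ℝ) (c : ℂ), fderiv ℝ η z (a, b, c) =
      (a * dT α (base z) + b * dX α (base z)) * z.2.2 + α (base z) * c
        + (a * dT β (base z) + b * dX β (base z)) := fun z hz a b c => by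
    have e1 : η =ᶠ[𝓝 z] fun z => α (base z) * z.2.2 + β (base z) := by
      filter_upwards [hD.mem_nhds hz] with y hy using hηeq y hy
    rw [e1.fderiv_eq, fderiv_affine (dα _ hz.1) (dβ _ hz.1)]
  have α_ne : ∀ p ∈ Ω, α p ≠ 0 := fun p hp h0 => by
    have hz := hlift p hp
    have e1 := fη _ hz 0 0 1
    have e2 : C (fderiv ℝ φ (p.1, p.2, 1) (0, 0, 1)).2.2 = 0 := by
      rw [← dη _ hz, e1]
      simp [base, h0]
    have e3 : (fderiv ℝ φ (p.1, p.2, 1) (0, 0, 1)).2.2 = 0 := by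
      rw [← norm_eq_zero, ← Cnorm, e2, norm_zero]
    exact one_ne_zero ((h _ hz).psi_ne 1 e3)
  -- Otherwise the nonzero value `ψ = -β / α` would be sent to `0`, outside the target domain.
  have β_zero : ∀ p ∈ Ω, β p = 0 := fun p hp => by
    by_contra h0
    have hz : ((p.1, p.2, -β p / α p) : TotalSpace) ∈ phaseDomain Ω :=
      ⟨hp, div_ne_zero (neg_ne_zero.2 h0) (α_ne p hp)⟩
    have e1 := hηeq _ hz
    have e2 : η (p.1, p.2, -β p / α p) = 0 := by
      rw [e1]
      have := α_ne p hp
      simp only [base]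
      field_simp
      simp
    have e3 : (φ (p.1, p.2, -β p / α p)).2.2 = 0 := by
      rw [← norm_eq_zero, ← Cnorm]
      exact norm_eq_zero.2 e2
    exact (hmaps hz).2 e3
  have β_x : ∀ p ∈ Ω, dT β p = 0 ∧ dX β p = 0 := fun p hp => by
    have e1 : β =ᶠ[𝓝 p] fun _ => 0 := by
      filter_upwards [hO.mem_nhds hp] with y hy using β_zero y hy
    simp [dT, dX, e1.fderiv_eq]
  have fη' : ∀ z ∈ phaseDomain Ω, ∀ (a b : ℝ) (c : ℂ), fderiv ℝ η z (a, b, c) =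
      (a * dT α (base z) + b * dX α (base z)) * z.2.2 + α (base z) * c := fun z hz a b c => by
    rw [fη z hz, (β_x _ hz.1).1, (β_x _ hz.1).2]
    ring
  have sαx := contDiffOn_dX hO hα
  have fηx : ∀ z ∈ phaseDomain Ω, ∀ (a b : ℝ) (c : ℂ), fderiv ℝ (fderiv ℝ η) z (a, b, c) (0, 1, 0) =
      (a * dT (dX α) (base z) + b * dX (dX α) (base z)) * z.2.2 + dX α (base z) * c :=
    fun z hz a b c => by
      rw [← fderiv_fderiv_apply hD sη hz]
      have e1 : (fun y => fderiv ℝ η y (0, 1, 0)) =ᶠ[𝓝 z]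
          fun z => dX α (base z) * z.2.2 + (fun _ => 0) (base z) := by
        filter_upwards [hD.mem_nhds hz] with y hy
        rw [fη' y hy]; simp
      rw [e1.fderiv_eq]
      refine (fderiv_affine (β := fun _ => 0) (differentiableAt_of_contDiffOn hO sαx hz.1)
        (by fun_prop) a b c).trans ?_
      simp [dT, dX]
  have x_ne : ∀ p ∈ Ω, dX X p ≠ 0 := fun p hp => by
    have := (h _ (hlift p hp)).space_ne
    rw [fXx _ (hlift p hp)] at this
    simpa [base] using this
  refine ⟨T, X, α, hT, hX, hα, fun z hz => ?_, α_ne, fun p hp => ?_, fun p hp => ?_,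
    fun p hp c hc => ?_⟩
  · ext
    · exact (eT₁ z hz).trans (eT _ hz.1)
    · exact eX z hz
  · have hz := hlift p hp
    have := (h _ hz).time_t
    rw [fT' _ hz, fXx _ hz] at this
    simpa [base] using this
  · have hz := hlift p hp
    have h1 := main _ hz 1
    have h2 := main _ hz (-1)
    have hx : ((dX X p : ℝ) : ℂ) ≠ 0 := by exact_mod_cast x_ne p hp
    rw [hadd, haddB, fderiv_fderiv_symm hD sη hz (0, 1, 0) (0, 0, 1)] at h1
    rw [hadd, hnegB, hneg, fderiv_fderiv_symm hD sη hz (0, 1, 0) (0, 0, 1)] at h2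
    have h3 := fηx _ hz 0 0 1
    have h4 := fη' _ hz 0 0 1
    have hb : base (p.1, p.2, (1 : ℂ)) = p := rfl
    rw [h3, h4] at h1 h2
    rw [hb] at h1 h2
    simp at h1 h2
    field_simp at h1 h2
    linear_combination (h1 - h2) / 2
  · have hz : ((p.1, p.2, c) : TotalSpace) ∈ phaseDomain Ω := ⟨hp, hc⟩
    have h1 := main _ hz 0
    rw [fηx _ hz, fη' _ hz, fη' _ hz, fη' _ hz] at h1
    have hb : base (p.1, p.2, c) = p := rfl
    have hη : C (φ (p.1, p.2, c)).2.2 = α p * c := by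
      have := hηeq _ hz
      rw [hb, β_zero p hp, add_zero] at this
      exact this
    have hF : C (nlsF σ V' (φ (p.1, p.2, c))) =
        α p * c * (C σ * (Real.log ‖α p * c‖ : ℝ) + C (V' (T p.1, X p))) := by
      have e1 : base (φ (p.1, p.2, c)) = (T p.1, X p) := by
        ext
        · exact (eT₁ _ hz).trans (eT _ hz.1)
        · exact eX _ hz
      rw [nlsF, e1, ← Cnorm (φ (p.1, p.2, c)).2.2, map_add, Cmul, Cmul, Cmul, Creal, hη]
      ring
    rw [hF, hb] at h1
    simp only [nlsF, hb] at h1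
    apply mul_right_cancel₀ hc
    rw [zero_mul, ← h1]
    simp
    ring

end LogNLS

/-! ### Relation between the potentials of point-equivalent equations. -/

namespace LogNLS

variable {σ : ℂ} {Ω Ω' : Set (ℝ × ℝ)} {V V' : ℝ × ℝ → ℂ} {φ : TotalSpace → TotalSpace}

theorem dT_eq_of_section {F : Type*} [NormedAddCommGroup F] [NormedSpace ℝ F] {f : ℝ × ℝ → F}
    {p : ℝ × ℝ} (hf : DifferentiableAt ℝ f p) {g : ℝ → F} {g' : F} (hg : HasDerivAt g g' p.1)
    (h : ∀ᶠ t in 𝓝 p.1, f (t, p.2) = g t) : dT f p = g' :=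
  (hasDerivAt_dT hf).unique (hg.congr_of_eventuallyEq h)

theorem eventually_slice (hΩ : IsOpen Ω) {p : ℝ × ℝ} (hp : p ∈ Ω) :
    ∀ᶠ t in 𝓝 p.1, (t, p.2) ∈ Ω :=
  (Continuous.prodMk_left p.2).continuousAt.eventually (hΩ.mem_nhds hp)

/-- Solutions of `α_x = i s(t) α`. -/
theorem exists_eq_mul_exp (hΩ : IsPotentialDomain Ω) {α : ℝ × ℝ → ℂ} (hα : ContDiffOn ℝ ∞ α Ω)
    {s : ℝ → ℝ} (hs : ContDiffOn ℝ ∞ s (timeInterval Ω))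
    (h : ∀ p ∈ Ω, dX α p = I * s p.1 * α p) :
    ∃ l : ℝ → ℂ, ∀ p ∈ Ω, α p = l p.1 * exp (I * s p.1 * p.2) ∧
      dT α p = deriv l p.1 * exp (I * s p.1 * p.2) + I * (deriv s p.1 : ℝ) * p.2 * α p := by
  have hO := hΩ.isOpen
  have hJ := hΩ.isOpen_timeInterval
  have sp : ContDiffOn ℝ ∞ (fun p : ℝ × ℝ => I * (s p.1 : ℂ) * (p.2 : ℂ)) Ω :=
    (contDiffOn_const.mul (ofRealCLM.contDiff.comp_contDiffOn (contDiffOn_comp_fst hs))).mul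
      (ofRealCLM.contDiff.comp_contDiffOn contDiff_snd.contDiffOn)
  have sf : ContDiffOn ℝ ∞ (fun p => α p * exp (-(I * (s p.1 : ℂ) * (p.2 : ℂ)))) Ω :=
    hα.mul sp.neg.cexp
  obtain ⟨l, hl, el⟩ := hΩ.exists_eq_comp_fst sf fun p hp => by
    refine dX_eq_of_section (differentiableAt_of_contDiffOn hO sf hp)
      (((hasDerivAt_dX (differentiableAt_of_contDiffOn hO hα hp)).fun_mul
        ((hasDerivAt_ofReal p.2).const_mul (I * (s p.1 : ℂ))).fun_neg.cexp).congr_deriv ?_)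
      (Eventually.of_forall fun x => rfl)
    rw [h p hp]
    ring
  have eα : ∀ p ∈ Ω, α p = l p.1 * exp (I * s p.1 * p.2) := fun p hp => by
    rw [← el p hp, mul_assoc, ← Complex.exp_add]
    simp
  refine ⟨l, fun p hp => ⟨eα p hp, ?_⟩⟩
  have dl := hasDerivAt_deriv_of_contDiffOn hJ hl (mem_timeInterval hp)
  have ds := hasDerivAt_deriv_of_contDiffOn hJ hs (mem_timeInterval hp)
  refine dT_eq_of_section (differentiableAt_of_contDiffOn hO hα hp)
    ((dl.fun_mul ((ds.ofReal_comp.const_mul I).mul_const (p.2 : ℂ)).cexp).congr_deriv ?_)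
    ((eventually_slice hO hp).mono fun t ht => eα _ ht)
  rw [eα p hp]
  ring

/-- Comparing `ψ = 1` and `ψ = e` isolates the coefficient of the logarithm, `X_x² C σ = σ`. Norms
give `X_x² = 1`, with a constant sign by connectedness, and then `C σ = σ`, so time reversal is
possible only for real `σ`. -/
theorem TransformationForm.exists_sign (hσ : σ ≠ 0) (hΩ : IsPotentialDomain Ω) {m : ℝ}
    {C : ℂ →L[ℝ] ℂ} (Cnorm : ∀ w, ‖C w‖ = ‖w‖) {T : ℝ → ℝ} {X : ℝ × ℝ → ℝ} {α : ℝ × ℝ → ℂ}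
    (F : TransformationForm σ Ω V V' φ m C T X α) :
    C σ = σ ∧ ∃ ε : ℝ, ε * ε = 1 ∧ ∀ p ∈ Ω, dX X p = ε := by
  have h1 : ∀ p ∈ Ω, ((dX X p ^ 2 : ℝ) : ℂ) * C σ = σ := fun p hp => by
    have hα := F.a_ne p hp
    have c1 := F.const p hp 1 one_ne_zero
    have c2 := F.const p hp (Real.exp 1) (by exact_mod_cast (Real.exp_pos 1).ne')
    have e2 : Real.log ‖((Real.exp 1 : ℝ) : ℂ)‖ = 1 := by
      rw [norm_real, Real.norm_of_nonneg (Real.exp_pos 1).le, Real.log_exp]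
    have e1 : Real.log ‖α p * (Real.exp 1 : ℝ)‖ = Real.log ‖α p‖ + 1 := by
      rw [norm_mul, Real.log_mul (by simpa using hα) (by simp), e2]
    rw [e1, e2] at c2
    rw [mul_one, norm_one, Real.log_one] at c1
    push_cast at c1 c2 ⊢
    apply mul_left_cancel₀ hα
    linear_combination c2 - c1
  have h2 : ∀ p ∈ Ω, dX X p ^ 2 = 1 := fun p hp => by
    have := congrArg norm (h1 p hp)
    rw [norm_mul, Cnorm, norm_real] at this
    have h3 := (mul_eq_right₀ (norm_ne_zero_iff.2 hσ)).1 this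
    rwa [Real.norm_of_nonneg (sq_nonneg _)] at h3
  constructor
  · obtain ⟨p, hp⟩ := hΩ.exists_mem
    have := h1 p hp
    rwa [h2 p hp, ofReal_one, one_mul] at this
  · rcases hΩ.isConnected.isPreconnected.eq_one_or_eq_neg_one_of_sq_eq
      (contDiffOn_dX hΩ.isOpen F.smooth_X).continuousOn (fun p hp => by simpa using h2 p hp)
      with h | h
    · exact ⟨1, by norm_num, fun p hp => h hp⟩
    · exact ⟨-1, by norm_num, fun p hp => h hp⟩

/-- The relation between the potentials of two equations connected by a point transformation. -/
structure PotentialForm (Ω : Set (ℝ × ℝ)) (V : ℝ × ℝ → ℂ) (Ω' : Set (ℝ × ℝ)) (V' : ℝ × ℝ → ℂ)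
    (m ε c : ℝ) (ξ s : ℝ → ℝ) (h : ℝ → ℂ) : Prop where
  time_sq : m * m = 1
  space_sq : ε * ε = 1
  maps : ∀ p ∈ Ω, (m * p.1 + c, ε * p.2 + ξ p.1) ∈ Ω'
  surj : ∀ q ∈ Ω', ∃ p ∈ Ω, q = (m * p.1 + c, ε * p.2 + ξ p.1)
  re_eq : ∀ p ∈ Ω, (V' (m * p.1 + c, ε * p.2 + ξ p.1)).re = (V p).re + s p.1 * p.2 + (h p.1).re
  im_eq : ∀ p ∈ Ω, (V' (m * p.1 + c, ε * p.2 + ξ p.1)).im = m * ((V p).im + (h p.1).im)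

/-- Now `T = m t + c` and `X = ε x + ξ(t)`, and the multiplier is a function of `t` times `exp (i ε
ξ_t x / 2)`. Substitution shows that `C V'` differs from `V` by a real multiple of `x` plus a
function of `t`. -/
theorem PointEquivalent.exists_potentialForm (hσ : σ ≠ 0) (hΩ : IsPotentialDomain Ω)
    (hΩ' : IsPotentialDomain Ω') (h : PointEquivalent σ Ω V Ω' V') :
    ∃ m ε c ξ s h, PotentialForm Ω V Ω' V' m ε c ξ s h := by
  obtain ⟨φ, hφ, htr⟩ := h
  have hO := hΩ.isOpen
  have hJ := hΩ.isOpen_timeInterval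
  obtain ⟨m, hm, hpf⟩ := exists_uniform_pointForm hΩ hφ.1 fun z hz =>
    htr.exists_pointForm hO hΩ'.isOpen hφ hz
  obtain ⟨C, Cmul, Creal, CI, Cnorm⟩ := exists_conjugation hm
  obtain ⟨T, X, α, F⟩ := exists_transformationForm hΩ hφ.1 hφ.2.1 hpf Cmul Creal CI Cnorm hm
  obtain ⟨hC, ε, hε, hXx⟩ := F.exists_sign hσ hΩ Cnorm
  have sξ : ContDiffOn ℝ ∞ (fun p => X p - ε * p.2) Ω :=
    F.smooth_X.sub (contDiffOn_const.mul contDiff_snd.contDiffOn)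
  have dX_X := fun p hp => differentiableAt_of_contDiffOn hO F.smooth_X (x := p) hp
  obtain ⟨ξ, hξ, eξ⟩ := hΩ.exists_eq_comp_fst sξ fun p hp => by
    refine dX_eq_of_section (differentiableAt_of_contDiffOn hO sξ hp)
      (((hasDerivAt_dX (dX_X p hp)).fun_sub ((hasDerivAt_id p.2).const_mul ε)).congr_deriv ?_)
      (Eventually.of_forall fun x => rfl)
    rw [hXx p hp]; ring
  have eX : ∀ p ∈ Ω, X p = ε * p.2 + ξ p.1 := fun p hp => by rw [← eξ p hp]; ring
  have hXt : ∀ p ∈ Ω, dT X p = deriv ξ p.1 := fun p hp =>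
    dT_eq_of_section (dX_X p hp) ((hasDerivAt_deriv_of_contDiffOn hJ hξ
      (mem_timeInterval hp)).const_add (ε * p.2))
      ((eventually_slice hO hp).mono fun t ht => eX _ ht)
  have hXxx : ∀ p ∈ Ω, dX (dX X) p = 0 := fun p hp => by
    have : dX X =ᶠ[𝓝 p] fun _ => ε := by
      filter_upwards [hO.mem_nhds hp] with q hq using hXx q hq
    rw [dX, this.fderiv_eq]
    simp
  obtain ⟨p₀, hp₀⟩ := hΩ.exists_mem
  have hT : ∀ p ∈ Ω, T p.1 = m * p.1 + (T p₀.1 - m * p₀.1) := fun p hp => by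
    have sT : ContDiffOn ℝ ∞ (fun t => T t - m * t) (timeInterval Ω) :=
      F.smooth_T.sub (contDiffOn_const.mul contDiffOn_id)
    have := eq_const_of_deriv_eq_zero hJ hΩ.ordConnected_timeInterval sT (fun t ht => by
      obtain ⟨q, hq, rfl⟩ := ht
      have d := (hasDerivAt_deriv_of_contDiffOn hJ F.smooth_T (mem_timeInterval hq)).fun_sub
        ((hasDerivAt_id q.1).const_mul m)
      refine d.deriv.trans ?_
      rw [F.deriv_T q hq, hXx q hq, sq, hε]
      ring) (mem_timeInterval hp₀) (mem_timeInterval hp)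
    linarith
  have hε' : (ε : ℂ) * ε = 1 := by exact_mod_cast hε
  have hm' : (m : ℂ) * m = 1 := by exact_mod_cast hm
  have hdiv : ∀ w : ℂ, w / ε = ε * w := fun w => by
    have : (ε : ℂ) ≠ 0 := left_ne_zero_of_mul_eq_one hε'
    field_simp
    linear_combination -w * hε'
  -- the multiplier
  have hξ' := contDiffOn_deriv hJ hξ
  have αx : ∀ p ∈ Ω, dX α p = I * ((ε * deriv ξ p.1 / 2 : ℝ) : ℂ) * α p := fun p hp => by
    have := F.linear p hp
    rw [hXx p hp, hXxx p hp, hXt p hp, ofReal_zero] at this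
    push_cast
    linear_combination (ε : ℂ) / 2 * this - dX α p * hε'
  obtain ⟨l, hl⟩ := exists_eq_mul_exp hΩ F.smooth_a
    (s := fun t => ε * deriv ξ t / 2) ((contDiffOn_const.mul hξ').div_const 2) αx
  have αxx : ∀ p ∈ Ω, dX (dX α) p = (I * ((ε * deriv ξ p.1 / 2 : ℝ) : ℂ)) ^ 2 * α p := fun p hp => by
    rw [dX_eq_of_section (differentiableAt_of_contDiffOn hO (contDiffOn_dX hO F.smooth_a) hp)
      ((hasDerivAt_dX (differentiableAt_of_contDiffOn hO F.smooth_a hp)).const_mul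
        (I * ((ε * deriv ξ p.1 / 2 : ℝ) : ℂ)))
      ((eventually_section hO hp).mono fun x hx => αx (p.1, x) hx), αx p hp]
    ring
  -- The term free of `x` comes from the time-dependent factor `l` of the multiplier and the moving
  -- frame; the modulus of the multiplier depends on `t` only, because the remaining exponent is
  -- imaginary.
  let k : ℝ → ℂ := fun t => -I * deriv l t / l t - ((deriv ξ t ^ 2 / 4 : ℝ) : ℂ)
    - σ * (Real.log ‖l t‖ : ℝ)
  let s : ℝ → ℝ := deriv fun t => ε * deriv ξ t / 2
  have key : ∀ p ∈ Ω, C (V' (T p.1, X p)) = V p + s p.1 * p.2 + k p.1 := fun p hp => by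
    have c1 := F.const p hp 1 one_ne_zero
    obtain ⟨h1, h2⟩ := hl p hp
    have hα := F.a_ne p hp
    have hlog : Real.log ‖α p‖ = Real.log ‖l p.1‖ := by
      rw [h1, norm_mul, Complex.norm_exp]
      simp
    have hl0 : l p.1 ≠ 0 := fun h0 => hα (by rw [h1, h0, zero_mul])
    rw [mul_one, norm_one, Real.log_one, hlog, hC, hXx p hp, hXxx p hp, hXt p hp, h2, αxx p hp,
      αx p hp, hdiv] at c1
    have h3 : deriv l p.1 * exp (I * ((ε * deriv ξ p.1 / 2 : ℝ) : ℂ) * p.2) =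
        deriv l p.1 / l p.1 * α p := by
      rw [h1]; field_simp
    rw [h3] at c1
    simp only [k]
    apply mul_left_cancel₀ hα
    push_cast at c1 ⊢
    linear_combination c1 + (-(s p.1 : ℂ) * p.2 * α p
      + α p * ((deriv ξ p.1 : ℝ) : ℂ) ^ 2 * ε ^ 2 / 4) * I_sq
      - (α p * ((deriv ξ p.1 : ℝ) : ℂ) ^ 2 / 4
        + α p * (σ * (Real.log ‖l p.1‖ : ℝ) + C (V' (T p.1, X p)))) * hε'
  have hCw : ∀ w : ℂ, C w = w.re + m * w.im * I := fun w => by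
    conv_lhs => rw [← re_add_im w]
    rw [map_add, Cmul, Creal, Creal, CI]
    ring
  refine ⟨m, ε, T p₀.1 - m * p₀.1, ξ, s, k, hm, hε, fun p hp => ?_, fun q hq => ?_, fun p hp => ?_,
    fun p hp => ?_⟩
  · have hz : ((p.1, p.2, 1) : TotalSpace) ∈ phaseDomain Ω := ⟨hp, one_ne_zero⟩
    have e := F.base_eq _ hz
    rw [← hT p hp, ← eX p hp]
    have := (hφ.2.1 hz).1
    rw [e] at this
    exact this
  · obtain ⟨-, -, g, -, hg, -, hr⟩ := hφ
    have hz : ((q.1, q.2, 1) : TotalSpace) ∈ phaseDomain Ω' := ⟨hq, one_ne_zero⟩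
    refine ⟨base (g (q.1, q.2, 1)), (hg hz).1, ?_⟩
    have e := F.base_eq _ (hg hz)
    rw [hr hz] at e
    rw [← hT _ (hg hz).1, ← eX _ (hg hz).1]
    exact e
  · have := congrArg Complex.re (key p hp)
    rw [hCw] at this
    rw [← hT p hp, ← eX p hp]
    simpa using this
  · have := congrArg Complex.im (key p hp)
    rw [hCw] at this
    rw [← hT p hp, ← eX p hp]
    simp at this
    linear_combination m * this - (V' (T p.1, X p)).im * hm

end LogNLS

/-! ### Invariants, inequivalence and the generic cases. -/

namespace LogNLS

variable {σ : ℂ} {Ω Ω' : Set (ℝ × ℝ)} {V V' : ℝ × ℝ → ℂ}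

theorem GroupEquivalent.pointEquivalent (h : GroupEquivalent σ Ω V Ω' V') :
    PointEquivalent σ Ω V Ω' V' := by
  obtain ⟨φ, θ, h1, h2⟩ := h
  exact ⟨φ, h1.1, h2.2⟩

theorem dX_quadratic (hV : IsPotential Ω V) {a : ℝ → ℝ} {b c : ℝ → ℂ}
    (h : ∀ p ∈ Ω, V p = a p.1 * (p.2 : ℂ) ^ 2 + b p.1 * (p.2 : ℂ) + c p.1) :
    (∀ p ∈ Ω, dX V p = 2 * a p.1 * p.2 + b p.1) ∧ (∀ p ∈ Ω, dX (dX V) p = (2 * a p.1 : ℝ)) ∧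
      ∀ p ∈ Ω, dX (dX (dX V)) p = 0 := by
  have hO := hV.domain.isOpen
  have s1 := contDiffOn_dX hO hV.smooth
  have s2 := contDiffOn_dX hO s1
  have h1 : ∀ p ∈ Ω, dX V p = 2 * a p.1 * p.2 + b p.1 := fun p hp =>
    dX_eq_of_section (hV.differentiableAt hp)
      ((((((hasDerivAt_ofReal p.2).fun_pow 2).const_mul (a p.1 : ℂ)).fun_add
        ((hasDerivAt_ofReal p.2).const_mul (b p.1))).add_const (c p.1)).congr_deriv (by simp; ring))
      ((eventually_section hO hp).mono fun x hx => h (p.1, x) hx)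
  have h2 : ∀ p ∈ Ω, dX (dX V) p = (2 * a p.1 : ℝ) := fun p hp =>
    dX_eq_of_section (differentiableAt_of_contDiffOn hO s1 hp)
      ((((hasDerivAt_ofReal p.2).const_mul (2 * a p.1 : ℂ)).add_const (b p.1)).congr_deriv (by simp))
      ((eventually_section hO hp).mono fun x hx => h1 (p.1, x) hx)
  refine ⟨h1, h2, fun p hp => ?_⟩
  exact dX_eq_of_section (differentiableAt_of_contDiffOn hO s2 hp)
      (hasDerivAt_const p.2 (((2 * a p.1 : ℝ)) : ℂ))
      ((eventually_section hO hp).mono fun x hx => h2 (p.1, x) hx)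

/-- A pointwise criterion in terms of `x`-derivatives, which is easy to transport along a
transformation. -/
theorem isQuadratic_iff (hV : IsPotential Ω V) : IsQuadratic Ω V ↔
    (∀ p ∈ Ω, dX (dX (dX V)) p = 0) ∧ ∀ p ∈ Ω, (dX (dX V) p).im = 0 := by
  constructor
  · rintro ⟨a, b, c, -, -, -, h⟩
    obtain ⟨-, h2, h3⟩ := dX_quadratic hV h
    exact ⟨h3, fun p hp => by rw [h2 p hp, ofReal_im]⟩
  · rintro ⟨h1, h2⟩
    exact isQuadratic_of_dX hV h1 h2

theorem IsReduced.isQuadratic {v w : ℝ → ℝ} (h : IsReduced Ω V v w) : IsQuadratic Ω V :=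
  ⟨v, fun t => I * w t, 0, h.smooth_v,
    contDiffOn_const.mul (ofRealCLM.contDiff.comp_contDiffOn h.smooth_w), contDiffOn_const,
    fun p hp => by simpa using h.eq p hp⟩

theorem IsReduced.dX_eq (hV : IsPotential Ω V) {v w : ℝ → ℝ} (h : IsReduced Ω V v w) :
    (∀ p ∈ Ω, dX V p = 2 * v p.1 * p.2 + I * w p.1) ∧ (∀ p ∈ Ω, dX (dX V) p = (2 * v p.1 : ℝ)) := by
  obtain ⟨h1, h2, -⟩ := dX_quadratic hV (a := v) (b := fun t => I * w t) (c := 0)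
    (fun p hp => by simpa using h.eq p hp)
  exact ⟨h1, h2⟩

/-- The derivatives of the potentials of equations connected by a point transformation. -/
theorem PotentialForm.derivatives (hV : IsPotential Ω V) (hV' : IsPotential Ω' V') {m ε c : ℝ}
    {ξ s : ℝ → ℝ} {h : ℝ → ℂ} (F : PotentialForm Ω V Ω' V' m ε c ξ s h) {p : ℝ × ℝ} (hp : p ∈ Ω) :
    ε * (dX V' (m * p.1 + c, ε * p.2 + ξ p.1)).im = m * (dX V p).im ∧
    (dX (dX V') (m * p.1 + c, ε * p.2 + ξ p.1)).re = (dX (dX V) p).re ∧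
    (dX (dX V') (m * p.1 + c, ε * p.2 + ξ p.1)).im = m * (dX (dX V) p).im ∧
    ε * (dX (dX (dX V')) (m * p.1 + c, ε * p.2 + ξ p.1)).re = (dX (dX (dX V)) p).re ∧
    ε * (dX (dX (dX V')) (m * p.1 + c, ε * p.2 + ξ p.1)).im = m * (dX (dX (dX V)) p).im := by
  have hO := hV.domain.isOpen
  have hO' := hV'.domain.isOpen
  have s1 := contDiffOn_dX hO hV.smooth
  have s2 := contDiffOn_dX hO s1
  have s1' := contDiffOn_dX hO' hV'.smooth
  have s2' := contDiffOn_dX hO' s1'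
  have slice : ∀ {f : ℝ × ℝ → ℂ}, ContDiffOn ℝ ∞ f Ω → ∀ p ∈ Ω,
      HasDerivAt (fun x => f (p.1, x)) (dX f p) p.2 := fun hf p hp =>
    hasDerivAt_dX (differentiableAt_of_contDiffOn hO hf hp)
  have slice' : ∀ {f : ℝ × ℝ → ℂ}, ContDiffOn ℝ ∞ f Ω' → ∀ p ∈ Ω,
      HasDerivAt (fun x => f (m * p.1 + c, ε * x + ξ p.1))
        (ε * dX f (m * p.1 + c, ε * p.2 + ξ p.1)) p.2 := fun {f} hf p hp => by
    have d1 := (differentiableAt_of_contDiffOn hO' hf (F.maps p hp)).hasFDerivAt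
    have l : HasDerivAt (fun x => (m * p.1 + c, ε * x + ξ p.1)) ((0 : ℝ), ε) p.2 :=
      (hasDerivAt_const _ _).prodMk
        ((((hasDerivAt_id p.2).const_mul ε).add_const (ξ p.1)).congr_deriv (by simp))
    refine (d1.comp_hasDerivAt p.2 l).congr_deriv ?_
    rw [fderiv_prod_apply]
    simp
  have im_of : ∀ {f : ℝ → ℂ} {f' : ℂ} {x : ℝ}, HasDerivAt f f' x →
      HasDerivAt (fun x => (f x).im) f'.im x := fun h => imCLM.hasFDerivAt.comp_hasDerivAt _ h
  have ev := fun p hp => eventually_section hO (p := p) hp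
  have r1 : ∀ p ∈ Ω, ε * (dX V' (m * p.1 + c, ε * p.2 + ξ p.1)).re = (dX V p).re + s p.1 :=
    fun p hp => by
      have d1 := hasDerivAt_re (slice' hV'.smooth p hp)
      have d2 := ((hasDerivAt_re (slice hV.smooth p hp)).fun_add
        ((hasDerivAt_id p.2).const_mul (s p.1))).add_const (h p.1).re
      have := d1.unique (d2.congr_of_eventuallyEq ((ev p hp).mono fun x hx => F.re_eq (p.1, x) hx))
      simpa using this
  have i1 : ∀ p ∈ Ω, ε * (dX V' (m * p.1 + c, ε * p.2 + ξ p.1)).im = m * (dX V p).im :=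
    fun p hp => by
      have d1 := im_of (slice' hV'.smooth p hp)
      have d2 := ((im_of (slice hV.smooth p hp)).add_const (h p.1).im).const_mul m
      have := d1.unique (d2.congr_of_eventuallyEq ((ev p hp).mono fun x hx => F.im_eq (p.1, x) hx))
      simpa using this
  have r2 : ∀ p ∈ Ω, (dX (dX V') (m * p.1 + c, ε * p.2 + ξ p.1)).re = (dX (dX V) p).re :=
    fun p hp => by
      have d1 := (hasDerivAt_re (slice' s1' p hp)).const_mul ε
      have d2 := (hasDerivAt_re (slice s1 p hp)).add_const (s p.1)
      have := d1.unique (d2.congr_of_eventuallyEq ((ev p hp).mono fun x hx => r1 (p.1, x) hx))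
      rw [re_ofReal_mul, ← mul_assoc, F.space_sq, one_mul] at this
      exact this
  have i2 : ∀ p ∈ Ω, (dX (dX V') (m * p.1 + c, ε * p.2 + ξ p.1)).im = m * (dX (dX V) p).im :=
    fun p hp => by
      have d1 := (im_of (slice' s1' p hp)).const_mul ε
      have d2 := (im_of (slice s1 p hp)).const_mul m
      have := d1.unique (d2.congr_of_eventuallyEq ((ev p hp).mono fun x hx => i1 (p.1, x) hx))
      rw [im_ofReal_mul, ← mul_assoc, F.space_sq, one_mul] at this
      exact this
  refine ⟨i1 p hp, r2 p hp, i2 p hp, ?_, ?_⟩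
  · have d1 := hasDerivAt_re (slice' s2' p hp)
    have d2 := hasDerivAt_re (slice s2 p hp)
    have := d1.unique (d2.congr_of_eventuallyEq ((ev p hp).mono fun x hx => r2 (p.1, x) hx))
    rwa [re_ofReal_mul] at this
  · have d1 := im_of (slice' s2' p hp)
    have d2 := (im_of (slice s2 p hp)).const_mul m
    have := d1.unique (d2.congr_of_eventuallyEq ((ev p hp).mono fun x hx => i2 (p.1, x) hx))
    rwa [im_ofReal_mul] at this

/-- The added terms are affine in `x`, so `V_xx` and `V_xxx` are preserved up to signs of their real
and imaginary parts, and every point of the new domain is attained. -/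
theorem PointEquivalent.isQuadratic_iff (hσ : σ ≠ 0) (hV : IsPotential Ω V)
    (hV' : IsPotential Ω' V') (h : PointEquivalent σ Ω V Ω' V') :
    IsQuadratic Ω V ↔ IsQuadratic Ω' V' := by
  obtain ⟨m, ε, c, ξ, s, h, F⟩ := h.exists_potentialForm hσ hV.domain hV'.domain
  have hm : m ≠ 0 := left_ne_zero_of_mul_eq_one F.time_sq
  have hε : ε ≠ 0 := left_ne_zero_of_mul_eq_one F.space_sq
  rw [LogNLS.isQuadratic_iff hV, LogNLS.isQuadratic_iff hV']
  constructor
  · rintro ⟨h1, h2⟩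
    constructor
    · intro q hq
      obtain ⟨p, hp, rfl⟩ := F.surj q hq
      obtain ⟨-, -, -, e1, e2⟩ := F.derivatives hV hV' hp
      rw [h1 p hp] at e1 e2
      apply Complex.ext
      · simpa [hε] using e1
      · simpa [hε] using e2
    · intro q hq
      obtain ⟨p, hp, rfl⟩ := F.surj q hq
      rw [(F.derivatives hV hV' hp).2.2.1, h2 p hp, mul_zero]
  · rintro ⟨h1, h2⟩
    constructor
    · intro p hp
      obtain ⟨-, -, -, e1, e2⟩ := F.derivatives hV hV' hp
      rw [h1 _ (F.maps p hp)] at e1 e2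
      apply Complex.ext
      · simpa using e1.symm
      · simpa [hm] using e2.symm
    · intro p hp
      have e := (F.derivatives hV hV' hp).2.2.1
      rw [h2 _ (F.maps p hp)] at e
      simpa [hm] using e.symm

/-- The relation between the parameters of reduced potentials. -/
theorem PotentialForm.reduced (hV : IsPotential Ω V) (hV' : IsPotential Ω' V') {m ε c : ℝ}
    {ξ s : ℝ → ℝ} {h : ℝ → ℂ} (F : PotentialForm Ω V Ω' V' m ε c ξ s h) {v w v' w' : ℝ → ℝ}
    (hr : IsReduced Ω V v w) (hr' : IsReduced Ω' V' v' w') {t : ℝ} (ht : t ∈ timeInterval Ω) :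
    v' (m * t + c) = v t ∧ w' (m * t + c) ^ 2 = w t ^ 2 := by
  obtain ⟨p, hp, rfl⟩ := ht
  obtain ⟨h1, h2⟩ := hr.dX_eq hV
  obtain ⟨h1', h2'⟩ := hr'.dX_eq hV'
  obtain ⟨e1, e2, -⟩ := F.derivatives hV hV' hp
  have hq := F.maps p hp
  rw [h2 p hp, h2' _ hq] at e2
  rw [h1 p hp, h1' _ hq] at e1
  simp at e1 e2
  refine ⟨e2, ?_⟩
  have e3 := congrArg (fun x => x ^ 2) e1
  simp only [mul_pow, sq ε, sq m, F.space_sq, F.time_sq, one_mul] at e3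
  exact e3

theorem IsSpecialized.exists_isCase (h : IsSpecialized Ω V) : ∃ n, IsCase σ n Ω V := by
  rcases h with h | h | h | h
  · exact ⟨2, h⟩
  · exact ⟨3, h⟩
  · exact ⟨4, h⟩
  · exact ⟨5, h⟩

theorem IsSpecialized.isQuadratic (h : IsSpecialized Ω V) : IsQuadratic Ω V := by
  rcases h with ⟨v, w, h⟩ | ⟨ν, h⟩ | ⟨μ, ν, h⟩ | ⟨μ, ν, h⟩
  · exact h.isReduced.isQuadratic
  · exact h.isReduced.isQuadratic
  · exact h.isReduced.isQuadratic
  · exact h.isReduced.isQuadratic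

theorem IsCase1.not_isQuadratic (hV : IsPotential Ω V) (h : IsCase1 σ Ω V) :
    ¬ IsQuadratic Ω V := fun hq => by
  obtain ⟨Ω', V', hV', hs, he⟩ := hq.exists_specialized hV σ
  exact h.2 Ω' V' hV' hs he

/-- A Case 1 potential is not quadratic, for otherwise it would be equivalent to one from Cases 2-5.
Hence every symmetry with `τ = 0` has `χ = 0`. -/
theorem IsCase1.basis (hσ : σ ≠ 0) (hV : IsPotential Ω V) (h : IsCase1 σ Ω V) :
    HasBasis Ω (lieAlgebra σ Ω V) ![fieldM, fieldI' σ, fieldDt] := by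
  refine hasBasis_MI'Dt hσ hV h.1 fun χ ρ hs => ?_
  by_contra! hne
  exact h.not_isQuadratic hV (hs.isQuadratic hV hne)

/-- Such a potential is not quadratic, so `χ = 0` once `τ = 0`. A symmetry with `τ ≠ 0` can be
rescaled to `τ = 1` and would make the potential equivalent to a stationary one. -/
theorem hasBasis_of_not_equivalent (hσ : σ ≠ 0) (hV : IsPotential Ω V)
    (h : ∀ n Ω' V', IsPotential Ω' V' → IsCase σ n Ω' V' → ¬ GroupEquivalent σ Ω V Ω' V') :
    HasBasis Ω (lieAlgebra σ Ω V) ![fieldM, fieldI' σ] := by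
  have hq : ¬ IsQuadratic Ω V := fun hq => by
    obtain ⟨Ω', V', hV', hs, he⟩ := hq.exists_specialized hV σ
    obtain ⟨n, hn⟩ := hs.exists_isCase (σ := σ)
    exact h n Ω' V' hV' hn he
  refine hasBasis_MI' hσ hV fun τ χ ρ hs => ?_
  have hτ : τ = 0 := by
    by_contra hτ
    have hs' := hs.linear hV.domain hs (1 / τ) 0
    rw [zero_mul, add_zero, one_div_mul_cancel hτ] at hs'
    obtain ⟨Ω', V', hV', hst, he⟩ := hs'.exists_stationary hV
    -- The stationary potential is of Case 1: if it were equivalent to a potential of Cases 2-5,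
    -- invariance of being quadratic would make `V` quadratic. Thus no composition of equivalence
    -- transformations is needed.
    refine h 1 Ω' V' hV' ⟨hst, fun Ω'' V'' hV'' hsp he' => hq ?_⟩ he
    rw [he.pointEquivalent.isQuadratic_iff hσ hV hV',
      he'.pointEquivalent.isQuadratic_iff hσ hV' hV'']
    exact hsp.isQuadratic
  subst hτ
  refine ⟨rfl, ?_⟩
  by_contra! hne
  exact hq (hs.isQuadratic hV hne)

/-- The parameters `v`, `w²` of a reduced potential are constant. -/
def IsConstantData (J : Set ℝ) (v w : ℝ → ℝ) : Prop := ∃ a b : ℝ, ∀ t ∈ J, v t = a ∧ w t ^ 2 = b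

/-- The reduced potentials with the parameters `v`, `w` belong to Case `n`. -/
def IsKind (n : ℕ) (J : Set ℝ) (v w : ℝ → ℝ) : Prop :=
  (n = 2 ∧ ¬ IsConstantData J v w) ∨ (n = 3 ∧ IsConstantData J v w ∧ ∀ t ∈ J, v t = 0) ∨
    (n = 4 ∧ IsConstantData J v w ∧ ∀ t ∈ J, 0 < v t) ∨
    (n = 5 ∧ IsConstantData J v w ∧ ∀ t ∈ J, v t < 0)

/-- Constancy of `w²` gives `w w_t = 0`. If `w_t ≠ 0` at some point, then `w = 0` there, so the
constant is zero and `w` vanishes nearby, a contradiction. Squares are used because a reflection or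
time reversal may change the sign of `w`. -/
theorem IsCase2.not_isConstantData (hΩ : IsPotentialDomain Ω) {v w : ℝ → ℝ}
    (h : IsCase2 Ω V v w) : ¬ IsConstantData (timeInterval Ω) v w := by
  rintro ⟨a, b, hab⟩
  obtain ⟨hv, hw, ⟨t, ht, hne⟩, -⟩ := h
  have hJ := hΩ.isOpen_timeInterval
  have hn := hJ.mem_nhds ht
  have dv : deriv v t = 0 := by
    have : v =ᶠ[𝓝 t] fun _ => a := by filter_upwards [hn] with s hs using (hab s hs).1
    rw [this.deriv_eq, deriv_const]
  have dw : 2 * w t * deriv w t = 0 := by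
    have d1 := (hasDerivAt_deriv_of_contDiffOn hJ hw ht).fun_pow 2
    have d2 : (fun s => w s ^ 2) =ᶠ[𝓝 t] fun _ => b := by
      filter_upwards [hn] with s hs using (hab s hs).2
    simpa using d1.unique ((hasDerivAt_const t b).congr_of_eventuallyEq d2)
  rcases hne with hne | hne
  · exact hne dv
  · have w0 : w t = 0 := by simpa [hne] using dw
    have b0 : b = 0 := by rw [← (hab t ht).2, w0]; simp
    have : w =ᶠ[𝓝 t] fun _ => 0 := by
      filter_upwards [hn] with s hs
      have := (hab s hs).2
      rw [b0] at this
      exact pow_eq_zero_iff two_ne_zero |>.1 this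
    exact hne (by rw [this.deriv_eq, deriv_const])

theorem IsCase.reduced (hΩ : IsPotentialDomain Ω) {n : ℕ} (h : IsCase σ n Ω V) :
    (n = 1 ∧ IsCase1 σ Ω V) ∨ ∃ v w, IsReduced Ω V v w ∧ IsKind n (timeInterval Ω) v w := by
  match n, h with
  | 1, h => exact Or.inl ⟨rfl, h⟩
  | 2, ⟨v, w, h⟩ => exact Or.inr ⟨v, w, h.isReduced, Or.inl ⟨rfl, h.not_isConstantData hΩ⟩⟩
  | 3, ⟨ν, h⟩ =>
    exact Or.inr ⟨_, _, h.isReduced, Or.inr (Or.inl ⟨rfl, ⟨0, ν ^ 2, by simp⟩, by simp⟩)⟩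
  | 4, ⟨μ, ν, h⟩ =>
    exact Or.inr ⟨_, _, h.isReduced, Or.inr (Or.inr (Or.inl
      ⟨rfl, ⟨μ ^ 2, ν ^ 2, by simp⟩, fun t _ => pow_pos h.1 2⟩))⟩
  | 5, ⟨μ, ν, h⟩ =>
    exact Or.inr ⟨_, _, h.isReduced, Or.inr (Or.inr (Or.inr
      ⟨rfl, ⟨-μ ^ 2, ν ^ 2, by simp⟩, fun t _ => neg_neg_of_pos (pow_pos h.1 2)⟩))⟩

theorem IsKind.eq {n n' : ℕ} {J : Set ℝ} {v w : ℝ → ℝ} (hJ : J.Nonempty) (h : IsKind n J v w)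
    (h' : IsKind n' J v w) : n = n' := by
  obtain ⟨t, ht⟩ := hJ
  rcases h with ⟨rfl, h⟩ | ⟨rfl, h, hs⟩ | ⟨rfl, h, hs⟩ | ⟨rfl, h, hs⟩ <;>
    rcases h' with ⟨rfl, h'⟩ | ⟨rfl, h', hs'⟩ | ⟨rfl, h', hs'⟩ | ⟨rfl, h', hs'⟩ <;>
    first
      | rfl
      | exact absurd h' h
      | exact absurd h h'
      | exact absurd h'.1 h
      | (have h1 := hs t ht
         have h2 := hs' t ht
         linarith)

/-- The time change `t ↦ m t + c` maps one time interval onto the other and preserves `v` and `w²`,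
in terms of which the cases are distinguished. -/
theorem PotentialForm.isKind (hV : IsPotential Ω V) (hV' : IsPotential Ω' V') {m ε c : ℝ}
    {ξ s : ℝ → ℝ} {h : ℝ → ℂ} (F : PotentialForm Ω V Ω' V' m ε c ξ s h) {v w v' w' : ℝ → ℝ}
    (hr : IsReduced Ω V v w) (hr' : IsReduced Ω' V' v' w') {n : ℕ}
    (hn : IsKind n (timeInterval Ω') v' w') : IsKind n (timeInterval Ω) v w := by
  have hmap : ∀ t ∈ timeInterval Ω, m * t + c ∈ timeInterval Ω' := by
    rintro _ ⟨p, hp, rfl⟩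
    exact ⟨_, F.maps p hp, rfl⟩
  have hsurj : ∀ t' ∈ timeInterval Ω', ∃ t ∈ timeInterval Ω, t' = m * t + c := by
    rintro _ ⟨q, hq, rfl⟩
    obtain ⟨p, hp, rfl⟩ := F.surj q hq
    exact ⟨p.1, mem_timeInterval hp, rfl⟩
  have hred := fun t ht => F.reduced hV hV' hr hr' (t := t) ht
  have hconst : IsConstantData (timeInterval Ω) v w ↔ IsConstantData (timeInterval Ω') v' w' := by
    constructor
    · rintro ⟨a, b, hab⟩
      refine ⟨a, b, fun t' ht' => ?_⟩
      obtain ⟨t, ht, rfl⟩ := hsurj t' ht'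
      rw [(hred t ht).1, (hred t ht).2]
      exact hab t ht
    · rintro ⟨a, b, hab⟩
      refine ⟨a, b, fun t ht => ?_⟩
      rw [← (hred t ht).1, ← (hred t ht).2]
      exact hab _ (hmap t ht)
  unfold IsKind
  rw [hconst]
  rcases hn with ⟨rfl, h⟩ | ⟨rfl, h, hs⟩ | ⟨rfl, h, hs⟩ | ⟨rfl, h, hs⟩
  · exact Or.inl ⟨rfl, h⟩
  · exact Or.inr (Or.inl ⟨rfl, h, fun t ht => (hred t ht).1 ▸ hs _ (hmap t ht)⟩)
  · exact Or.inr (Or.inr (Or.inl ⟨rfl, h, fun t ht => (hred t ht).1 ▸ hs _ (hmap t ht)⟩))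
  · exact Or.inr (Or.inr (Or.inr ⟨rfl, h, fun t ht => (hred t ht).1 ▸ hs _ (hmap t ht)⟩))

theorem PointEquivalent.isCase_eq (hσ : σ ≠ 0) (hV : IsPotential Ω V) (hV' : IsPotential Ω' V')
    (h : PointEquivalent σ Ω V Ω' V') {n n' : ℕ} (hn : IsCase σ n Ω V) (hn' : IsCase σ n' Ω' V') :
    n = n' := by
  have hq := h.isQuadratic_iff hσ hV hV'
  obtain ⟨m, ε, c, ξ, s, h, F⟩ := h.exists_potentialForm hσ hV.domain hV'.domain
  rcases hn.reduced hV.domain with ⟨rfl, h1⟩ | ⟨v, w, hr, hk⟩ <;>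
    rcases hn'.reduced hV'.domain with ⟨rfl, h1'⟩ | ⟨v', w', hr', hk'⟩
  · rfl
  · exact absurd (hq.2 hr'.isQuadratic) (h1.not_isQuadratic hV)
  · exact absurd (hq.1 hr.isQuadratic) (h1'.not_isQuadratic hV')
  · obtain ⟨p, hp⟩ := hV.domain.exists_mem
    exact hk.eq ⟨p.1, mem_timeInterval hp⟩ (F.isKind hV hV' hr hr' hk')

/-- Only `ν²` is invariant; the normalization `ν ≥ 0` recovers `ν`. -/
theorem PointEquivalent.reduced_const (hσ : σ ≠ 0) (hV : IsPotential Ω V)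
    (hV' : IsPotential Ω' V') (h : PointEquivalent σ Ω V Ω' V') {a a' ν ν' : ℝ} (hν : 0 ≤ ν)
    (hν' : 0 ≤ ν') (hr : IsReduced Ω V (fun _ => a) fun _ => ν)
    (hr' : IsReduced Ω' V' (fun _ => a') fun _ => ν') : a = a' ∧ ν = ν' := by
  obtain ⟨m, ε, c, ξ, s, h, F⟩ := h.exists_potentialForm hσ hV.domain hV'.domain
  obtain ⟨p, hp⟩ := hV.domain.exists_mem
  obtain ⟨h1, h2⟩ := F.reduced hV hV' hr hr' (mem_timeInterval hp)
  exact ⟨h1.symm, (pow_left_inj₀ hν hν' two_ne_zero).1 h2.symm⟩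

end LogNLS

/-! ### The classification. -/

theorem mainTheorem7 (σ : ℂ) (hσ : σ ≠ 0) :
    -- the common part of the maximal Lie invariance algebras
    (∀ Ω, LogNLS.IsPotentialDomain Ω →
      LogNLS.HasBasis Ω (LogNLS.kernelAlgebra σ Ω) ![LogNLS.fieldM, LogNLS.fieldI' σ]) ∧
    -- completeness of the list
    (∀ Ω V, LogNLS.IsPotential Ω V →
      LogNLS.lieAlgebra σ Ω V ≠ LogNLS.kernelAlgebra σ Ω →
      ∃ n Ω' V', LogNLS.IsPotential Ω' V' ∧ LogNLS.IsCase σ n Ω' V' ∧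
        LogNLS.GroupEquivalent σ Ω V Ω' V') ∧
    -- Case 0
    (∀ Ω V, LogNLS.IsPotential Ω V →
      (∀ n Ω' V', LogNLS.IsPotential Ω' V' → LogNLS.IsCase σ n Ω' V' →
        ¬ LogNLS.GroupEquivalent σ Ω V Ω' V') →
      LogNLS.HasBasis Ω (LogNLS.lieAlgebra σ Ω V) ![LogNLS.fieldM, LogNLS.fieldI' σ]) ∧
    -- Case 1
    (∀ Ω V, LogNLS.IsPotential Ω V → LogNLS.IsCase1 σ Ω V →
      LogNLS.HasBasis Ω (LogNLS.lieAlgebra σ Ω V)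
        ![LogNLS.fieldM, LogNLS.fieldI' σ, LogNLS.fieldDt]) ∧
    -- Case 2
    (∀ Ω V, LogNLS.IsPotential Ω V → ∀ v w, LogNLS.IsCase2 Ω V v w →
      (∃ χ₁ χ₂, LogNLS.IsFundamentalSystem (LogNLS.timeInterval Ω) v χ₁ χ₂) ∧
      ∀ χ₁ χ₂, LogNLS.IsFundamentalSystem (LogNLS.timeInterval Ω) v χ₁ χ₂ →
        LogNLS.HasNonstationaryBasis σ Ω V w χ₁ χ₂) ∧
    -- Case 3
    (∀ Ω V, LogNLS.IsPotential Ω V → ∀ ν, LogNLS.IsCase3 Ω V ν →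
      LogNLS.HasStationaryBasis σ Ω V (fun _ => ν) (fun _ => 1) (fun t => t)) ∧
    -- Case 4
    (∀ Ω V, LogNLS.IsPotential Ω V → ∀ μ ν, LogNLS.IsCase4 Ω V μ ν →
      LogNLS.HasStationaryBasis σ Ω V (fun _ => ν)
        (fun t => Real.exp (-2 * μ * t)) (fun t => Real.exp (2 * μ * t))) ∧
    -- Case 5
    (∀ Ω V, LogNLS.IsPotential Ω V → ∀ μ ν, LogNLS.IsCase5 Ω V μ ν →
      LogNLS.HasStationaryBasis σ Ω V (fun _ => ν)
        (fun t => Real.cos (2 * μ * t)) (fun t => Real.sin (2 * μ * t))) ∧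
    -- inequivalence of different cases and, in Cases 3-5, of different values of the parameters
    (∀ Ω V Ω' V', LogNLS.IsPotential Ω V → LogNLS.IsPotential Ω' V' →
      LogNLS.PointEquivalent σ Ω V Ω' V' →
      (∀ n n', LogNLS.IsCase σ n Ω V → LogNLS.IsCase σ n' Ω' V' → n = n') ∧
      (∀ ν ν', LogNLS.IsCase3 Ω V ν → LogNLS.IsCase3 Ω' V' ν' → ν = ν') ∧
      (∀ μ ν μ' ν', LogNLS.IsCase4 Ω V μ ν → LogNLS.IsCase4 Ω' V' μ' ν' → μ = μ' ∧ ν = ν') ∧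
      (∀ μ ν μ' ν', LogNLS.IsCase5 Ω V μ ν → LogNLS.IsCase5 Ω' V' μ' ν' → μ = μ' ∧ ν = ν')) := by
  have case0 := fun Ω V hV h => LogNLS.hasBasis_of_not_equivalent (Ω := Ω) (V := V) hσ hV h
  refine ⟨fun Ω hΩ => LogNLS.hasBasis_kernelAlgebra hσ hΩ, fun Ω V hV hne => ?_, case0,
    fun Ω V hV h => h.basis hσ hV, fun Ω V hV v w h => h.basis hσ hV,
    fun Ω V hV ν h => h.basis hσ hV, fun Ω V hV μ ν h => h.basis hσ hV,
    fun Ω V hV μ ν h => h.basis hσ hV, fun Ω V Ω' V' hV hV' he =>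
      ⟨fun n n' hn hn' => he.isCase_eq hσ hV hV' hn hn', fun ν ν' h h' => ?_,
        fun μ ν μ' ν' h h' => ?_, fun μ ν μ' ν' h h' => ?_⟩⟩
  -- If no listed case were equivalent, the Case 0 basis would span both the algebra and the kernel.
  · by_contra! hno
    exact hne ((case0 Ω V hV hno).2.symm.trans (LogNLS.hasBasis_kernelAlgebra hσ hV.domain).2)
  · exact (he.reduced_const hσ hV hV' h.1 h'.1 h.isReduced h'.isReduced).2
  · obtain ⟨h1, h2⟩ := he.reduced_const hσ hV hV' h.2.1 h'.2.1 h.isReduced h'.isReduced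
    exact ⟨(pow_left_inj₀ h.1.le h'.1.le two_ne_zero).1 h1, h2⟩
  · obtain ⟨h1, h2⟩ := he.reduced_const hσ hV hV' h.2.1 h'.2.1 h.isReduced h'.isReduced
    exact ⟨(pow_left_inj₀ h.1.le h'.1.le two_ne_zero).1 (neg_injective h1), h2⟩
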